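/- Let $\mathcal O$ be a discrete valuation ring with fraction field $E$ and residue field $\mathbb F$ (for instance the ring of integers in a finite extension $E$ of $\mathbb Q_\ell$). Let $\mathcal N^{2,2}$ be the affine $\mathcal O$-scheme of triples $(X_1,N,X_2)$ of $2\times 2$ matrices with $X_1N=NX_2$, and let $\mathcal N^{2,2}(\mathrm{st}_{2,2})\subseteq\mathcal N^{2,2}$ be the Zariski closure, with its reduced structure, of the set of points $(X_1,N,X_2)\in\mathcal N^{2,2}(\overline E)$ for which the nilpotent matrix $\begin{pmatrix}0&N\\0&0\end{pmatrix}$ has two Jordan blocks of size $2$. Then there is an isomorphism of $\mathcal O$-schemes $$\mathcal N^{2,2}(\mathrm{st}_{2,2})\cong \mathrm{Spec}\,\widetilde{\mathcal R}\times_{\mathcal O}\mathbb A^1_{\mathcal O}$$ for some graded $\mathcal O$-algebra $\widetilde{\mathcal R}=\bigoplus_{n\ge 0}\widetilde{\mathcal R}_n$ with $\widetilde{\mathcal R}_0=\mathcal O$ such that, writing $\mathcal I_+$ for the ideal generated by the elements of positive degree and $\widetilde{\mathcal R}_k=k\otimes_{\mathcal O}\widetilde{\mathcal R}$ for $k=\mathbb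 F,E$: 1. $\widetilde{\mathcal R}_{\mathbb F}$ and $\widetilde{\mathcal R}_E$ are domains of dimension $7$, and $\widetilde{\mathcal R}$ is a domain of dimension $8$ which is flat over $\mathcal O$ (so of relative dimension $7$). 2. The singular locus (the set of points whose local ring is not regular) of $\mathcal N^{2,2}(\mathrm{st}_{2,2})$ is the underlying set of the closed subscheme of triples $(tI,0,tI)$, given by $N=0$, $X_1=X_2$ and $X_1$ scalar. Under the isomorphism above this closed subscheme is identified with $\mathrm{Spec}(\widetilde{\mathcal R}/\mathcal I_+)\times_{\mathcal O}\mathbb A^1_{\mathcal O}$. The singular locus of $\mathrm{Spec}\,\widetilde{\mathcal R}$ is $V(\mathcal I_+)$. 3. For $k=\mathbb F,E$ there is a geometrically integral closed subscheme $\mathcal Z_k\subseteq\mathrm{Spec}\,\widetilde{\mathcal R}_k$ of codimension $1$ such that $(\mathrm{Spec}\,\widetilde{\mathcal R}_k)\smallsetminus\mathcal Z_k$ is isomorphic over $k$ to a Zariski open subset of $\mathbb A^7_k$ containing at least one point of $\mathbb A^7_k(k)$. 4. $\widetilde{\mathcal R}$, $\widetilde{\mathcal R}_{\mathbb F}$ and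 $\widetilde{\mathcal R}_E$ are normal, and $\widetilde{\mathcal R}$ is Gorenstein but is not a complete intersection (not even locally: some localization at a maximal ideal is not a complete intersection local ring). 5. The divisor class groups vanish: $\mathrm{Cl}(\widetilde{\mathcal R})=\mathrm{Cl}(\widetilde{\mathcal R}_{\mathbb F})=\mathrm{Cl}(\widetilde{\mathcal R}_E)=0$. -/

import Mathlib

open AlgebraicGeometry CategoryTheory TensorProduct

universe u

/-! ### Commutative algebra: singular locus, Gorenstein, complete intersection, class group -/

/-- The singular locus of `Spec A`: the primes whose local ring is not regular. -/
def singularLocus (A : Type u) [CommRing A] : Set (PrimeSpectrum A) :=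
  {p | ¬ IsRegularLocalRing (Localization.AtPrime p.asIdeal)}

/-- A Noetherian local ring is Gorenstein if it has a regular sequence (contained in the maximal
ideal) whose quotient is zero-dimensional and Gorenstein, i.e. Artinian and injective as a module
over itself. -/
def IsGorensteinLocal (A : Type u) [CommRing A] : Prop :=
  IsLocalRing A ∧ IsNoetherianRing A ∧ ∃ xs : List A, RingTheory.Sequence.IsRegular A xs ∧
    IsArtinianRing (A ⧸ Ideal.ofList xs) ∧
    Module.Injective (A ⧸ Ideal.ofList xs) (A ⧸ Ideal.ofList xs)

/-- A Noetherian ring is Gorenstein if its localizations at maximal ideals are. -/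
def IsGorenstein (A : Type u) [CommRing A] : Prop :=
  IsNoetherianRing A ∧
    ∀ (m : Ideal A) [m.IsMaximal], IsGorensteinLocal (Localization.AtPrime m)

/-- A Noetherian local ring is a complete intersection if its completion is the quotient of a
regular local ring by an ideal generated by a regular sequence. -/
def IsCompleteIntersectionLocal (A : Type u) [CommRing A] [IsLocalRing A] : Prop :=
  IsNoetherianRing A ∧ ∃ (S : Type u) (_ : CommRing S) (xs : List S),
    IsRegularLocalRing S ∧ RingTheory.Sequence.IsRegular S xs ∧
    Nonempty ((S ⧸ Ideal.ofList xs) ≃+* AdicCompletion (IsLocalRing.maximalIdeal A) A)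

/-- A Noetherian ring is a complete intersection if its localizations at maximal ideals are.
(This is the local notion, so that its negation is the strongest one.) -/
def IsCompleteIntersection (A : Type u) [CommRing A] : Prop :=
  IsNoetherianRing A ∧
    ∀ (m : Ideal A) [m.IsMaximal], IsCompleteIntersectionLocal (Localization.AtPrime m)

/-- The prime divisors of `Spec A`: the primes of height one. -/
abbrev PrimeDivisor (A : Type u) [CommRing A] : Type u :=
  {p : PrimeSpectrum A // p.asIdeal.height = 1}

/-- The order of vanishing of `a` along a prime divisor: the length of `A_p / (a)`. -/
noncomputable def ordAlong {A : Type u} [CommRing A] (p : PrimeDivisor A) (a : A) : ℕ∞ :=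
  Ring.ord (Localization.AtPrime p.1.asIdeal)
    (algebraMap A (Localization.AtPrime p.1.asIdeal) a)

/-- The principal divisors. As `div (a / b) = div a - div b`, the group of all principal divisors
of a Noetherian domain is generated by the divisors of the nonzero elements of `A`. -/
noncomputable def principalDivisors (A : Type u) [CommRing A] : AddSubgroup (PrimeDivisor A →₀ ℤ) :=
  AddSubgroup.closure {D | ∃ a ∈ nonZeroDivisors A, ∀ p, D p = ((ordAlong p a).toNat : ℤ)}

/-- The divisor class group `Cl A` of a normal Noetherian domain: Weil divisors modulo principal
divisors. -/
abbrev DivisorClassGroup (A : Type u) [CommRing A] : Type u :=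
  (PrimeDivisor A →₀ ℤ) ⧸ principalDivisors A

/-! ### Rationality away from a divisor -/

/-- The open subscheme of `Spec B` complementary to the closed subscheme `Spec (B / P)`. -/
def complementOpen {B : Type u} [CommRing B] (P : Ideal B) : (Spec (CommRingCat.of B)).Opens :=
  ⟨(PrimeSpectrum.zeroLocus (P : Set B))ᶜ, (PrimeSpectrum.isClosed_zeroLocus _).isOpen_compl⟩

/-- The structure morphism `Spec B ⟶ Spec k` of a `k`-algebra `B`. -/
noncomputable def structureMap (k B : Type u) [CommRing k] [CommRing B] [Algebra k B] :
    Spec (CommRingCat.of B) ⟶ Spec (CommRingCat.of k) :=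
  Spec.map (CommRingCat.ofHom (algebraMap k B))

/-- There is a geometrically integral closed subscheme `Z = Spec (B / P)` of codimension one in
`Spec B` such that `Spec B ∖ Z` is isomorphic over `k` to an open subscheme `U` of affine `n`-space
over `k` that has a `k`-point. -/
def IsRationalAwayFromIntegralDivisor (k B : Type u) [Field k] [CommRing B] [Algebra k B]
    (n : ℕ) : Prop :=
  ∃ P : Ideal B, P.height = 1 ∧ GeometricallyIntegral (structureMap k (B ⧸ P)) ∧
    ∃ (U : (Spec (CommRingCat.of (MvPolynomial (Fin n) k))).Opens)
      (e : (complementOpen P).toScheme ≅ U.toScheme),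
      e.hom ≫ U.ι ≫ structureMap k (MvPolynomial (Fin n) k) =
        (complementOpen P).ι ≫ structureMap k B ∧
      ∃ s : Spec (CommRingCat.of k) ⟶ U.toScheme,
        s ≫ U.ι ≫ structureMap k (MvPolynomial (Fin n) k) = 𝟙 _

/-! ### The scheme of triples `(X₁, N, X₂)` with `X₁ N = N X₂` -/

namespace N22

/-- The generic `2 × 2` matrices: `a = 0, 1, 2` stands for `X₁`, `N`, `X₂`. -/
noncomputable def generic (O : Type u) [CommRing O] (a : Fin 3) :
    Matrix (Fin 2) (Fin 2) (MvPolynomial (Fin 3 × Fin 2 × Fin 2) O) :=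
  Matrix.of fun i j => MvPolynomial.X (a, i, j)

/-- The ideal generated by the entries of `X₁ N - N X₂`. -/
noncomputable def relations (O : Type u) [CommRing O] : Ideal (MvPolynomial (Fin 3 × Fin 2 × Fin 2) O) :=
  Ideal.span (Set.range fun ij : Fin 2 × Fin 2 =>
    (generic O 0 * generic O 1 - generic O 1 * generic O 2) ij.1 ij.2)

/-- The coordinate ring of the scheme of triples `(X₁, N, X₂)` of `2 × 2` matrices with
`X₁ N = N X₂` over `O`. -/
abbrev CoordRing (O : Type u) [CommRing O] : Type u :=
  MvPolynomial (Fin 3 × Fin 2 × Fin 2) O ⧸ relations O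

/-- The universal matrices `X₁`, `N`, `X₂` (for `a = 0, 1, 2`) over the coordinate ring. -/
noncomputable def univ (O : Type u) [CommRing O] (a : Fin 3) :
    Matrix (Fin 2) (Fin 2) (CoordRing O) :=
  (generic O a).map (Ideal.Quotient.mk (relations O))

/-- A square matrix `M` over a field has the ranks `rank (M ^ i) = ∑ max (m_a - i, 0)` of the
nilpotent matrix with Jordan blocks of sizes `m_a`; so `M` is conjugate to that matrix. -/
def HasNilpotentType {K ι : Type*} [Field K] [Fintype ι] [DecidableEq ι]
    (m : Multiset ℕ) (M : Matrix ι ι K) : Prop :=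
  ∀ i : ℕ, (M ^ i).rank = (m.map fun a => a - i).sum

/-- The nilpotent block matrix with single nonzero block `N` in the upper right corner. -/
def eta {K : Type*} [Field K] (N : Matrix (Fin 2) (Fin 2) K) :
    Matrix (Fin 2 ⊕ Fin 2) (Fin 2 ⊕ Fin 2) K :=
  Matrix.fromBlocks 0 N 0 0

/-- The ideal of functions vanishing at all points `(X₁, N, X₂)` with values in an algebraic
closure of `E` for which `N` has type `st_{2,2}`. -/
noncomputable def stIdeal (O E : Type u) [CommRing O] [Field E] [Algebra O E] :
    Ideal (CoordRing O) :=
  ⨅ (x : CoordRing O →ₐ[O] AlgebraicClosure E)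
    (_ : HasNilpotentType {2, 2} (eta ((univ O 1).map x))), RingHom.ker x

/-- The coordinate ring of `N^{2,2}(st_{2,2})`, the Zariski closure, with its reduced structure,
of the points of type `st_{2,2}`. -/
abbrev StRing (O E : Type u) [CommRing O] [Field E] [Algebra O E] : Type u :=
  CoordRing O ⧸ stIdeal O E

/-- The universal matrices over the coordinate ring of `N^{2,2}(st_{2,2})`. -/
noncomputable def stUniv (O E : Type u) [CommRing O] [Field E] [Algebra O E] (a : Fin 3) :
    Matrix (Fin 2) (Fin 2) (StRing O E) :=
  (univ O a).map (Ideal.Quotient.mk (stIdeal O E))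

/-- The ideal of the closed subscheme of triples `(t I, 0, t I)`. -/
noncomputable def scalarIdeal (O E : Type u) [CommRing O] [Field E] [Algebra O E] :
    Ideal (StRing O E) :=
  Ideal.span (Set.range fun ij : Fin 2 × Fin 2 => stUniv O E 1 ij.1 ij.2) ⊔
  Ideal.span (Set.range fun ij : Fin 2 × Fin 2 => (stUniv O E 0 - stUniv O E 2) ij.1 ij.2) ⊔
  Ideal.span {stUniv O E 0 0 1, stUniv O E 0 1 0, stUniv O E 0 0 0 - stUniv O E 0 1 1}

end N22

/-- The ideal generated by the elements of positive degree. -/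
def positiveIdeal {O R : Type u} [CommRing O] [CommRing R] [Algebra O R]
    (𝒜 : ℕ → Submodule O R) : Ideal R :=
  Ideal.span {x | ∃ n, 0 < n ∧ x ∈ 𝒜 n}

/-! Where `det N ≠ 0` the equation `X₁ N = N X₂` makes `X₁` and `X₂` conjugate, so on the closure of
these points their traces and determinants agree. Modulo the trace equation eleven linear
coordinates remain. One of them, the lower right entry of `X₁`, is free. The other ten satisfy five
quadrics, four from `X₁ N = N X₂` and one from the determinants, which after a linear change of
coordinates are the Plücker relations of the Grassmannian of planes in 5-space. Hence the closure
has coordinate ring `PluckerRing O` with one variable adjoined (`N22.stEquiv`), and the graded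
algebra sought is `PluckerRing O`.

The Plücker ring is studied in two ways. By `fiveEquiv` it is free of rank five over a polynomial
ring in seven linear parameters, with an explicit multiplication table `FiveAlg`; this gives
flatness, dimension and regular sequences. By `chartEquiv`, inverting `p 0 1` turns it into a
polynomial ring with one variable inverted. Together they show that the ring is a domain and, since
the quotient by `p 0 1` embeds in a polynomial ring, that `p 0 1` is prime. Nagata's criterion then
yields factoriality, hence normality and trivial class groups; the locus `p 0 1 = 0` is the divisor
whose complement is rational.

Permuting the coordinates moves the regular chart to all charts `p i j ≠ 0`, so singularities lie
over the vertex. There the quadrics have no linear terms, so ten independent tangent directions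
exceed the dimension.

Dividing by the seven parameters and a uniformizer leaves a local Artinian algebra with Hilbert
function 1, 3, 1. Its socle pairing is perfect, so the vertex is Gorenstein. If the vertex were a
complete intersection, that algebra would be a quotient of a three-dimensional regular local ring by
at most three equations of order two, and the square of the maximal ideal of that ring would have
four generators instead of six (`false_of_ker_eq_ofList`). -/

/-! ### The explicit algebra with basis `1, a, b, c, bc` -/

/-- Coordinates of elements of the rank five algebra. -/
@[ext]
structure FiveAlg (P : Type*) (e : Fin 7 → P) where
  c0 : P
  c1 : P
  c2 : P
  c3 : P
  c4 : P

namespace FiveAlg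

variable {P : Type*} [CommRing P] {e : Fin 7 → P}

instance : Zero (FiveAlg P e) := ⟨⟨0, 0, 0, 0, 0⟩⟩
instance : One (FiveAlg P e) := ⟨⟨1, 0, 0, 0, 0⟩⟩
instance : Add (FiveAlg P e) :=
  ⟨fun x y => ⟨x.c0 + y.c0, x.c1 + y.c1, x.c2 + y.c2, x.c3 + y.c3, x.c4 + y.c4⟩⟩
instance : Neg (FiveAlg P e) := ⟨fun x => ⟨-x.c0, -x.c1, -x.c2, -x.c3, -x.c4⟩⟩
instance : SMul P (FiveAlg P e) :=
  ⟨fun r x => ⟨r * x.c0, r * x.c1, r * x.c2, r * x.c3, r * x.c4⟩⟩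

@[simp] lemma zero_c0 : (0 : FiveAlg P e).c0 = 0 := rfl
@[simp] lemma zero_c1 : (0 : FiveAlg P e).c1 = 0 := rfl
@[simp] lemma zero_c2 : (0 : FiveAlg P e).c2 = 0 := rfl
@[simp] lemma zero_c3 : (0 : FiveAlg P e).c3 = 0 := rfl
@[simp] lemma zero_c4 : (0 : FiveAlg P e).c4 = 0 := rfl
@[simp] lemma one_c0 : (1 : FiveAlg P e).c0 = 1 := rfl
@[simp] lemma one_c1 : (1 : FiveAlg P e).c1 = 0 := rfl
@[simp] lemma one_c2 : (1 : FiveAlg P e).c2 = 0 := rfl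
@[simp] lemma one_c3 : (1 : FiveAlg P e).c3 = 0 := rfl
@[simp] lemma one_c4 : (1 : FiveAlg P e).c4 = 0 := rfl
@[simp] lemma add_c0 (x y : FiveAlg P e) : (x + y).c0 = x.c0 + y.c0 := rfl
@[simp] lemma add_c1 (x y : FiveAlg P e) : (x + y).c1 = x.c1 + y.c1 := rfl
@[simp] lemma add_c2 (x y : FiveAlg P e) : (x + y).c2 = x.c2 + y.c2 := rfl
@[simp] lemma add_c3 (x y : FiveAlg P e) : (x + y).c3 = x.c3 + y.c3 := rfl
@[simp] lemma add_c4 (x y : FiveAlg P e) : (x + y).c4 = x.c4 + y.c4 := rfl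
@[simp] lemma neg_c0 (x : FiveAlg P e) : (-x).c0 = -x.c0 := rfl
@[simp] lemma neg_c1 (x : FiveAlg P e) : (-x).c1 = -x.c1 := rfl
@[simp] lemma neg_c2 (x : FiveAlg P e) : (-x).c2 = -x.c2 := rfl
@[simp] lemma neg_c3 (x : FiveAlg P e) : (-x).c3 = -x.c3 := rfl
@[simp] lemma neg_c4 (x : FiveAlg P e) : (-x).c4 = -x.c4 := rfl
@[simp] lemma smul_c0 (r : P) (x : FiveAlg P e) : (r • x).c0 = r * x.c0 := rfl
@[simp] lemma smul_c1 (r : P) (x : FiveAlg P e) : (r • x).c1 = r * x.c1 := rfl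
@[simp] lemma smul_c2 (r : P) (x : FiveAlg P e) : (r • x).c2 = r * x.c2 := rfl
@[simp] lemma smul_c3 (r : P) (x : FiveAlg P e) : (r • x).c3 = r * x.c3 := rfl
@[simp] lemma smul_c4 (r : P) (x : FiveAlg P e) : (r • x).c4 = r * x.c4 := rfl

instance : AddCommGroup (FiveAlg P e) where
  add_assoc x y z := by ext <;> simp [add_assoc]
  zero_add x := by ext <;> simp
  add_zero x := by ext <;> simp
  add_comm x y := by ext <;> simp [add_comm]
  neg_add_cancel x := by ext <;> simp
  nsmul := nsmulRec
  zsmul := zsmulRec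

instance : Module P (FiveAlg P e) where
  one_smul x := by ext <;> simp
  mul_smul r s x := by ext <;> simp [mul_assoc]
  smul_zero r := by ext <;> simp
  zero_smul x := by ext <;> simp
  smul_add r x y := by ext <;> simp [mul_add]
  add_smul r s x := by ext <;> simp [add_mul]

variable (P e) in
/-- Multiplication by the basis vector `a`. -/
def mulA : FiveAlg P e →ₗ[P] FiveAlg P e where
  toFun x :=
    -- The coefficients of `x.c0`, ..., `x.c4` are the coordinates of `a`, `a²`, `ab`, `ac`,
    -- `a(bc)`, as dictated by the five Plücker relations.
    ⟨x.c1 * (-e 0 * e 3 - e 0 * e 6 - e 1 * e 4) + x.c2 * (-e 0 * e 2) + x.c3 * (e 0 * e 3) + x.c4 * (-e 1 * e 3 * e 4),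
      x.c0 + x.c1 * (e 5) + x.c4 * (-e 2 * e 4),
      x.c1 * (e 0 - e 4) + x.c2 * (e 5) + x.c3 * (e 4) + x.c4 * (e 0 * e 3 + e 4 * e 6),
      x.c1 * (e 0) + x.c2 * (-e 1),
      x.c2 * (-1) + x.c4 * (-e 4)⟩
  map_add' x y := by ext <;> simp <;> ring
  map_smul' r x := by ext <;> simp <;> ring

variable (P e) in
/-- Multiplication by the basis vector `b`. -/
def mulB : FiveAlg P e →ₗ[P] FiveAlg P e where
  toFun x :=
    ⟨x.c1 * (-e 0 * e 2) + x.c2 * (-e 1 * e 3) + x.c4 * (-e 0 * e 2 * e 3 - e 1 * e 2 * e 4 - e 1 * e 3 * e 4 - e 1 * e 3 * e 5),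
      x.c2 * (-e 2) + x.c4 * (e 1 * e 3 - e 2 * e 4),
      x.c0 + x.c1 * (e 5) + x.c2 * (e 6) + x.c4 * (e 0 * e 3 - e 2 * e 4 + e 4 * e 6),
      x.c1 * (-e 1) + x.c4 * (e 0 * e 2 + e 1 * e 6),
      x.c1 * (-1) + x.c2 * (-1) + x.c3 + x.c4 * (-e 1 - e 4 - e 5 + e 6)⟩
  map_add' x y := by ext <;> simp <;> ring
  map_smul' r x := by ext <;> simp <;> ring

variable (P e) in
/-- Multiplication by the basis vector `c`. -/
def mulC : FiveAlg P e →ₗ[P] FiveAlg P e where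
  toFun x :=
    ⟨x.c1 * (e 0 * e 3) + x.c3 * (-e 2 * e 4 - e 3 * e 5) + x.c4 * (e 1 * e 2 * e 4 + e 1 * e 3 * e 4 + e 1 * e 3 * e 5),
      x.c3 * (e 3) + x.c4 * (-e 1 * e 3 + e 2 * e 4),
      x.c1 * (e 4) + x.c4 * (-e 0 * e 3 - e 4 * e 6),
      x.c0 + x.c3 * (e 3 + e 6) + x.c4 * (-e 0 * e 2 - e 1 * e 3 - e 1 * e 6),
      x.c2 + x.c3 * (-1) + x.c4 * (e 1 + e 4 + e 5)⟩
  map_add' x y := by ext <;> simp <;> ring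
  map_smul' r x := by ext <;> simp <;> ring

/-- These three commutations carry the whole ring structure: operators built from `mulA`, `mulB`,
`mulC` then commute, and an element is recovered by applying its operator to `1`. Commutativity and
associativity of the product follow without comparing structure constants again. -/
lemma mulA_mulB : Commute (mulA P e) (mulB P e) := by
  refine LinearMap.ext fun x => ?_
  ext <;> simp [mulA, mulB] <;> ring

lemma mulA_mulC : Commute (mulA P e) (mulC P e) := by
  refine LinearMap.ext fun x => ?_
  ext <;> simp [mulA, mulC] <;> ring

lemma mulB_mulC : Commute (mulB P e) (mulC P e) := by
  refine LinearMap.ext fun x => ?_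
  ext <;> simp [mulB, mulC] <;> ring

variable (P e) in
/-- The regular representation. -/
def rep : FiveAlg P e →ₗ[P] Module.End P (FiveAlg P e) where
  toFun x := x.c0 • 1 + x.c1 • mulA P e + x.c2 • mulB P e + x.c3 • mulC P e +
    x.c4 • (mulB P e * mulC P e)
  map_add' x y := by simp only [add_c0, add_c1, add_c2, add_c3, add_c4]; module
  map_smul' r x := by
    simp only [smul_c0, smul_c1, smul_c2, smul_c3, smul_c4, RingHom.id_apply]; module

lemma rep_apply (x : FiveAlg P e) : rep P e x = x.c0 • 1 + x.c1 • mulA P e + x.c2 • mulB P e +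
    x.c3 • mulC P e + x.c4 • (mulB P e * mulC P e) := rfl

lemma rep_one (x : FiveAlg P e) : rep P e x 1 = x := by
  ext <;> simp [rep_apply, mulA, mulB, mulC]

lemma one_rep : rep P e 1 = 1 := by
  simp [rep_apply]

lemma commute_rep (x y : FiveAlg P e) : Commute (rep P e x) (rep P e y) := by
  have hA : ∀ {T}, Commute (mulA P e) T → Commute (mulB P e) T → Commute (mulC P e) T →
      ∀ z, Commute (rep P e z) T := fun {T} h1 h2 h3 z =>
    ((((((Commute.one_left T).smul_left _).add_left (h1.smul_left _)).add_left
      (h2.smul_left _)).add_left (h3.smul_left _)).add_left ((h2.mul_left h3).smul_left _))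
  refine hA (hA ?_ ?_ ?_ y).symm (hA ?_ ?_ ?_ y).symm (hA ?_ ?_ ?_ y).symm x
  exacts [.refl _, mulA_mulB.symm, mulA_mulC.symm, mulA_mulB, .refl _, mulB_mulC.symm,
    mulA_mulC, mulB_mulC, .refl _]

instance : Mul (FiveAlg P e) := ⟨fun x y => rep P e x y⟩

lemma mul_def (x y : FiveAlg P e) : x * y = rep P e x y := rfl

protected lemma mul_comm (x y : FiveAlg P e) : x * y = y * x := by
  rw [mul_def, mul_def]
  conv_lhs => rw [← rep_one y]
  conv_rhs => rw [← rep_one x]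
  exact congrArg (fun f : Module.End P (FiveAlg P e) => f 1) (commute_rep x y)

protected lemma mul_assoc (x y z : FiveAlg P e) : x * y * z = x * (y * z) := by
  rw [FiveAlg.mul_comm (x * y) z, FiveAlg.mul_comm y z]
  exact congrArg (fun f : Module.End P (FiveAlg P e) => f y) (commute_rep z x)

instance : CommRing (FiveAlg P e) where
  mul_comm := FiveAlg.mul_comm
  mul_assoc := FiveAlg.mul_assoc
  one_mul x := by rw [mul_def, one_rep]; rfl
  mul_one x := by rw [mul_def, rep_one]
  zero_mul x := by rw [mul_def, map_zero]; rfl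
  mul_zero x := by rw [mul_def, map_zero]
  left_distrib x y z := by rw [mul_def, map_add]; rfl
  right_distrib x y z := by rw [mul_def, map_add]; rfl
  nsmul := nsmulRec
  zsmul := zsmulRec
  neg_add_cancel := neg_add_cancel

instance : Algebra P (FiveAlg P e) :=
  Algebra.ofModule (fun r x y => by simp [mul_def]) (fun r x y => by simp [mul_def])

@[simp] lemma sub_c0 (x y : FiveAlg P e) : (x - y).c0 = x.c0 - y.c0 := by simp [sub_eq_add_neg]
@[simp] lemma sub_c1 (x y : FiveAlg P e) : (x - y).c1 = x.c1 - y.c1 := by simp [sub_eq_add_neg]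
@[simp] lemma sub_c2 (x y : FiveAlg P e) : (x - y).c2 = x.c2 - y.c2 := by simp [sub_eq_add_neg]
@[simp] lemma sub_c3 (x y : FiveAlg P e) : (x - y).c3 = x.c3 - y.c3 := by simp [sub_eq_add_neg]
@[simp] lemma sub_c4 (x y : FiveAlg P e) : (x - y).c4 = x.c4 - y.c4 := by simp [sub_eq_add_neg]

lemma algebraMap_eq (r : P) : algebraMap P (FiveAlg P e) r = ⟨r, 0, 0, 0, 0⟩ := by
  rw [Algebra.algebraMap_eq_smul_one]; ext <;> simp

variable (P e) in
/-- The coordinates as a linear equivalence. -/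
def coordEquiv : FiveAlg P e ≃ₗ[P] (Fin 5 → P) where
  toFun x := ![x.c0, x.c1, x.c2, x.c3, x.c4]
  invFun f := ⟨f 0, f 1, f 2, f 3, f 4⟩
  map_add' x y := by ext i; fin_cases i <;> simp
  map_smul' r x := by ext i; fin_cases i <;> simp
  left_inv x := rfl
  right_inv f := by ext i; fin_cases i <;> rfl

instance : Module.Free P (FiveAlg P e) := .of_equiv (coordEquiv P e).symm
instance : Module.Finite P (FiveAlg P e) := .equiv (coordEquiv P e).symm

/-- The map of algebras induced by a ring homomorphism compatible with the parameters. -/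
def map {P' : Type*} [CommRing P'] {e' : Fin 7 → P'} (f : P →+* P') (hf : ∀ i, f (e i) = e' i) :
    FiveAlg P e →+* FiveAlg P' e' where
  toFun x := ⟨f x.c0, f x.c1, f x.c2, f x.c3, f x.c4⟩
  map_one' := by ext <;> simp
  map_zero' := by ext <;> simp
  map_add' x y := by ext <;> simp
  map_mul' x y := by ext <;> simp [mul_def, rep_apply, mulA, mulB, mulC, hf]

end FiveAlg

/-! ### Plücker relations and their universal ring -/

/-- The alternating families `w i j`, `i j : Fin 5`, satisfying the Plücker relations. -/
structure IsPlucker {B : Type*} [CommRing B] (w : Fin 5 → Fin 5 → B) : Prop where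
  self (i) : w i i = 0
  swap (i j) : w i j = -w j i
  rel (i j k l) : w i j * w k l - w i k * w j l + w i l * w j k = 0

namespace IsPlucker

variable {B C : Type*} [CommRing B] [CommRing C]

lemma map {w : Fin 5 → Fin 5 → B} (hw : IsPlucker w) (f : B →+* C) :
    IsPlucker fun i j => f (w i j) where
  self i := by simp [hw.self]
  swap i j := by rw [hw.swap, map_neg]
  rel i j k l := by simp only [← map_mul, ← map_sub, ← map_add, hw.rel, map_zero]

lemma of_minors (r s : Fin 5 → B) : IsPlucker fun i j => r i * s j - r j * s i where
  self i := by ring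
  swap i j := by ring
  rel i j k l := by ring

lemma comp {w : Fin 5 → Fin 5 → B} (hw : IsPlucker w) (σ : Fin 5 → Fin 5) :
    IsPlucker fun i j => w (σ i) (σ j) :=
  ⟨fun _ => hw.self _, fun _ _ => hw.swap _ _, fun _ _ _ _ => hw.rel _ _ _ _⟩

/-- It suffices to check the Plücker relations for increasing indices. -/
lemma of_lt {w : Fin 5 → Fin 5 → B} (self : ∀ i, w i i = 0) (swap : ∀ i j, w i j = -w j i)
    (h : ∀ i j k l, i < j → j < k → k < l → w i j * w k l - w i k * w j l + w i l * w j k = 0) :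
    IsPlucker w := by
  refine ⟨self, swap, ?_⟩
  -- A relation only changes sign under an adjacent transposition of indices and is trivial when two
  -- neighbours coincide. So the quadruple can be sorted by insertion: `A` inserts `l`, `B` inserts
  -- `k`, and the end of the proof orders `i` and `j`.
  have s12 (i j k l) (H : w i j * w k l - w i k * w j l + w i l * w j k = 0) :
      w j i * w k l - w j k * w i l + w j l * w i k = 0 := by
    rw [swap j i]; linear_combination -H
  have s23 (i j k l) (H : w i j * w k l - w i k * w j l + w i l * w j k = 0) :
      w i k * w j l - w i j * w k l + w i l * w k j = 0 := by
    rw [swap k j]; linear_combination -H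
  have s34 (i j k l) (H : w i j * w k l - w i k * w j l + w i l * w j k = 0) :
      w i j * w l k - w i l * w j k + w i k * w j l = 0 := by
    rw [swap l k]; linear_combination -H
  have e34 (i j k) : w i j * w k k - w i k * w j k + w i k * w j k = 0 := by rw [self]; ring
  have e23 (i j l) : w i j * w j l - w i j * w j l + w i l * w j j = 0 := by rw [self]; ring
  have e12 (i k l) : w i i * w k l - w i k * w i l + w i l * w i k = 0 := by rw [self]; ring
  have A (i j k l) (hij : i < j) (hjk : j < k) :
      w i j * w k l - w i k * w j l + w i l * w j k = 0 := by
    rcases lt_trichotomy k l with hl | rfl | hl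
    · exact h i j k l hij hjk hl
    · exact e34 i j k
    apply s34
    rcases lt_trichotomy j l with hl' | rfl | hl'
    · exact h i j l k hij hl' hl
    · exact e23 i j k
    apply s23
    rcases lt_trichotomy i l with hl'' | rfl | hl''
    · exact h i l j k hl'' hl' hjk
    · exact e12 i j k
    · exact s12 _ _ _ _ (h l i j k hl'' hij hjk)
  have B (i j k l) (hij : i < j) : w i j * w k l - w i k * w j l + w i l * w j k = 0 := by
    rcases lt_trichotomy j k with hl | rfl | hl
    · exact A i j k l hij hl
    · exact e23 i j l
    apply s23
    rcases lt_trichotomy i k with hl' | rfl | hl'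
    · exact A i k j l hl' hl
    · exact e12 i j l
    · exact s12 _ _ _ _ (A k i j l hl' hij)
  intro i j k l
  rcases lt_trichotomy i j with hl | rfl | hl
  · exact B i j k l hl
  · exact e12 i k l
  · exact s12 _ _ _ _ (B j i k l hl)

end IsPlucker

/-- The alternating family with the given entries above the diagonal. -/
def skewFamily {B : Type*} [CommRing B] (a01 a02 a03 a04 a12 a13 a14 a23 a24 a34 : B) :
    Fin 5 → Fin 5 → B :=
  ![![0, a01, a02, a03, a04], ![-a01, 0, a12, a13, a14], ![-a02, -a12, 0, a23, a24],
    ![-a03, -a13, -a23, 0, a34], ![-a04, -a14, -a24, -a34, 0]]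

lemma isPlucker_skewFamily {B : Type*} [CommRing B]
    {a01 a02 a03 a04 a12 a13 a14 a23 a24 a34 : B}
    (h0 : a12 * a34 - a13 * a24 + a14 * a23 = 0) (h1 : a02 * a34 - a03 * a24 + a04 * a23 = 0)
    (h2 : a01 * a34 - a03 * a14 + a04 * a13 = 0) (h3 : a01 * a24 - a02 * a14 + a04 * a12 = 0)
    (h4 : a01 * a23 - a02 * a13 + a03 * a12 = 0) :
    IsPlucker (skewFamily a01 a02 a03 a04 a12 a13 a14 a23 a24 a34) := by
  refine .of_lt (fun i => by fin_cases i <;> rfl) (fun i j => ?_) fun i j k l hij hjk hkl => ?_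
  · fin_cases i <;> fin_cases j <;> simp [skewFamily]
  · have key : (i = 0 ∧ j = 1 ∧ k = 2 ∧ l = 3) ∨ (i = 0 ∧ j = 1 ∧ k = 2 ∧ l = 4) ∨
        (i = 0 ∧ j = 1 ∧ k = 3 ∧ l = 4) ∨ (i = 0 ∧ j = 2 ∧ k = 3 ∧ l = 4) ∨
        (i = 1 ∧ j = 2 ∧ k = 3 ∧ l = 4) := by
      simp only [Fin.ext_iff, Fin.lt_def] at *
      have := l.isLt
      norm_num
      omega
    rcases key with ⟨rfl, rfl, rfl, rfl⟩ | ⟨rfl, rfl, rfl, rfl⟩ | ⟨rfl, rfl, rfl, rfl⟩ |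
      ⟨rfl, rfl, rfl, rfl⟩ | ⟨rfl, rfl, rfl, rfl⟩
    exacts [h4, h3, h2, h1, h0]

/-- The ideal generated by the quadratic Plücker relations of the Grassmannian of planes in
`5`-space together with the relations expressing that the coordinates alternate. -/
noncomputable def pluckerIdeal (A : Type*) [CommRing A] : Ideal (MvPolynomial (Fin 5 × Fin 5) A) :=
  Ideal.span {f | (∃ i, f = .X (i, i)) ∨ (∃ i j, f = .X (i, j) + .X (j, i)) ∨
    ∃ i j k l, f = .X (i, j) * .X (k, l) - .X (i, k) * .X (j, l) + .X (i, l) * .X (j, k)}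

/-- The homogeneous coordinate ring of the Grassmannian of planes in `5`-space. -/
def PluckerRing (A : Type*) [CommRing A] : Type _ :=
  MvPolynomial (Fin 5 × Fin 5) A ⧸ pluckerIdeal A

namespace PluckerRing

variable (A : Type*) [CommRing A]

noncomputable instance : CommRing (PluckerRing A) :=
  inferInstanceAs (CommRing (MvPolynomial (Fin 5 × Fin 5) A ⧸ pluckerIdeal A))

noncomputable instance {k : Type*} [CommSemiring k] [Algebra k A] : Algebra k (PluckerRing A) :=
  inferInstanceAs (Algebra k (MvPolynomial (Fin 5 × Fin 5) A ⧸ pluckerIdeal A))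

instance {k : Type*} [CommSemiring k] [Algebra k A] : IsScalarTower k A (PluckerRing A) :=
  inferInstanceAs (IsScalarTower k A (MvPolynomial (Fin 5 × Fin 5) A ⧸ pluckerIdeal A))

/-- The presentation of the Plücker ring as a quotient of a polynomial ring. -/
noncomputable def mk : MvPolynomial (Fin 5 × Fin 5) A →ₐ[A] PluckerRing A :=
  Ideal.Quotient.mkₐ A (pluckerIdeal A)

lemma mk_surjective : Function.Surjective (mk A) := Ideal.Quotient.mk_surjective

/-- The Plücker coordinates. -/
noncomputable def p (i j : Fin 5) : PluckerRing A := mk A (.X (i, j))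

lemma mk_eq_zero {f : MvPolynomial (Fin 5 × Fin 5) A} (hf : f ∈ pluckerIdeal A) : mk A f = 0 :=
  Ideal.Quotient.eq_zero_iff_mem.2 hf

lemma isPlucker_p : IsPlucker (p A) where
  self i := mk_eq_zero A (Ideal.subset_span (.inl ⟨i, rfl⟩))
  swap i j := by
    rw [eq_neg_iff_add_eq_zero, p, p, ← map_add]
    exact mk_eq_zero A (Ideal.subset_span (.inr (.inl ⟨i, j, rfl⟩)))
  rel i j k l := by
    simp only [p, ← map_add, ← map_mul, ← map_sub]
    exact mk_eq_zero A (Ideal.subset_span (.inr (.inr ⟨i, j, k, l, rfl⟩)))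

variable {A} {B : Type*} [CommRing B] [Algebra A B]

/-- The universal property of the Plücker ring. -/
noncomputable def lift (w : Fin 5 → Fin 5 → B) (hw : IsPlucker w) : PluckerRing A →ₐ[A] B :=
  Ideal.Quotient.liftₐ (pluckerIdeal A) (MvPolynomial.aeval fun ij => w ij.1 ij.2) fun a ha => by
    refine (Ideal.span_le (I := RingHom.ker (MvPolynomial.aeval fun ij : Fin 5 × Fin 5 =>
      w ij.1 ij.2 : _ →ₐ[A] B))).2 ?_ ha
    rintro f (⟨i, rfl⟩ | ⟨i, j, rfl⟩ | ⟨i, j, k, l, rfl⟩)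
    · simp [hw.self]
    · simp [hw.swap i j]
    · simp [hw.rel]

@[simp] lemma lift_p (w : Fin 5 → Fin 5 → B) (hw : IsPlucker w) (i j : Fin 5) :
    lift (A := A) w hw (p A i j) = w i j :=
  MvPolynomial.aeval_X _ (i, j)

lemma algHom_ext {f g : PluckerRing A →ₐ[A] B} (h : ∀ i j, f (p A i j) = g (p A i j)) : f = g :=
  (AlgHom.cancel_right (mk_surjective A)).1 (MvPolynomial.algHom_ext fun ij => h ij.1 ij.2)

lemma ringHom_ext {S : Type*} [CommRing S] {f g : PluckerRing A →+* S}
    (h : ∀ i j, f (p A i j) = g (p A i j))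
    (h' : ∀ a, f (algebraMap A _ a) = g (algebraMap A _ a)) : f = g :=
  (RingHom.cancel_right (f := (mk A).toRingHom) (mk_surjective A)).1 <|
    MvPolynomial.ringHom_ext (fun a => by simpa using h' a) fun ij => h ij.1 ij.2

instance [IsNoetherianRing A] : IsNoetherianRing (PluckerRing A) :=
  isNoetherianRing_of_surjective _ _ (mk A).toRingHom (mk_surjective A)

lemma map_p_eq_of_lt {S : Type*} [CommRing S] {f g : PluckerRing A →+* S}
    (h : ∀ i j, i < j → f (p A i j) = g (p A i j)) (i j : Fin 5) : f (p A i j) = g (p A i j) := by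
  rcases lt_trichotomy i j with hij | rfl | hij
  · exact h i j hij
  · simp [(isPlucker_p A).self]
  · rw [(isPlucker_p A).swap, map_neg, map_neg, h j i hij]

end PluckerRing

/-! ### Noether normalization of the Plücker ring -/

namespace FiveAlg

variable {P : Type*} [CommRing P] {e : Fin 7 → P}

variable (e) in
/-- The Plücker coordinates in the rank five algebra. -/
def coords : Fin 5 → Fin 5 → FiveAlg P e :=
  -- Here `a = p 1 4`, `b = p 1 3`, `c = p 0 3`; the parameters `e 5` and `e 6` are solved for `p 0
  -- 2 = e 5 - a - c` and `p 2 4 = e 6 - b - c`.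
  skewFamily ⟨e 0, 0, 0, 0, 0⟩ ⟨e 5, -1, 0, -1, 0⟩ ⟨0, 0, 0, 1, 0⟩ ⟨e 4, 0, 0, 0, 0⟩
    ⟨e 1, 0, 0, 0, 0⟩ ⟨0, 0, 1, 0, 0⟩ ⟨0, 1, 0, 0, 0⟩ ⟨e 2, 0, 0, 0, 0⟩ ⟨e 6, 0, -1, -1, 0⟩
    ⟨e 3, 0, 0, 0, 0⟩

set_option maxHeartbeats 800000 in
lemma isPlucker_coords : IsPlucker (coords e) := by
  refine isPlucker_skewFamily ?_ ?_ ?_ ?_ ?_ <;>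
  ext <;> simp [mul_def, rep_apply, mulA, mulB, mulC] <;> ring

end FiveAlg

namespace FiveAlg

variable {P : Type*} [CommRing P] {e : Fin 7 → P} {S : Type*} [CommRing S]

/-- Homomorphisms out of the rank five algebra: it is presented by the products of the basis
vectors `a`, `b`, `c`. -/
def lift (f : P →+* S) (a b c : S)
    (hac : a * c = f (e 0) * f (e 3) + f (e 4) * b)
    (haa : a * a = f (e 5) * a - a * c - f (e 0) * (f (e 6) - b - c) - f (e 4) * f (e 1))
    (hab : a * b = f (e 5) * b - b * c - f (e 0) * f (e 2) - f (e 1) * c)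
    (hbb : b * b = f (e 6) * b - b * c - f (e 1) * f (e 3) - f (e 2) * a)
    (hcc : c * c = f (e 6) * c - b * c - f (e 3) * (f (e 5) - a - c) - f (e 4) * f (e 2)) :
    FiveAlg P e →+* S :=
  let ψ (x : FiveAlg P e) : S := f x.c0 + f x.c1 * a + f x.c2 * b + f x.c3 * c + f x.c4 * (b * c)
  have hadd (x y : FiveAlg P e) : ψ (x + y) = ψ x + ψ y := by simp [ψ]; ring
  have hsmul (r : P) (x : FiveAlg P e) : ψ (r • x) = f r * ψ x := by simp [ψ]; ring
  -- The products of the fifth basis vector `bc` with `a`, `b`, `c` are consequences of the five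
  -- relations, so they need not be assumed.
  have habc : a * (b * c) = f (e 0) * f (e 3) * b + f (e 4) * (b * b) := by
    linear_combination b * hac
  have hcbc : c * (b * c) = f (e 5) * (b * c) - f (e 0) * f (e 2) * c - f (e 1) * (c * c) -
      a * (b * c) := by linear_combination c * hab
  have hbbc : b * (b * c) = f (e 6) * (b * c) - c * (b * c) - f (e 1) * f (e 3) * c -
      f (e 2) * (a * c) := by linear_combination c * hbb
  have hA (x : FiveAlg P e) : ψ (mulA P e x) = a * ψ x := by
    simp only [ψ, mulA, LinearMap.coe_mk, AddHom.coe_mk, map_add, map_mul, map_sub, map_neg,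
      map_one]
    linear_combination -f x.c1 * (haa - hac) - f x.c2 * hab - f x.c3 * hac -
      f x.c4 * (habc + f (e 4) * hbb)
  have hB (x : FiveAlg P e) : ψ (mulB P e x) = b * ψ x := by
    simp only [ψ, mulB, LinearMap.coe_mk, AddHom.coe_mk, map_add, map_mul, map_sub, map_neg,
      map_one]
    linear_combination -f x.c1 * hab - f x.c2 * hbb -
      f x.c4 * (hbbc - hcbc + f (e 1) * hcc + habc + f (e 4) * hbb - f (e 2) * hac)
  have hC (x : FiveAlg P e) : ψ (mulC P e x) = c * ψ x := by
    simp only [ψ, mulC, LinearMap.coe_mk, AddHom.coe_mk, map_add, map_mul, map_sub, map_neg,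
      map_one]
    linear_combination -f x.c1 * hac - f x.c3 * hcc -
      f x.c4 * (hcbc - f (e 1) * hcc - habc - f (e 4) * hbb)
  { toFun := ψ
    map_one' := by simp [ψ]
    map_zero' := by simp [ψ]
    map_add' := hadd
    map_mul' x y := by
      rw [mul_def, rep_apply]
      simp only [LinearMap.add_apply, LinearMap.smul_apply, Module.End.one_apply,
        Module.End.mul_apply, hadd, hsmul, hA, hB, hC]
      simp only [ψ]
      ring }

lemma ringHom_ext {f g : FiveAlg P e →+* S}
    (h : ∀ r, f (algebraMap P _ r) = g (algebraMap P _ r)) (ha : f ⟨0, 1, 0, 0, 0⟩ = g ⟨0, 1, 0, 0, 0⟩)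
    (hb : f ⟨0, 0, 1, 0, 0⟩ = g ⟨0, 0, 1, 0, 0⟩) (hc : f ⟨0, 0, 0, 1, 0⟩ = g ⟨0, 0, 0, 1, 0⟩) :
    f = g := by
  refine RingHom.ext fun x => ?_
  have hx : x = algebraMap P _ x.c0 + algebraMap P _ x.c1 * ⟨0, 1, 0, 0, 0⟩ +
      algebraMap P _ x.c2 * ⟨0, 0, 1, 0, 0⟩ + algebraMap P _ x.c3 * ⟨0, 0, 0, 1, 0⟩ +
      algebraMap P _ x.c4 * (⟨0, 0, 1, 0, 0⟩ * ⟨0, 0, 0, 1, 0⟩) := by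
    ext <;> simp [mul_def, rep_apply, algebraMap_eq, mulB, mulC]
  rw [hx]
  simp only [map_add, map_mul, h, ha, hb, hc]

end FiveAlg

namespace PluckerRing

variable {A : Type*} [CommRing A]

/-- The universal property of the Plücker ring, for ring homomorphisms. -/
noncomputable def liftRingHom {B : Type*} [CommRing B] (f : A →+* B) (w : Fin 5 → Fin 5 → B)
    (hw : IsPlucker w) : PluckerRing A →+* B :=
  letI := f.toAlgebra
  (lift w hw : PluckerRing A →ₐ[A] B)

@[simp] lemma liftRingHom_p {B : Type*} [CommRing B] (f : A →+* B) (w : Fin 5 → Fin 5 → B)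
    (hw : IsPlucker w) (i j : Fin 5) : liftRingHom f w hw (p A i j) = w i j := by
  let := f.toAlgebra
  exact lift_p w hw i j

@[simp] lemma liftRingHom_algebraMap {B : Type*} [CommRing B] (f : A →+* B)
    (w : Fin 5 → Fin 5 → B) (hw : IsPlucker w) (a : A) :
    liftRingHom f w hw (algebraMap A _ a) = f a := by
  let := f.toAlgebra
  exact (lift w hw : PluckerRing A →ₐ[A] B).commutes a

variable (A)

/-- The seven linear parameters in the Plücker ring. -/
noncomputable def param : MvPolynomial (Fin 7) A →ₐ[A] PluckerRing A :=
  -- The first five parameters are the sides of a pentagon on the indices. Setting them to zero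
  -- leaves the Stanley–Reisner ring of a pentagon in the five diagonals, and two more linear forms
  -- cut it down to rank five.
  MvPolynomial.aeval ![p A 0 1, p A 1 2, p A 2 3, p A 3 4, p A 0 4, p A 0 2 + p A 1 4 + p A 0 3,
    p A 2 4 + p A 1 3 + p A 0 3]

lemma lift_algebraMap_aux {P S : Type*} [CommRing P] [CommRing S] {e : Fin 7 → P} (f : P →+* S)
    (a b c : S) (hac haa hab hbb hcc) (r : P) :
    FiveAlg.lift (e := e) f a b c hac haa hab hbb hcc (algebraMap P _ r) = f r := by
  simp [FiveAlg.lift, FiveAlg.algebraMap_eq]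

lemma lift_mk_aux {P S : Type*} [CommRing P] [CommRing S] {e : Fin 7 → P} (f : P →+* S)
    (a b c : S) (hac haa hab hbb hcc) (x0 x1 x2 x3 x4 : P) :
    FiveAlg.lift (e := e) f a b c hac haa hab hbb hcc ⟨x0, x1, x2, x3, x4⟩ =
      f x0 + f x1 * a + f x2 * b + f x3 * c + f x4 * (b * c) := rfl

/-- The map from the Plücker ring to the free algebra of rank five. -/
noncomputable def toFiveAlg :
    PluckerRing A →+* FiveAlg (MvPolynomial (Fin 7) A) MvPolynomial.X :=
  liftRingHom ((algebraMap (MvPolynomial (Fin 7) A) _).comp MvPolynomial.C)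
      (FiveAlg.coords MvPolynomial.X) FiveAlg.isPlucker_coords

lemma toFiveAlg_param (r : MvPolynomial (Fin 7) A) :
    toFiveAlg A (param A r) = algebraMap _ _ r := by
  change ((toFiveAlg A).comp (param A).toRingHom) r = _
  refine RingHom.congr_fun (MvPolynomial.ringHom_ext (fun a => ?_) fun i => ?_) r
  · simp [toFiveAlg]
  · fin_cases i <;> simp [toFiveAlg, param, FiveAlg.coords, skewFamily, FiveAlg.algebraMap_eq] <;>
    ext <;> simp

/-- The Plücker ring is free of rank five over a polynomial ring in seven variables. -/
noncomputable def fiveEquiv : PluckerRing A ≃+* FiveAlg (MvPolynomial (Fin 7) A) MvPolynomial.X :=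
  have h := (isPlucker_p A).rel
  RingEquiv.ofRingHom (toFiveAlg A)
    (FiveAlg.lift (param A).toRingHom (p A 1 4) (p A 1 3) (p A 0 3)
      -- One Plücker relation for each four-element set of indices, each giving one product of the
      -- generators.
      (by simp [param]; linear_combination -h 0 1 3 4)
      (by simp [param]; linear_combination h 0 1 2 4)
      (by simp [param]; linear_combination h 0 1 2 3)
      (by simp [param]; linear_combination h 1 2 3 4)
      (by simp [param]; linear_combination h 0 2 3 4))
    (by
      refine FiveAlg.ringHom_ext (fun r => ?_) ?_ ?_ ?_
      · rw [RingHom.comp_apply, lift_algebraMap_aux]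
        exact toFiveAlg_param A r
      all_goals simp [lift_mk_aux, toFiveAlg, FiveAlg.coords, skewFamily])
    (by
      refine ringHom_ext (map_p_eq_of_lt fun i j hij => ?_) fun a => ?_
      · fin_cases i <;> fin_cases j <;> first | exact absurd hij (by decide) |
          (simp [toFiveAlg, FiveAlg.coords, skewFamily, lift_mk_aux, param]; done) |
          (simp [toFiveAlg, FiveAlg.coords, skewFamily, lift_mk_aux, param]; ring)
      · simp [toFiveAlg, lift_algebraMap_aux])

lemma fiveEquiv_param (r : MvPolynomial (Fin 7) A) :
    fiveEquiv A (param A r) = algebraMap _ _ r :=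
  toFiveAlg_param A r

lemma fiveEquiv_p (i j : Fin 5) : fiveEquiv A (p A i j) = FiveAlg.coords MvPolynomial.X i j :=
  liftRingHom_p _ _ FiveAlg.isPlucker_coords i j

end PluckerRing

/-! ### Charts, primality of `p 0 1` and factoriality -/

namespace PluckerRing

variable (A : Type*) [CommRing A]

lemma fiveEquiv_p01 : fiveEquiv A (p A 0 1) = algebraMap (MvPolynomial (Fin 7) A) _ (.X 0) := by
  rw [fiveEquiv_p, FiveAlg.algebraMap_eq]; rfl

lemma fiveEquiv_p12 : fiveEquiv A (p A 1 2) = algebraMap (MvPolynomial (Fin 7) A) _ (.X 1) := by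
  rw [fiveEquiv_p, FiveAlg.algebraMap_eq]; rfl

lemma p01_mem_nonZeroDivisors [IsDomain A] : p A 0 1 ∈ nonZeroDivisors (PluckerRing A) := by
  rw [mem_nonZeroDivisors_iff_right]
  intro x hx
  have hX : (MvPolynomial.X 0 : MvPolynomial (Fin 7) A) ≠ 0 := MvPolynomial.X_ne_zero 0
  have h := congrArg (fiveEquiv A) hx
  rw [map_mul, fiveEquiv_p01, mul_comm, ← Algebra.smul_def, map_zero] at h
  rw [← map_eq_zero_iff _ (fiveEquiv A).injective,
    ← map_eq_zero_iff _ (FiveAlg.coordEquiv _ _).injective]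
  refine (smul_eq_zero.1 ?_).resolve_left hX
  rw [← map_smul, h, map_zero]

/-- `p 0 1` and `p 1 2` are two of the variables of the polynomial ring over which the Plücker ring
is free, so they form a regular sequence; divisibility is tested on the five coordinates. -/
lemma p01_dvd_of_dvd_p12_mul [IsDomain A] {x : PluckerRing A} (hx : p A 0 1 ∣ p A 1 2 * x) :
    p A 0 1 ∣ x := by
  obtain ⟨y, hy⟩ := hx
  have h := congrArg (fiveEquiv A) hy
  rw [map_mul, map_mul, fiveEquiv_p01, fiveEquiv_p12, ← Algebra.smul_def, ← Algebra.smul_def] at h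
  have key (f g : MvPolynomial (Fin 7) A) (hfg : .X 1 * f = .X 0 * g) :
      ∃ f', f = .X 0 * f' := by
    refine ((MvPolynomial.X_prime (i := 0)).dvd_or_dvd ⟨g, hfg⟩).resolve_left fun h' => ?_
    rw [MvPolynomial.X_dvd_X] at h'
    revert h'
    decide
  obtain ⟨d0, h0⟩ := key _ _ (congrArg FiveAlg.c0 h)
  obtain ⟨d1, h1⟩ := key _ _ (congrArg FiveAlg.c1 h)
  obtain ⟨d2, h2⟩ := key _ _ (congrArg FiveAlg.c2 h)
  obtain ⟨d3, h3⟩ := key _ _ (congrArg FiveAlg.c3 h)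
  obtain ⟨d4, h4⟩ := key _ _ (congrArg FiveAlg.c4 h)
  refine ⟨(fiveEquiv A).symm ⟨d0, d1, d2, d3, d4⟩, (fiveEquiv A).injective ?_⟩
  rw [map_mul, RingEquiv.apply_symm_apply, fiveEquiv_p01, ← Algebra.smul_def]
  ext1
  exacts [h0, h1, h2, h3, h4]

/-- The Plücker coordinates of the planes which meet the coordinate plane `x₀ = x₁ = 0` trivially. -/
noncomputable def minors : PluckerRing A →ₐ[A] MvPolynomial (Fin 7) A :=
  -- The first two columns form `diag(X₀, 1)`, so `p 0 1` becomes `X₀`, and the other entries are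
  -- read off from `p 0 j` and `p 1 j`.
  lift _ (.of_minors ![.X 0, 0, .X 1, .X 2, .X 3] ![0, 1, .X 4, .X 5, .X 6])

/-- The affine chart `p₀₁ ≠ 0`. -/
noncomputable def chart : MvPolynomial (Fin 7) A →ₐ[A] Localization.Away (p A 0 1) :=
  let a (i j : Fin 5) := algebraMap _ (Localization.Away (p A 0 1)) (p A i j)
  let b := IsLocalization.Away.invSelf (p A 0 1)
  MvPolynomial.aeval ![a 0 1, -a 1 2, -a 1 3, -a 1 4, a 0 2 * b, a 0 3 * b, a 0 4 * b]

/-- The relation with indices `0, 1, i, j` expresses `p 0 1 * p i j` through coordinates involving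
`0` or `1`; once `p 0 1` is invertible these determine everything. -/
lemma chart_minors (x : PluckerRing A) : chart A (minors A x) = algebraMap _ _ x := by
  change ((chart A).comp (minors A)) x = IsScalarTower.toAlgHom A _ _ x
  refine DFunLike.congr_fun (algHom_ext fun i j => ?_) x
  have hab : algebraMap _ (Localization.Away (p A 0 1)) (p A 0 1) *
      IsLocalization.Away.invSelf (p A 0 1) = 1 := IsLocalization.Away.mul_invSelf _
  have hP := (isPlucker_p A).map (algebraMap _ (Localization.Away (p A 0 1)))
  have hr (i) : chart A ((![.X 0, 0, .X 1, .X 2, .X 3] : Fin 5 → _) i) =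
      -algebraMap _ (Localization.Away (p A 0 1)) (p A 1 i) := by
    fin_cases i <;> simp [chart, hP.self, hP.swap 1 0]
  have hs (i) : chart A ((![0, 1, .X 4, .X 5, .X 6] : Fin 5 → _) i) =
      algebraMap _ (Localization.Away (p A 0 1)) (p A 0 i) *
        IsLocalization.Away.invSelf (p A 0 1) := by
    fin_cases i <;> simp [chart, hP.self, hab]
  rw [AlgHom.comp_apply, minors, lift_p, map_sub, map_mul, map_mul, hr, hr, hs, hs]
  simp only [IsScalarTower.coe_toAlgHom']
  linear_combination -(IsLocalization.Away.invSelf (p A 0 1)) * hP.rel 0 1 i j +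
    algebraMap _ (Localization.Away (p A 0 1)) (p A i j) * hab

/-- Since `p 0 1` is not a zero divisor, the ring embeds in its localization, and that embedding
factors through `minors`. This makes the Plücker ring a domain. -/
lemma minors_injective [IsDomain A] : Function.Injective (minors A) := by
  have h : Function.Injective (algebraMap (PluckerRing A) (Localization.Away (p A 0 1))) :=
    IsLocalization.injective _ (Submonoid.powers_le.2 (p01_mem_nonZeroDivisors A))
  refine Function.Injective.of_comp (f := chart A) ?_
  convert h using 1
  exact funext (chart_minors A)

instance [IsDomain A] : IsDomain (PluckerRing A) := (minors_injective A).isDomain (minors A).toRingHom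

@[simp] lemma minors_p01 : minors A (p A 0 1) = .X 0 := by simp [minors]

@[simp] lemma chart_X_zero : chart A (.X 0) = algebraMap _ _ (p A 0 1) := by simp [chart]

lemma isUnit_powers_of_isUnit {B C : Type*} [CommRing B] [CommRing C] (x : B) (f : B →+* C)
    (hf : IsUnit (f x)) (y : Submonoid.powers x) : IsUnit (f y) := by
  obtain ⟨_, n, rfl⟩ := y
  simpa using hf.pow n

/-- The coordinate ring of the complement of a coordinate hyperplane in affine space. -/
abbrev ChartRing : Type _ := Localization.Away (MvPolynomial.X 0 : MvPolynomial (Fin 7) A)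

/-- The minors with `p₀₁` inverted. -/
noncomputable def chartHom : Localization.Away (p A 0 1) →ₐ[A] ChartRing A :=
  IsLocalization.liftAlgHom (M := Submonoid.powers (p A 0 1))
    (f := (IsScalarTower.toAlgHom A (MvPolynomial (Fin 7) A) (ChartRing A)).comp (minors A))
    (isUnit_powers_of_isUnit (p A 0 1) _ (by
      change IsUnit (algebraMap (MvPolynomial (Fin 7) A) (ChartRing A) (minors A (p A 0 1)))
      rw [minors_p01]
      exact IsLocalization.Away.algebraMap_isUnit (MvPolynomial.X 0 : MvPolynomial (Fin 7) A)))

/-- The inverse of `chartHom`. -/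
noncomputable def chartInv : ChartRing A →ₐ[A] Localization.Away (p A 0 1) :=
  IsLocalization.liftAlgHom (M := Submonoid.powers (MvPolynomial.X 0 : MvPolynomial (Fin 7) A))
    (f := chart A) (isUnit_powers_of_isUnit (MvPolynomial.X 0) _ (by
      change IsUnit (chart A (.X 0))
      rw [chart_X_zero]
      exact IsLocalization.Away.algebraMap_isUnit (p A 0 1)))

lemma chartHom_algebraMap (x : PluckerRing A) :
    chartHom A (algebraMap _ _ x) = algebraMap _ _ (minors A x) := by simp [chartHom]

lemma chartInv_algebraMap (x : MvPolynomial (Fin 7) A) :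
    chartInv A (algebraMap _ _ x) = chart A x := by simp [chartInv]

lemma chartHom_mul_invSelf (x : PluckerRing A) (y : MvPolynomial (Fin 7) A)
    (h : minors A x = .X 0 * y) :
    chartHom A (algebraMap _ _ x * IsLocalization.Away.invSelf (p A 0 1)) =
      algebraMap _ _ y := by
  have h1 := congrArg (chartHom A)
    (IsLocalization.Away.mul_invSelf (S := Localization.Away (p A 0 1)) (p A 0 1))
  rw [map_mul, chartHom_algebraMap, minors_p01, map_one] at h1
  rw [map_mul, chartHom_algebraMap, h, map_mul]
  linear_combination algebraMap (MvPolynomial (Fin 7) A) (ChartRing A) y * h1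

lemma chartHom_chart (x : MvPolynomial (Fin 7) A) :
    chartHom A (chart A x) = algebraMap _ _ x := by
  change ((chartHom A).comp (chart A)) x = IsScalarTower.toAlgHom A _ (ChartRing A) x
  refine DFunLike.congr_fun (MvPolynomial.algHom_ext fun i => ?_) x
  change chartHom A (chart A (.X i)) = algebraMap (MvPolynomial (Fin 7) A) (ChartRing A) (.X i)
  rw [chart, MvPolynomial.aeval_X]
  fin_cases i
  · exact (chartHom_algebraMap A _).trans (by simp [minors])
  · exact ((map_neg _ _).trans (congrArg _ (chartHom_algebraMap A _))).trans (by simp [minors])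
  · exact ((map_neg _ _).trans (congrArg _ (chartHom_algebraMap A _))).trans (by simp [minors])
  · exact ((map_neg _ _).trans (congrArg _ (chartHom_algebraMap A _))).trans (by simp [minors])
  all_goals exact chartHom_mul_invSelf A _ _ (by simp [minors])

/-- The affine chart `p₀₁ ≠ 0` of the cone is an open subscheme of affine space. -/
noncomputable def chartEquiv : Localization.Away (p A 0 1) ≃ₐ[A] ChartRing A :=
  AlgEquiv.ofAlgHom (chartHom A) (chartInv A)
    (IsLocalization.algHom_ext (Submonoid.powers (MvPolynomial.X 0 : MvPolynomial (Fin 7) A)) <|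
      AlgHom.ext fun x => by
        change chartHom A (chartInv A (algebraMap _ _ x)) = algebraMap _ _ x
        rw [chartInv_algebraMap, chartHom_chart])
    (IsLocalization.algHom_ext (Submonoid.powers (p A 0 1)) <| AlgHom.ext fun x => by
      change chartInv A (chartHom A (algebraMap _ _ x)) = algebraMap _ _ x
      rw [chartHom_algebraMap, chartInv_algebraMap, chart_minors])

/-- The Plücker coordinates of the planes on which `p₀₁` vanishes and `p₁₂` does not. -/
noncomputable def minors' : PluckerRing A →ₐ[A] MvPolynomial (Fin 6) A :=
  -- Columns 0 and 1 are proportional, which forces `p 0 1 = 0`, while `p 1 2` becomes `X₀`.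
  lift _ (.of_minors ![.X 0 * .X 1, .X 0, 0, .X 2, .X 3] ![0, 0, 1, .X 4, .X 5])

@[simp] lemma minors'_p01 : minors' A (p A 0 1) = 0 := by simp [minors']

/-- After inverting `w 1 2`, the relations with indices `1, 2, i, j` show that `w` is a
specialization of the family defining `minors'`. It will be applied to the quotient by `p 0 1`,
where `p 1 2` is still a nonzerodivisor. -/
lemma lift_eq_zero_of_minors'_eq_zero {Q : Type*} [CommRing Q] [Algebra A Q]
    {w : Fin 5 → Fin 5 → Q} (hw : IsPlucker w) (h01 : w 0 1 = 0)
    (h12 : w 1 2 ∈ nonZeroDivisors Q) {x : PluckerRing A} (hx : minors' A x = 0) :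
    lift w hw x = 0 := by
  let a (i j : Fin 5) := algebraMap Q (Localization.Away (w 1 2)) (w i j)
  let b : Localization.Away (w 1 2) := IsLocalization.Away.invSelf (w 1 2)
  have hab : a 1 2 * b = 1 := IsLocalization.Away.mul_invSelf _
  have h01 : a 0 1 = 0 := by simp [a, h01]
  have hP : IsPlucker a := hw.map (algebraMap Q (Localization.Away (w 1 2)))
  let χ : MvPolynomial (Fin 6) A →ₐ[A] Localization.Away (w 1 2) :=
    MvPolynomial.aeval ![a 1 2, a 0 2 * b, a 3 2, a 4 2, a 1 3 * b, a 1 4 * b]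
  have key (x) : χ (minors' A x) = algebraMap Q (Localization.Away (w 1 2)) (lift w hw x) := by
    change (χ.comp (minors' A)) x =
      ((IsScalarTower.toAlgHom A Q (Localization.Away (w 1 2))).comp (lift w hw)) x
    refine DFunLike.congr_fun (algHom_ext fun i j => ?_) x
    have hr (i) : χ ((![.X 0 * .X 1, .X 0, 0, .X 2, .X 3] : Fin 5 → _) i) = a i 2 := by
      fin_cases i <;> simp [χ, hP.self]
      linear_combination a 0 2 * hab
    have hs (i) : χ ((![0, 0, 1, .X 4, .X 5] : Fin 5 → _) i) = a 1 i * b := by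
      fin_cases i <;> simp [χ, hP.self, hP.swap 1 0, h01, hab]
    rw [AlgHom.comp_apply, AlgHom.comp_apply, minors', lift_p, lift_p, map_sub, map_mul, map_mul,
      hr, hr, hs, hs]
    change _ = a i j
    rw [hP.swap i 2, hP.swap j 2]
    linear_combination -b * hP.rel 1 2 i j + a i j * hab
  refine IsLocalization.injective (Localization.Away (w 1 2)) (Submonoid.powers_le.2 h12) ?_
  rw [← key, hx, map_zero, map_zero]

lemma dvd_of_minors'_eq_zero [IsDomain A] {x : PluckerRing A} (hx : minors' A x = 0) :
    p A 0 1 ∣ x := by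
  let π := Ideal.Quotient.mkₐ A (Ideal.span {p A 0 1})
  have hw := (isPlucker_p A).map (Ideal.Quotient.mk (Ideal.span {p A 0 1}))
  have hπ : lift _ hw = π := algHom_ext fun i j => lift_p _ hw i j
  rw [← Ideal.mem_span_singleton, ← Ideal.Quotient.eq_zero_iff_mem]
  change π x = 0
  rw [← hπ]
  refine lift_eq_zero_of_minors'_eq_zero A hw
    (Ideal.Quotient.eq_zero_iff_mem.2 (Ideal.subset_span (Set.mem_singleton _))) ?_ hx
  rw [mem_nonZeroDivisors_iff_right]
  intro z hz
  obtain ⟨z, rfl⟩ := Ideal.Quotient.mk_surjective z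
  have : Ideal.Quotient.mk (Ideal.span {p A 0 1}) (z * p A 1 2) = 0 := hz
  rw [Ideal.Quotient.eq_zero_iff_mem, Ideal.mem_span_singleton, mul_comm] at this
  rw [Ideal.Quotient.eq_zero_iff_mem, Ideal.mem_span_singleton]
  exact p01_dvd_of_dvd_p12_mul A this

/-- The quotient by `p 0 1` embeds via `minors'` in a polynomial ring, hence is a domain. -/
lemma prime_p01 [IsDomain A] : Prime (p A 0 1) := by
  have hk : RingHom.ker (minors' A) = Ideal.span {p A 0 1} :=
    le_antisymm (fun x hx => Ideal.mem_span_singleton.2 (dvd_of_minors'_eq_zero A hx)) <| by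
      rw [Ideal.span_singleton_le_iff_mem]; exact minors'_p01 A
  rw [← Ideal.span_singleton_prime (nonZeroDivisors.ne_zero (p01_mem_nonZeroDivisors A)), ← hk]
  exact RingHom.ker_isPrime _

/-- Nagata's criterion: `p 0 1` is prime, and inverting it gives a localization of a polynomial
ring, which is factorial. -/
instance [IsDomain A] [UniqueFactorizationMonoid A] [IsNoetherianRing A] :
    UniqueFactorizationMonoid (PluckerRing A) := by
  rw [UniqueFactorizationMonoid.iff_localizationAway_of_prime (prime_p01 A)]
  exact (chartEquiv A).symm.toMulEquiv.uniqueFactorizationMonoid inferInstance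

end PluckerRing

/-! ### Dimension, base change and regularity away from the vertex -/

section General

/-- Incomparability gives one inequality; lying over and going up lift chains for the other. -/
lemma ringKrullDim_eq_of_isIntegral (R S : Type*) [CommRing R] [CommRing S] [Algebra R S]
    [Algebra.IsIntegral R S] [FaithfulSMul R S] : ringKrullDim S = ringKrullDim R := by
  refine le_antisymm ?_ ?_
  · refine Order.krullDim_le_of_strictMono (PrimeSpectrum.comap (algebraMap R S)) fun p q h => ?_
    exact Ideal.IsIntegral.comap_lt_comap (I := p.asIdeal) h
  · refine iSup_le fun l => ?_
    obtain ⟨Q, hQ⟩ := (inferInstance : Nonempty (Ideal.primesOver l.head.asIdeal S))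
    have := hQ.1
    have := hQ.2
    obtain ⟨L, hL, -⟩ := Ideal.exists_ltSeries_of_hasGoingUp l Q
    rw [← hL]
    exact Order.LTSeries.length_le_krullDim L

lemma isRegularLocalRing_of_isLocalization {T S : Type*} [CommRing T] [CommRing S] [Algebra T S]
    (M : Submonoid T) [IsLocalization M S] [IsRegularRing S] (q : Ideal T) [q.IsPrime]
    (hd : Disjoint (M : Set T) q) : IsRegularLocalRing (Localization.AtPrime q) := by
  have hQ := IsLocalization.isPrime_of_isPrime_disjoint M S q inferInstance hd
  have hc : (q.map (algebraMap T S)).comap (algebraMap T S) = q :=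
    IsLocalization.under_map_of_isPrime_disjoint M S inferInstance hd
  have h := IsLocalization.isLocalization_isLocalization_atPrime_isLocalization M
    (Localization.AtPrime (q.map (algebraMap T S))) (q.map (algebraMap T S))
  have : IsLocalization.AtPrime (Localization.AtPrime (q.map (algebraMap T S))) q := by
    convert h
    exact hc.symm
  exact .of_ringEquiv (IsLocalization.algEquiv q.primeCompl
    (Localization.AtPrime (q.map (algebraMap T S))) (Localization.AtPrime q)).toRingEquiv

lemma isRegularRing_of_isLocalization {T S : Type*} [CommRing T] [CommRing S] [Algebra T S]
    (M : Submonoid T) [IsLocalization M S] [IsRegularRing T] : IsRegularRing S := by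
  have := IsLocalization.isNoetherianRing M S inferInstance
  refine isRegularRing_iff.2 fun Q _ => ?_
  have := IsLocalization.isLocalization_isLocalization_atPrime_isLocalization M
    (Localization.AtPrime Q) Q
  exact .of_ringEquiv (IsLocalization.algEquiv (Q.comap (algebraMap T S)).primeCompl
    (Localization.AtPrime (Q.comap (algebraMap T S))) (Localization.AtPrime Q)).toRingEquiv

lemma disjoint_powers_iff {T : Type*} [CommRing T] (x : T) (q : Ideal T) [q.IsPrime] :
    Disjoint (Submonoid.powers x : Set T) q ↔ x ∉ q :=
  Ideal.disjoint_powers_iff_notMem_of_isPrime x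

end General

namespace FiveAlg

instance {P : Type*} [CommRing P] {e : Fin 7 → P} : FaithfulSMul P (FiveAlg P e) :=
  (faithfulSMul_iff_algebraMap_injective _ _).2 fun r s h => by
    simpa [algebraMap_eq] using h

end FiveAlg

namespace PluckerRing

variable (A : Type*) [CommRing A]

lemma minors_algebraMap (a : A) : minors A (algebraMap A _ a) = .C a := (minors A).commutes a

lemma algebraMap_injective : Function.Injective (algebraMap A (PluckerRing A)) :=
  .of_comp (f := minors A) <| by
    convert MvPolynomial.C_injective (Fin 7) A using 1
    exact funext (minors_algebraMap A)

lemma fiveEquiv_algebraMap (a : A) :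
    fiveEquiv A (algebraMap A _ a) = algebraMap (MvPolynomial (Fin 7) A) _ (.C a) := by
  rw [← fiveEquiv_param]
  exact congrArg _ ((param A).commutes a).symm

/-- The Plücker ring as a module over the base ring. -/
noncomputable def linearEquiv : PluckerRing A ≃ₗ[A] (Fin 5 → MvPolynomial (Fin 7) A) :=
  { ((fiveEquiv A).toAddEquiv.trans (FiveAlg.coordEquiv _ _).toAddEquiv) with
    map_smul' := fun a x => by
      change FiveAlg.coordEquiv _ _ (fiveEquiv A (a • x)) = a • FiveAlg.coordEquiv _ _ _
      rw [Algebra.smul_def, map_mul, fiveEquiv_algebraMap, ← Algebra.smul_def, map_smul]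
      ext1 i
      simp [MvPolynomial.smul_eq_C_mul] }

instance : Module.Free A (PluckerRing A) := .of_equiv (linearEquiv A).symm

lemma ringKrullDim_eq [IsNoetherianRing A] : ringKrullDim (PluckerRing A) = ringKrullDim A + 7 := by
  rw [ringKrullDim_eq_of_ringEquiv (fiveEquiv A),
    ringKrullDim_eq_of_isIntegral (MvPolynomial (Fin 7) A),
    MvPolynomial.ringKrullDim_of_isNoetherianRing]
  simp

variable (B : Type*) [CommRing B] [Algebra A B]

/-- The formation of the Plücker ring commutes with base change. -/
noncomputable def baseChangeEquiv : B ⊗[A] PluckerRing A ≃ₐ[B] PluckerRing B :=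
  have h : IsPlucker fun i j => (1 : B) ⊗ₜ[A] p A i j :=
    (isPlucker_p A).map (Algebra.TensorProduct.includeRight : _ →ₐ[A] B ⊗[A] PluckerRing A).toRingHom
  AlgEquiv.ofAlgHom
    (Algebra.TensorProduct.lift (Algebra.ofId B _) (lift (p B) (isPlucker_p B))
      fun _ _ => Commute.all _ _)
    (lift _ h)
    (algHom_ext fun i j => by simp)
    (Algebra.TensorProduct.ext (by ext) (algHom_ext fun i j => by simp))

@[simp] lemma baseChangeEquiv_tmul (i j : Fin 5) :
    baseChangeEquiv A B (1 ⊗ₜ p A i j) = p B i j := by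
  simp [baseChangeEquiv]

variable {A}

/-- The endomorphism given by a permutation of the coordinates. -/
noncomputable def permHom (σ : Equiv.Perm (Fin 5)) : PluckerRing A →ₐ[A] PluckerRing A :=
  lift _ ((isPlucker_p A).comp σ)

/-- The action of permutations of the coordinates. -/
noncomputable def perm (σ : Equiv.Perm (Fin 5)) : PluckerRing A ≃ₐ[A] PluckerRing A :=
  AlgEquiv.ofAlgHom (permHom σ) (permHom σ.symm)
    (algHom_ext fun i j => by simp [permHom]) (algHom_ext fun i j => by simp [permHom])

@[simp] lemma perm_p (σ : Equiv.Perm (Fin 5)) (i j : Fin 5) :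
    perm σ (p A i j) = p A (σ i) (σ j) :=
  lift_p (fun i j => p A (σ i) (σ j)) ((isPlucker_p A).comp σ) i j

variable (A)

lemma isRegularRing_away_p01 [IsRegularRing A] :
    IsRegularRing (Localization.Away (p A 0 1)) := by
  have : IsRegularRing (ChartRing A) := 
    isRegularRing_of_isLocalization (Submonoid.powers (MvPolynomial.X 0 : MvPolynomial (Fin 7) A))
  exact .of_ringEquiv (chartEquiv A).symm.toRingEquiv

/-- A permutation of the five coordinates sending `0, 1` to `i, j` carries the chart `p 0 1 ≠ 0` to
this one. -/
lemma isRegularRing_away [IsRegularRing A] {i j : Fin 5} (hij : i ≠ j) :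
    IsRegularRing (Localization.Away (p A i j)) := by
  have : IsRegularRing (Localization.Away (p A 0 1)) := isRegularRing_away_p01 A
  obtain ⟨σ, h0, h1⟩ : ∃ σ : Equiv.Perm (Fin 5), σ 0 = i ∧ σ 1 = j := by
    refine ⟨Equiv.swap (Equiv.swap 0 i 1) j * Equiv.swap 0 i, ?_, ?_⟩
    · have h : i ≠ Equiv.swap 0 i 1 := fun h => by
        have := (Equiv.swap 0 i).injective ((Equiv.swap_apply_left 0 i).trans h)
        exact absurd this (by decide)
      rw [Equiv.Perm.mul_apply, Equiv.swap_apply_left, Equiv.swap_apply_of_ne_of_ne h hij]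
    · rw [Equiv.Perm.mul_apply, Equiv.swap_apply_left]
  refine .of_ringEquiv (IsLocalization.ringEquivOfRingEquiv (M := Submonoid.powers (p A 0 1))
    (T := Submonoid.powers (p A i j)) (Localization.Away (p A 0 1)) (Localization.Away (p A i j))
    (perm σ).toRingEquiv ?_)
  rw [Submonoid.map_powers]
  congr 1
  subst h0 h1
  exact perm_p σ 0 1

/-- The ideal of the vertex of the cone. -/
noncomputable def vertexIdeal : Ideal (PluckerRing A) :=
  Ideal.span (Set.range fun ij : Fin 5 × Fin 5 => p A ij.1 ij.2)

lemma p_mem_vertexIdeal (i j : Fin 5) : p A i j ∈ vertexIdeal A :=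
  Ideal.subset_span ⟨(i, j), rfl⟩

lemma exists_p_notMem {q : Ideal (PluckerRing A)} (hq : ¬ vertexIdeal A ≤ q) :
    ∃ i j, i ≠ j ∧ p A i j ∉ q := by
  by_contra! h
  refine hq (Ideal.span_le.2 ?_)
  rintro _ ⟨⟨i, j⟩, rfl⟩
  rcases eq_or_ne i j with rfl | hij
  · simp [(isPlucker_p A).self]
  · exact h i j hij

lemma isRegularLocalRing_of_not_le [IsRegularRing A] (q : Ideal (PluckerRing A)) [q.IsPrime]
    (hq : ¬ vertexIdeal A ≤ q) : IsRegularLocalRing (Localization.AtPrime q) := by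
  obtain ⟨i, j, hij, h⟩ := exists_p_notMem A hq
  have := isRegularRing_away A hij
  exact isRegularLocalRing_of_isLocalization (S := Localization.Away (p A i j))
    (Submonoid.powers (p A i j)) q ((disjoint_powers_iff _ _).2 h)

attribute [local instance] Polynomial.algebra Polynomial.isLocalization in
lemma isRegularLocalRing_polynomial_of_not_le [IsRegularRing A]
    (q : Ideal (Polynomial (PluckerRing A))) [q.IsPrime]
    (hq : ¬ (vertexIdeal A).map Polynomial.C ≤ q) :
    IsRegularLocalRing (Localization.AtPrime q) := by
  rw [Ideal.map_le_iff_le_comap] at hq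
  obtain ⟨i, j, hij, h⟩ := exists_p_notMem A hq
  have := isRegularRing_away A hij
  refine isRegularLocalRing_of_isLocalization
    (S := Polynomial (Localization.Away (p A i j)))
    ((Submonoid.powers (p A i j)).map Polynomial.C) q ?_
  rw [Submonoid.map_powers]
  exact (disjoint_powers_iff _ _).2 h

end PluckerRing

/-! ### Regular systems of parameters -/

open IsLocalRing in
lemma maximalIdeal_quotient_span_cons {S : Type*} [CommRing S] [IsLocalRing S] {x : S}
    [IsLocalRing (S ⧸ Ideal.span {x})] {xs : List S}
    (hm : maximalIdeal S = Ideal.ofList (x :: xs)) :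
    maximalIdeal (S ⧸ Ideal.span {x}) =
      Ideal.ofList (xs.map (Ideal.Quotient.mk (Ideal.span {x}))) := by
  have hsurj : Function.Surjective (Ideal.Quotient.mk (Ideal.span {x})) :=
    Ideal.Quotient.mk_surjective
  have := IsLocalHom.of_surjective _ hsurj
  rw [← IsLocalRing.map_maximalIdeal_of_surjective _ hsurj, hm, Ideal.map_ofList, List.map_cons,
    Ideal.ofList_cons, Ideal.Quotient.mk_singleton_self, Ideal.span_singleton_zero, bot_sup_eq]

lemma ringKrullDim_le_ringKrullDim_quotient_span_singleton_add_one {S : Type*} [CommRing S]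
    [IsNoetherianRing S] [IsLocalRing S] {x : S} (hx : x ∈ IsLocalRing.maximalIdeal S) :
    ringKrullDim S ≤ ringKrullDim (S ⧸ Ideal.span {x}) + 1 := by
  have := ringKrullDim_le_ringKrullDim_quotient_add_card {x}
    (by simpa [IsLocalRing.ringJacobson_eq_maximalIdeal] using hx)
  rwa [Finset.coe_singleton, Finset.card_singleton, Nat.cast_one] at this

lemma isLocalRing_quotient_of_le {S : Type*} [CommRing S] [IsLocalRing S] {I : Ideal S}
    (hI : I ≤ IsLocalRing.maximalIdeal S) : IsLocalRing (S ⧸ I) :=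
  have : Nontrivial (S ⧸ I) := Ideal.Quotient.nontrivial_iff.2 fun h =>
    (IsLocalRing.maximalIdeal.isMaximal S).ne_top (top_le_iff.1 (h ▸ hI))
  .of_surjective' (Ideal.Quotient.mk I) Ideal.Quotient.mk_surjective

lemma exists_isPrime_le_ringKrullDim_quotient {S : Type*} [CommRing S] {n : ℕ}
    (h : (n : WithBot ℕ∞) ≤ ringKrullDim S) :
    ∃ Q : Ideal S, Q.IsPrime ∧ (n : WithBot ℕ∞) ≤ ringKrullDim (S ⧸ Q) := by
  obtain ⟨l, rfl⟩ := Order.le_krullDim_iff.1 h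
  refine ⟨l.head.asIdeal, l.head.2, ?_⟩
  rw [ringKrullDim_quotient]
  refine Order.le_krullDim_iff.2 ⟨⟨l.length, fun i => ⟨l i, ?_⟩, fun i => l.step i⟩, rfl⟩
  exact l.head_le i

lemma ringKrullDim_quotient_add_one_le_of_ne_bot {S : Type*} [CommRing S] [IsDomain S]
    {I : Ideal S} (hI : I ≠ ⊥) : ringKrullDim (S ⧸ I) + 1 ≤ ringKrullDim S := by
  obtain ⟨x, hxI, hx⟩ := Submodule.exists_mem_ne_zero_of_ne_bot hI
  refine le_trans ?_ (ringKrullDim_quotient_succ_le_of_nonZeroDivisor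
    (mem_nonZeroDivisors_of_ne_zero hx))
  gcongr
  exact ringKrullDim_le_of_surjective
    (Ideal.Quotient.factor ((Ideal.span_singleton_le_iff_mem I).2 hxI))
    (Ideal.Quotient.factor_surjective _)

lemma spanFinrank_ofList_le {S : Type*} [CommRing S] (xs : List S) :
    (Ideal.ofList xs).spanFinrank ≤ xs.length := by
  classical
  refine (Submodule.spanFinrank_span_le_ncard_of_finite (List.finite_toSet xs)).trans ?_
  rw [← List.coe_toFinset, Set.ncard_coe_finset]
  exact List.toFinset_card_le xs

lemma ringKrullDim_le_length {S : Type*} [CommRing S] [IsNoetherianRing S] [IsLocalRing S]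
    {xs : List S} (hm : IsLocalRing.maximalIdeal S = Ideal.ofList xs) :
    ringKrullDim S ≤ xs.length :=
  (ringKrullDim_le_spanFinrank_maximalIdeal S).trans <| by
    rw [hm]; exact_mod_cast spanFinrank_ofList_le xs

lemma withBot_le_of_add_one_le {a : WithBot ℕ∞} {n : ℕ}
    (h : ((n + 1 : ℕ) : WithBot ℕ∞) ≤ a + 1) : (n : WithBot ℕ∞) ≤ a := by
  induction a with
  | bot => simp at h
  | coe a =>
    induction a with
    | top => exact le_top
    | coe a => norm_cast at h ⊢; omega

lemma not_add_one_le_of_le {a b : WithBot ℕ∞} {n : ℕ} (ha : (n : WithBot ℕ∞) ≤ a)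
    (hb : b ≤ n) : ¬ a + 1 ≤ b := by
  intro h
  have : ((n : WithBot ℕ∞)) + 1 ≤ n := (add_le_add_left ha 1).trans (h.trans hb)
  norm_cast at this
  omega

open Pointwise in
/-- The two quotients of a ring by an element agree. -/
noncomputable def spanSingletonQuotEquiv {S : Type*} [CommRing S] (x : S) :
    (S ⧸ Ideal.span {x}) ≃ₗ[S ⧸ Ideal.span {x}] QuotSMulTop x S :=
  (Submodule.quotEquivOfEq _ _ (by
    rw [← Submodule.ideal_span_singleton_smul]; simp)).extendScalarsOfSurjective
    Ideal.Quotient.mk_surjective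

/-- A Noetherian local ring whose maximal ideal is generated by a list of at most `dim S` elements
is a domain, and the list is a regular sequence. -/
theorem isDomain_and_isRegular_of_length_le_ringKrullDim {S : Type u} [CommRing S]
    [IsNoetherianRing S] [IsLocalRing S] (xs : List S)
    (hm : IsLocalRing.maximalIdeal S = Ideal.ofList xs)
    (hd : (xs.length : WithBot ℕ∞) ≤ ringKrullDim S) :
    IsDomain S ∧ RingTheory.Sequence.IsRegular S xs := by
  induction hn : xs.length generalizing S with
  | zero =>
    rw [List.length_eq_zero_iff] at hn
    subst hn
    rw [Ideal.ofList_nil] at hm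
    exact ⟨(IsLocalRing.isField_iff_maximalIdeal_eq.2 hm).isDomain, .nil S S⟩
  | succ n ih =>
    obtain _ | ⟨x, ys⟩ := xs
    · simp at hn
    have hx : x ∈ IsLocalRing.maximalIdeal S := by
      rw [hm]; exact Ideal.subset_span (by simp)
    have := isLocalRing_quotient_of_le ((Ideal.span_singleton_le_iff_mem _).2 hx)
    have hm' := maximalIdeal_quotient_span_cons hm
    have hdim := ringKrullDim_le_ringKrullDim_quotient_span_singleton_add_one hx
    simp only [List.length_cons, Nat.add_right_cancel_iff] at hn
    rw [List.length_cons, hn] at hd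
    have hd' : (n : WithBot ℕ∞) ≤ ringKrullDim (S ⧸ Ideal.span {x}) :=
      withBot_le_of_add_one_le (hd.trans hdim)
    obtain ⟨hdom, hreg⟩ := ih _ hm' (by simpa [hn] using hd') (by simpa using hn)
    have hle : ringKrullDim (S ⧸ Ideal.span {x}) ≤ n := by
      simpa [hn] using ringKrullDim_le_length hm'
    -- The prime `Q` at the foot of a longest chain turns out to be zero. Dimension excludes `x ∈
    -- Q`. Also `Q ⊆ (x)`, since the domain `S/(x)` has no proper quotient of its own dimension.
    -- Then `Q = xQ`, and Nakayama's lemma applies.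
    obtain ⟨Q, hQ, hQd⟩ := exists_isPrime_le_ringKrullDim_quotient hd
    have hQm : Q ≤ IsLocalRing.maximalIdeal S := IsLocalRing.le_maximalIdeal hQ.ne_top
    have hxQ : x ∉ Q := fun hxQ => by
      have h1 : ringKrullDim (S ⧸ Q) ≤ n := (ringKrullDim_le_of_surjective
        (Ideal.Quotient.factor ((Ideal.span_singleton_le_iff_mem Q).2 hxQ))
        (Ideal.Quotient.factor_surjective _)).trans hle
      have := hQd.trans h1
      norm_cast at this
      omega
    have hQx : Q ≤ Ideal.span {x} := by
      by_contra hne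
      have hbot : Q.map (Ideal.Quotient.mk (Ideal.span {x})) ≠ ⊥ := by
        rwa [Ne, Ideal.map_eq_bot_iff_le_ker, Ideal.mk_ker]
      have h1 := ringKrullDim_quotient_add_one_le_of_ne_bot hbot
      have := isLocalRing_quotient_of_le hQm
      have hxm : Ideal.Quotient.mk Q x ∈ IsLocalRing.maximalIdeal (S ⧸ Q) := by
        have hl := IsLocalHom.of_surjective _ (Ideal.Quotient.mk_surjective (I := Q))
        rw [← IsLocalRing.map_maximalIdeal_of_surjective _
          (Ideal.Quotient.mk_surjective (I := Q))]
        exact Ideal.mem_map_of_mem _ hx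
      have h2 : ringKrullDim (S ⧸ Q) ≤
          ringKrullDim ((S ⧸ Q) ⧸ (Ideal.span {x}).map (Ideal.Quotient.mk Q)) + 1 := by
        rw [Ideal.map_span, Set.image_singleton]
        exact ringKrullDim_le_ringKrullDim_quotient_span_singleton_add_one hxm
      rw [ringKrullDim_eq_of_ringEquiv (DoubleQuot.quotQuotEquivComm Q (Ideal.span {x}))] at h2
      exact not_add_one_le_of_le (withBot_le_of_add_one_le (hQd.trans h2)) hle h1
    have hQbot : Q = ⊥ := by
      rw [eq_bot_iff]
      refine Submodule.le_of_le_smul_of_le_jacobson_bot (I := IsLocalRing.maximalIdeal S)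
        (IsNoetherian.noetherian Q) (IsLocalRing.maximalIdeal_le_jacobson _) ?_
      intro y hy
      obtain ⟨z, rfl⟩ := Ideal.mem_span_singleton.1 (hQx hy)
      exact Submodule.mem_sup_right (Submodule.smul_mem_smul hx
        ((hQ.mem_or_mem hy).resolve_left hxQ))
    have hS : IsDomain S := by
      subst hQbot
      exact IsDomain.of_bot_isPrime S
    refine ⟨hS, .cons' ?_ (((spanSingletonQuotEquiv x).isRegular_congr _).1 hreg)⟩
    have hx0 : x ≠ 0 := fun h => hxQ (h ▸ Q.zero_mem)
    exact fun a b hab => mul_left_cancel₀ hx0 hab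

section

variable {S : Type u} [CommRing S] [IsNoetherianRing S] [IsLocalRing S]

open IsLocalRing

omit [IsLocalRing S] in
lemma exists_ofList_eq {I : Ideal S} (n : ℕ) (h : I.spanFinrank ≤ n) :
    ∃ xs : List S, xs.length = n ∧ I = Ideal.ofList xs := by
  obtain ⟨s, hs, hs'⟩ := Submodule.FG.exists_span_finset_card_eq_spanFinrank
    (IsNoetherian.noetherian I)
  refine ⟨s.toList ++ List.replicate (n - s.card) 0, ?_, ?_⟩
  · simp; omega
  · rw [Ideal.ofList_append, ← hs']
    have h1 : Ideal.ofList s.toList = Submodule.span S (s : Set S) := by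
      simp [Ideal.ofList, Ideal.span]
    have h2 : Ideal.ofList (List.replicate (n - s.card) (0 : S)) = ⊥ := by
      rw [Ideal.ofList, Ideal.span_eq_bot]
      simp
    rw [h1, h2, sup_bot_eq]

/-- Modulo `ys` the ring has dimension at least one and principal maximal ideal `(x)`, so it is a
domain in which `x² ≠ 0`. -/
lemma mem_maximalIdeal_of_mul_sq_mem (x : S) (ys : List S)
    (hm : maximalIdeal S = Ideal.ofList (x :: ys))
    (hd : (ys.length + 1 : ℕ) ≤ ringKrullDim S) {a : S}
    (ha : a * x ^ 2 ∈ Ideal.ofList ys) : a ∈ maximalIdeal S := by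
  have hle : Ideal.ofList ys ≤ maximalIdeal S := by
    rw [hm, Ideal.ofList_cons]; exact le_sup_right
  have := isLocalRing_quotient_of_le hle
  have hsurj := Ideal.Quotient.mk_surjective (I := Ideal.ofList ys)
  have hl := IsLocalHom.of_surjective _ hsurj
  have hm' : maximalIdeal (S ⧸ Ideal.ofList ys) =
      Ideal.ofList [Ideal.Quotient.mk (Ideal.ofList ys) x] := by
    rw [← IsLocalRing.map_maximalIdeal_of_surjective _ hsurj, hm, Ideal.ofList_cons, Ideal.map_sup,
      Ideal.map_quotient_self, sup_bot_eq, Ideal.map_span, Set.image_singleton,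
      Ideal.ofList_singleton]
  have hdim : ((1 : ℕ) : WithBot ℕ∞) ≤ ringKrullDim (S ⧸ Ideal.ofList ys) := by
    have h1 := ringKrullDim_le_ringKrullDim_quotient_add_spanFinrank (Ideal.ofList ys)
      (by rwa [ringJacobson_eq_maximalIdeal])
    have h2 : ((Ideal.ofList ys).spanFinrank : WithBot ℕ∞) ≤ ys.length := by
      exact_mod_cast spanFinrank_ofList_le ys
    have h3 := hd.trans (h1.trans (add_le_add_right h2 _))
    generalize ringKrullDim (S ⧸ Ideal.ofList ys) = d at h3 ⊢
    induction d with
    | bot => simp at h3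
    | coe a =>
      induction a with
      | top => exact le_top
      | coe a => norm_cast at h3 ⊢; omega
  obtain ⟨hdom, hreg⟩ := isDomain_and_isRegular_of_length_le_ringKrullDim _ hm' hdim
  have hx : Ideal.Quotient.mk (Ideal.ofList ys) x ≠ 0 := by
    have h := ((RingTheory.Sequence.isRegular_cons_iff _ _ _).1 hreg).1
    intro h0
    rw [h0] at h
    exact one_ne_zero (α := S ⧸ Ideal.ofList ys) (h (by simp))
  rw [← Ideal.Quotient.eq_zero_iff_mem, map_mul, map_pow] at ha
  exact hle (Ideal.Quotient.eq_zero_iff_mem.1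
    ((mul_eq_zero.1 ha).resolve_right (pow_ne_zero _ hx)))

variable {x y z : S} (hm : maximalIdeal S = Ideal.ofList [x, y, z]) (hd : 3 ≤ ringKrullDim S)

-- This is the independence of the six quadratic monomials modulo the maximal ideal. Working modulo
-- two parameters isolates a pure square. A mixed coefficient is reached by changing parameters: in
-- the system `x, y - x, z` the coefficient of `x²` is `a + b + d`.
include hm hd in
lemma coeff_mem_maximalIdeal_of_quadratic_eq_zero {a b c d e f : S}
    (h : a * x ^ 2 + b * y ^ 2 + c * z ^ 2 + d * (x * y) + e * (x * z) + f * (y * z) = 0) :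
    a ∈ maximalIdeal S ∧ b ∈ maximalIdeal S ∧ c ∈ maximalIdeal S ∧ d ∈ maximalIdeal S ∧
      e ∈ maximalIdeal S ∧ f ∈ maximalIdeal S := by
  have key (x y z : S) (hm : maximalIdeal S = Ideal.ofList [x, y, z]) (a r s : S)
      (h : a * x ^ 2 = r * y + s * z) : a ∈ maximalIdeal S := by
    refine mem_maximalIdeal_of_mul_sq_mem x [y, z] hm hd ?_
    rw [h]
    exact add_mem (Ideal.mul_mem_left _ _ (Ideal.subset_span (by simp)))
      (Ideal.mul_mem_left _ _ (Ideal.subset_span (by simp)))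
  have span (u v w : S) (hu : u ∈ maximalIdeal S) (hv : v ∈ maximalIdeal S)
      (hw : w ∈ maximalIdeal S) (h : ∀ I : Ideal S, u ∈ I → v ∈ I → w ∈ I → x ∈ I ∧ y ∈ I ∧ z ∈ I) :
      maximalIdeal S = Ideal.ofList [u, v, w] := by
    refine le_antisymm ?_ (Ideal.span_le.2 (by simp_all [Set.subset_def]))
    obtain ⟨h1, h2, h3⟩ := h (Ideal.ofList [u, v, w]) (Ideal.subset_span (by simp))
      (Ideal.subset_span (by simp)) (Ideal.subset_span (by simp))
    rw [hm]
    exact Ideal.span_le.2 (by simp_all [Set.subset_def])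
  have hx : x ∈ maximalIdeal S := by rw [hm]; exact Ideal.subset_span (by simp)
  have hy : y ∈ maximalIdeal S := by rw [hm]; exact Ideal.subset_span (by simp)
  have hz : z ∈ maximalIdeal S := by rw [hm]; exact Ideal.subset_span (by simp)
  have ha : a ∈ maximalIdeal S := key x y z hm a (-(b * y + d * x + f * z)) (-(c * z + e * x))
    (by linear_combination h)
  have hb : b ∈ maximalIdeal S :=
    key y x z (span _ _ _ hy hx hz fun I h1 h2 h3 => ⟨h2, h1, h3⟩) b
      (-(a * x + d * y + e * z)) (-(c * z + f * y)) (by linear_combination h)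
  have hc : c ∈ maximalIdeal S :=
    key z x y (span _ _ _ hz hx hy fun I h1 h2 h3 => ⟨h2, h3, h1⟩) c
      (-(a * x + d * y + e * z)) (-(b * y + f * z)) (by linear_combination h)
  have hab : a + b + d ∈ maximalIdeal S :=
    key x (y - x) z (span _ _ _ hx (sub_mem hy hx) hz fun I h1 h2 h3 =>
      ⟨h1, by simpa using add_mem h2 h1, h3⟩) _ (-(b * (y + x) + d * x)) (-(c * z + e * x + f * y))
      (by linear_combination h)
  have hac : a + c + e ∈ maximalIdeal S :=
    key x y (z - x) (span _ _ _ hx hy (sub_mem hz hx) fun I h1 h2 h3 =>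
      ⟨h1, h2, by simpa using add_mem h3 h1⟩) _ (-(b * y + d * x + f * z)) (-(c * (z + x) + e * x))
      (by linear_combination h)
  have hbc : b + c + f ∈ maximalIdeal S :=
    key y x (z - y) (span _ _ _ hy hx (sub_mem hz hy) fun I h1 h2 h3 =>
      ⟨h2, h1, by simpa using add_mem h3 h1⟩) _ (-(a * x + d * y + e * z)) (-(c * (z + y) + f * y))
      (by linear_combination h)
  refine ⟨ha, hb, hc, ?_, ?_, ?_⟩
  · convert sub_mem (sub_mem hab ha) hb using 1; ring
  · convert sub_mem (sub_mem hac ha) hc using 1; ring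
  · convert sub_mem (sub_mem hbc hb) hc using 1; ring

omit [IsNoetherianRing S] in
include hm in
lemma maximalIdeal_sq_le_span : maximalIdeal S ^ 2 ≤
    Ideal.span (Set.range ![x ^ 2, y ^ 2, z ^ 2, x * y, x * z, y * z]) := by
  have hI (i) := Ideal.subset_span
    (Set.mem_range_self (f := ![x ^ 2, y ^ 2, z ^ 2, x * y, x * z, y * z]) i)
  have h0 := hI 0
  have h1 := hI 1
  have h2 := hI 2
  have h3 := hI 3
  have h4 := hI 4
  have h5 := hI 5
  simp only [Matrix.cons_val] at h0 h1 h2 h3 h4 h5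
  rw [sq, Ideal.mul_le]
  intro r hr s hs
  have hspan : maximalIdeal S = Ideal.span {x, y, z} := by
    rw [hm, Ideal.ofList]; congr 1; ext; simp
  rw [hspan, Ideal.span, Submodule.mem_span_triple] at hr hs
  obtain ⟨a, b, c, rfl⟩ := hr
  obtain ⟨a', b', c', rfl⟩ := hs
  convert add_mem (add_mem (add_mem (add_mem (add_mem (Ideal.mul_mem_left _ (a * a') h0)
    (Ideal.mul_mem_left _ (b * b') h1)) (Ideal.mul_mem_left _ (c * c') h2))
    (Ideal.mul_mem_left _ (a * b' + b * a') h3)) (Ideal.mul_mem_left _ (a * c' + c * a') h4))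
    (Ideal.mul_mem_left _ (b * c' + c * b') h5) using 1
  simp only [smul_eq_mul]
  ring

include hm hd in
/-- In a three-dimensional regular local ring the square of the maximal ideal is not generated by
four elements. -/
lemma maximalIdeal_sq_ne_span (g : Fin 4 → S) : maximalIdeal S ^ 2 ≠ Ideal.span (Set.range g) := by
  intro hg
  have hx : x ∈ maximalIdeal S := by rw [hm]; exact Ideal.subset_span (by simp)
  have hy : y ∈ maximalIdeal S := by rw [hm]; exact Ideal.subset_span (by simp)
  have hz : z ∈ maximalIdeal S := by rw [hm]; exact Ideal.subset_span (by simp)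
  let q : Fin 6 → S := ![x ^ 2, y ^ 2, z ^ 2, x * y, x * z, y * z]
  have hq (i) : q i ∈ maximalIdeal S ^ 2 := by
    fin_cases i <;> simp only [q, sq, Fin.reduceFinMk, Matrix.cons_val, Fin.zero_eta, Fin.mk_one] <;>
      exact Ideal.mul_mem_mul (by assumption) (by assumption)
  have hA (k) : ∃ c : Fin 6 → S, ∑ i, c i * q i = g k :=
    Ideal.mem_span_range_iff_exists_fun.1 <| maximalIdeal_sq_le_span hm <| by
      rw [hg]; exact Ideal.subset_span ⟨k, rfl⟩
  have hB (i) : ∃ c : Fin 4 → S, ∑ k, c k * g k = q i :=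
    Ideal.mem_span_range_iff_exists_fun.1 (hg ▸ hq i)
  choose α hα using hA
  choose β hβ using hB
  -- Writing the six monomials through the four generators and back gives a matrix congruent to `1`
  -- modulo the maximal ideal, although it factors through rank four.
  let M : Matrix (Fin 6) (Fin 6) S := Matrix.of β * Matrix.of α
  have hM (i) : ∑ j, ((1 : Matrix (Fin 6) (Fin 6) S) i j - M i j) * q j = 0 := by
    have h1 : ∑ j, M i j * q j = q i := by
      rw [← hβ i]
      simp only [M, Matrix.mul_apply, Matrix.of_apply, ← hα, Finset.sum_mul, Finset.mul_sum]
      rw [Finset.sum_comm]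
      simp only [mul_assoc]
    simp only [sub_mul, Finset.sum_sub_distrib, h1]
    simp [Matrix.one_apply]
  have hmem (i j) : residue S ((1 : Matrix (Fin 6) (Fin 6) S) i j - M i j) = 0 := by
    have h := hM i
    rw [Fin.sum_univ_six] at h
    obtain ⟨h0, h1, h2, h3, h4, h5⟩ := coeff_mem_maximalIdeal_of_quadratic_eq_zero hm hd h
    rw [residue_eq_zero_iff]
    fin_cases j
    exacts [h0, h1, h2, h3, h4, h5]
  have hone : (Matrix.of β).map (residue S) * (Matrix.of α).map (residue S) = 1 := by
    rw [← Matrix.map_mul]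
    ext i j
    have h := hmem i j
    rw [map_sub, sub_eq_zero] at h
    rw [Matrix.map_apply, ← h]
    by_cases hij : i = j <;> simp [Matrix.one_apply, hij]
  have h6 := congrArg Matrix.rank hone
  rw [Matrix.rank_one] at h6
  have h4 := (Matrix.rank_mul_le_left ((Matrix.of β).map (residue S))
    ((Matrix.of α).map (residue S))).trans (Matrix.rank_le_width _)
  simp at h6
  omega

end

/-! ### Quotients of regular local rings by few equations -/

section

open IsLocalRing

variable {S : Type u} [CommRing S] [IsRegularLocalRing S]

/-- A nonzero element of the cotangent space is part of a system of generators. -/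
lemma exists_ofList_cons_eq_maximalIdeal {y : S} (hy : y ∈ maximalIdeal S)
    (hy' : y ∉ maximalIdeal S ^ 2) :
    ∃ xs : List S, maximalIdeal S = Ideal.ofList (y :: xs) ∧
      ((xs.length + 1 : ℕ) : WithBot ℕ∞) = ringKrullDim S := by
  let V := CotangentSpace S
  let v : V := (maximalIdeal S).toCotangent ⟨y, hy⟩
  have hv : v ≠ 0 := by rwa [Ne, Ideal.toCotangent_eq_zero]
  let n := Module.finrank (ResidueField S) (V ⧸ Submodule.span (ResidueField S) {v})
  have hn : n + 1 = Module.finrank (ResidueField S) V := by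
    rw [← Submodule.finrank_quotient_add_finrank (Submodule.span (ResidueField S) {v}),
      finrank_span_singleton hv]
  let b := Module.finBasis (ResidueField S) (V ⧸ Submodule.span (ResidueField S) {v})
  choose w hw using fun i => Submodule.mkQ_surjective _ (b i)
  choose x hx using fun i => (maximalIdeal S).toCotangent_surjective (w i)
  have htop : Submodule.span (ResidueField S)
      ((maximalIdeal S).toCotangent '' (insert ⟨y, hy⟩ (Set.range x))) = ⊤ := by
    rw [Set.image_insert_eq, ← Set.range_comp, Submodule.span_insert, eq_top_iff]
    intro u _
    have hu : (Submodule.span (ResidueField S) {v}).mkQ u ∈ (Submodule.span (ResidueField S)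
        (Set.range w)).map (Submodule.span (ResidueField S) {v}).mkQ := by
      rw [Submodule.map_span, ← Set.range_comp, show _ ∘ w = b from funext hw, b.span_eq]
      trivial
    obtain ⟨u', hu', h⟩ := hu
    rw [← sub_add_cancel u u']
    refine Submodule.add_mem_sup ((Submodule.Quotient.eq _).1 h.symm) ?_
    rwa [show _ ∘ x = w from funext hx]
  rw [CotangentSpace.span_image_eq_top_iff] at htop
  refine ⟨(List.finRange n).map fun i => (x i : S), ?_, ?_⟩
  · have := congrArg (Submodule.map (maximalIdeal S).subtype) htop
    rw [Submodule.map_subtype_top, Submodule.map_span] at this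
    refine this.symm.trans ?_
    rw [Ideal.ofList, Ideal.span, Set.image_insert_eq, ← Set.range_comp]
    congr 1
    ext u
    simp [eq_comm]
  · rw [List.length_map, List.length_finRange, hn]
    exact (IsRegularLocalRing.iff_finrank_cotangentSpace S).1 inferInstance

lemma isRegularLocalRing_quotient_span_singleton {y : S} (hy : y ∈ maximalIdeal S)
    (hy' : y ∉ maximalIdeal S ^ 2) :
    IsRegularLocalRing (S ⧸ Ideal.span {y}) ∧
      ringKrullDim S ≤ ringKrullDim (S ⧸ Ideal.span {y}) + 1 := by
  have := isLocalRing_quotient_of_le ((Ideal.span_singleton_le_iff_mem _).2 hy)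
  obtain ⟨xs, hm, hd⟩ := exists_ofList_cons_eq_maximalIdeal hy hy'
  have hdim := ringKrullDim_le_ringKrullDim_quotient_span_singleton_add_one hy
  refine ⟨.of_spanFinrank_maximalIdeal_le _ ?_, hdim⟩
  refine le_trans ?_ (withBot_le_of_add_one_le (hd.le.trans hdim))
  rw [maximalIdeal_quotient_span_cons hm]
  exact_mod_cast (spanFinrank_ofList_le _).trans_eq (List.length_map _)

lemma exists_isRegular_maximalIdeal_eq_ofList (S : Type u) [CommRing S] [IsRegularLocalRing S] :
    ∃ xs : List S, RingTheory.Sequence.IsRegular S xs ∧ maximalIdeal S = Ideal.ofList xs := by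
  obtain ⟨xs, hl, hm⟩ := exists_ofList_eq _ (le_refl (maximalIdeal S).spanFinrank)
  refine ⟨xs, (isDomain_and_isRegular_of_length_le_ringKrullDim xs hm ?_).2, hm⟩
  rw [hl, IsRegularLocalRing.spanFinrank_maximalIdeal]

end

section

open IsLocalRing

variable {B : Type*} [CommRing B] [IsLocalRing B] (t : Fin 3 → B)
    (ht : maximalIdeal B = Ideal.span (Set.range t))
    (h2 : ∀ a b : B, maximalIdeal B ≠ Ideal.span {a, b})
    (s : B) (hs : maximalIdeal B ^ 2 = Ideal.span {s})

-- When the kernel lies in the square of the maximal ideal, `S` and `B` have the same embedding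
-- dimension, so `S` has dimension three and there are at most three equations. With a lift of `s`
-- they generate the square of the maximal ideal: four generators at most, where six are needed.
include ht h2 hs in
lemma false_of_ker_le_sq {S : Type u} [CommRing S] [IsRegularLocalRing S] (φ : S →+* B)
    (hφ : Function.Surjective φ) (ys : List S) (hy : RingHom.ker φ = Ideal.ofList ys)
    (hd : (ys.length : WithBot ℕ∞) ≤ ringKrullDim S) (hsq : RingHom.ker φ ≤ maximalIdeal S ^ 2) :
    False := by
  have hloc := IsLocalHom.of_surjective φ hφ
  have hmap : (maximalIdeal S).map φ = maximalIdeal B :=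
    IsLocalRing.map_maximalIdeal_of_surjective φ hφ
  choose t' ht' using fun i => hφ (t i)
  have hle : maximalIdeal S ≤ Ideal.span (Set.range t') := by
    refine Submodule.le_of_le_smul_of_le_jacobson_bot (I := maximalIdeal S)
      (IsNoetherian.noetherian _) (maximalIdeal_le_jacobson _) fun u hu => ?_
    have hu' : φ u ∈ (Ideal.span (Set.range t')).map φ := by
      rw [Ideal.map_span, ← Set.range_comp, show φ ∘ t' = t from funext ht', ← ht, ← hmap]
      exact Ideal.mem_map_of_mem _ hu
    rw [Ideal.mem_map_iff_of_surjective φ hφ] at hu'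
    obtain ⟨u', hu', h⟩ := hu'
    rw [← add_sub_cancel u' u]
    refine Submodule.add_mem_sup hu' ?_
    rw [smul_eq_mul, ← sq]
    exact hsq (by rw [RingHom.mem_ker, map_sub, h, sub_self])
  have hm : maximalIdeal S = Ideal.span (Set.range t') := by
    refine le_antisymm hle (Ideal.span_le.2 ?_)
    rintro _ ⟨i, rfl⟩
    have hcomap : (maximalIdeal B).comap φ = maximalIdeal S :=
      ((local_hom_TFAE φ).out 0 4 : IsLocalHom φ ↔ _).1 hloc
    rw [SetLike.mem_coe, ← hcomap, Ideal.mem_comap, ht', ht]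
    exact Ideal.subset_span ⟨i, rfl⟩
  have h3 : (maximalIdeal S).spanFinrank ≤ 3 := by
    rw [hm]
    refine (Submodule.spanFinrank_span_le_ncard_of_finite (Set.finite_range t')).trans ?_
    rw [← Set.image_univ]
    exact (Set.ncard_image_le).trans (by simp)
  have h3' : (maximalIdeal S).spanFinrank = 3 := by
    by_contra hne
    obtain ⟨l, hl, hl'⟩ := exists_ofList_eq 2 (show (maximalIdeal S).spanFinrank ≤ 2 by omega)
    obtain ⟨a, b, rfl⟩ := List.length_eq_two.1 hl
    refine h2 (φ a) (φ b) ?_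
    rw [← hmap, hl', Ideal.map_ofList, Ideal.ofList]
    congr 1
    ext; simp
  obtain ⟨l, hl, hm3⟩ := exists_ofList_eq 3 h3
  obtain ⟨x, y, z, rfl⟩ := List.length_eq_three.1 hl
  have hdim : ringKrullDim S = 3 := by
    rw [← IsRegularLocalRing.spanFinrank_maximalIdeal, h3']; rfl
  have hlen : ys.length ≤ 3 := by
    rw [hdim] at hd
    exact_mod_cast hd
  have hs' : s ∈ (maximalIdeal S ^ 2).map φ := by
    rw [Ideal.map_pow, hmap, hs]
    exact Ideal.mem_span_singleton_self s
  rw [Ideal.mem_map_iff_of_surjective φ hφ] at hs'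
  obtain ⟨s', hs', rfl⟩ := hs'
  have hsq' : maximalIdeal S ^ 2 = Ideal.ofList (s' :: ys) := by
    rw [Ideal.ofList_cons, ← hy]
    refine le_antisymm (fun u hu => ?_) (sup_le ?_ hsq)
    · have h : φ u ∈ Ideal.span {φ s'} := by
        rw [← hs, ← hmap, ← Ideal.map_pow]
        exact Ideal.mem_map_of_mem _ hu
      obtain ⟨b, hb⟩ := Ideal.mem_span_singleton'.1 h
      obtain ⟨c, rfl⟩ := hφ b
      rw [← add_sub_cancel (c * s') u]
      refine Submodule.add_mem_sup (Ideal.mem_span_singleton'.2 ⟨c, rfl⟩) ?_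
      rw [RingHom.mem_ker, map_sub, map_mul, hb, sub_self]
    · rwa [Ideal.span_singleton_le_iff_mem]
  have h4 : (maximalIdeal S ^ 2).spanFinrank ≤ 4 := by
    rw [hsq']
    exact (spanFinrank_ofList_le _).trans (by rw [List.length_cons]; omega)
  obtain ⟨l, hl, hl'⟩ := exists_ofList_eq 4 h4
  refine maximalIdeal_sq_ne_span hm3 hdim.ge (fun i : Fin 4 => l[i]) ?_
  rw [hl', Ideal.ofList]
  congr 1
  ext u
  simp only [Set.mem_ofPred_eq, Set.mem_range, List.mem_iff_getElem, Fin.getElem_fin]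
  exact ⟨fun ⟨i, hi, h⟩ => ⟨⟨i, by omega⟩, h⟩, fun ⟨i, h⟩ => ⟨i, by omega, h⟩⟩

include ht h2 hs in
/-- A local ring `B` of embedding dimension three with principal square of the maximal ideal is
not the quotient of a regular local ring by at most as many equations as the dimension. -/
theorem false_of_ker_eq_ofList {S : Type u} [CommRing S] [IsRegularLocalRing S] (φ : S →+* B)
    (hφ : Function.Surjective φ) (ys : List S) (hy : RingHom.ker φ = Ideal.ofList ys)
    (hd : (ys.length : WithBot ℕ∞) ≤ ringKrullDim S) : False := by
  classical
  induction hn : ys.length generalizing S with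
  | zero =>
    refine false_of_ker_le_sq t ht h2 s hs φ hφ ys hy hd ?_
    rw [hy, List.length_eq_zero_iff.1 hn, Ideal.ofList_nil]
    exact bot_le
  | succ n ih =>
    -- An equation of order one can be divided out: the quotient is again regular, and the number of
    -- equations and the dimension both drop by one. Otherwise the kernel lies in the square of the
    -- maximal ideal.
    by_cases h : ∃ y ∈ ys, y ∉ maximalIdeal S ^ 2
    · obtain ⟨y, hys, hy2⟩ := h
      have hker : y ∈ RingHom.ker φ := by rw [hy]; exact Ideal.subset_span hys
      have hym : y ∈ maximalIdeal S := le_maximalIdeal (RingHom.ker_ne_top φ) hker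
      obtain ⟨hreg, hdim⟩ := isRegularLocalRing_quotient_span_singleton hym hy2
      have hlen : (ys.erase y).length = n := by rw [List.length_erase_of_mem hys, hn]; rfl
      have hlift : ∀ a ∈ Ideal.span {y}, φ a = 0 := fun a ha =>
        (Ideal.span_singleton_le_iff_mem (RingHom.ker φ)).2 hker ha
      refine ih (Ideal.Quotient.lift (Ideal.span {y}) φ hlift)
        (Ideal.Quotient.lift_surjective_of_surjective _ hlift hφ)
        ((ys.erase y).map (Ideal.Quotient.mk (Ideal.span {y}))) ?_ ?_ (by simpa using hlen)
      · refine (Ideal.ker_quotient_lift φ hlift).trans ?_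
        rw [hy, ← Ideal.map_ofList]
        have : Ideal.ofList ys = Ideal.ofList (y :: ys.erase y) := by
          rw [Ideal.ofList, Ideal.ofList]
          congr 1
          ext u
          exact (List.perm_cons_erase hys).mem_iff
        rw [this, Ideal.ofList_cons, Ideal.map_sup, Ideal.map_quotient_self, bot_sup_eq]
      · rw [hn] at hd
        rw [List.length_map, hlen]
        exact withBot_le_of_add_one_le (hd.trans hdim)
    · push Not at h
      refine false_of_ker_le_sq t ht h2 s hs φ hφ ys hy hd ?_
      rw [hy]
      exact Ideal.span_le.2 h

end

/-! ### Self-injectivity and the Artinian fibre at the vertex -/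

section Injective

/-- A finite-dimensional commutative algebra with a nondegenerate linear form is self-injective. -/
theorem injective_self_of_nondegenerate (F : Type*) [Field F] {Q : Type u} [CommRing Q] [Algebra F Q]
    [Module.Finite F Q] (l : Q →ₗ[F] F) (hl : ∀ x, (∀ y, l (y * x) = 0) → x = 0) :
    Module.Injective Q Q := by
  refine Module.Baer.injective fun I g => ?_
  let D : Q →ₗ[F] Module.Dual F Q := (LinearMap.mul F Q).compr₂ l
  have hD : Function.Injective D := (injective_iff_map_eq_zero D).2 fun x hx =>
    hl x fun y => by rw [mul_comm]; exact DFunLike.congr_fun hx y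
  have hD' : Function.Surjective D :=
    (LinearMap.injective_iff_surjective_of_finrank_eq_finrank
      (Subspace.dual_finrank_eq).symm).1 hD
  -- To extend `g` from the ideal, extend the linear form `l ∘ g` over the field and represent it as
  -- `l (q * ·)` by the perfect pairing; then `g` is multiplication by `q`.
  obtain ⟨μ, hμ⟩ := LinearMap.exists_extend
    (p := I.restrictScalars F) (l.comp (g.restrictScalars F))
  obtain ⟨q, rfl⟩ := hD' μ
  refine ⟨LinearMap.mulLeft Q q, fun x hx => ?_⟩
  rw [← sub_eq_zero]
  refine hl _ fun z => ?_
  have h := DFunLike.congr_fun hμ ⟨z * x, I.mul_mem_left z hx⟩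
  have h1 : l (q * (z * x)) = l (g ⟨z * x, I.mul_mem_left z hx⟩) := h
  have h2 : g ⟨z * x, I.mul_mem_left z hx⟩ = z * g ⟨x, hx⟩ := map_smul g z ⟨x, hx⟩
  rw [LinearMap.mulLeft_apply, mul_sub, map_sub, ← h2, ← h1, sub_eq_zero]
  congr 1
  ring

end Injective

namespace FiveAlg

variable {F : Type*} [Field F]

/-- With all parameters zero, every product of two of `a`, `b`, `c` is a multiple of `bc`, and `bc`
is killed by all three: the Hilbert function is 1, 3, 1. -/
lemma mul_eq (x y : FiveAlg F 0) : x * y = ⟨x.c0 * y.c0, x.c0 * y.c1 + x.c1 * y.c0,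
    x.c0 * y.c2 + x.c2 * y.c0, x.c0 * y.c3 + x.c3 * y.c0, x.c0 * y.c4 + x.c4 * y.c0 - x.c1 * y.c2 -
    x.c2 * y.c1 - x.c2 * y.c2 + x.c2 * y.c3 + x.c3 * y.c2 - x.c3 * y.c3⟩ := by
  ext <;> simp [mul_def, rep_apply, mulA, mulB, mulC]
  ring

/-- The augmentation of the fibre at the origin. -/
def augmentation : FiveAlg F 0 →+* F where
  toFun := c0
  map_one' := rfl
  map_zero' := rfl
  map_add' _ _ := rfl
  map_mul' x y := by rw [mul_eq]

lemma isUnit_iff_c0_ne_zero (x : FiveAlg F 0) : IsUnit x ↔ x.c0 ≠ 0 := by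
  refine ⟨fun h => (h.map augmentation).ne_zero, fun h => ?_⟩
  have hn : IsNilpotent (x - algebraMap F _ x.c0) := by
    refine ⟨3, ?_⟩
    rw [algebraMap_eq]
    ext <;> simp [pow_succ, mul_eq]
  have hu : IsUnit (algebraMap F (FiveAlg F 0) x.c0) := (isUnit_iff_ne_zero.2 h).map _
  simpa using hn.isUnit_add_left_of_commute hu (Commute.all _ _)

instance : Nontrivial (FiveAlg F 0) := augmentation.domain_nontrivial

instance : IsLocalRing (FiveAlg F 0) := .of_nonunits_add fun a b ha hb => by
  simp_all [isUnit_iff_c0_ne_zero]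

open IsLocalRing

lemma mem_maximalIdeal_iff (x : FiveAlg F 0) : x ∈ maximalIdeal (FiveAlg F 0) ↔ x.c0 = 0 := by
  rw [mem_maximalIdeal, mem_nonunits_iff, isUnit_iff_c0_ne_zero, not_not]

lemma maximalIdeal_eq_span : maximalIdeal (FiveAlg F 0) = Ideal.span (Set.range
    ![⟨0, 1, 0, 0, 0⟩, ⟨0, 0, 1, 0, 0⟩, ⟨0, 0, 0, 1, 0⟩]) := by
  refine le_antisymm (fun x hx => ?_) (Ideal.span_le.2 ?_)
  · rw [mem_maximalIdeal_iff] at hx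
    refine Ideal.mem_span_range_iff_exists_fun.2
      ⟨![algebraMap F _ x.c1, algebraMap F _ x.c2, ⟨x.c3, 0, x.c4, 0, 0⟩], ?_⟩
    simp only [Fin.sum_univ_three, Matrix.cons_val, algebraMap_eq, mul_eq]
    ext <;> simp [hx]
  · rintro _ ⟨i, rfl⟩
    rw [SetLike.mem_coe, mem_maximalIdeal_iff]
    fin_cases i <;> rfl

lemma maximalIdeal_sq_eq_span :
    maximalIdeal (FiveAlg F 0) ^ 2 = Ideal.span {⟨0, 0, 0, 0, 1⟩} := by
  refine le_antisymm ?_ ((Ideal.span_singleton_le_iff_mem _).2 ?_)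
  · rw [sq, Ideal.mul_le]
    intro x hx y hy
    rw [mem_maximalIdeal_iff] at hx hy
    refine Ideal.mem_span_singleton'.2 ⟨algebraMap F _ (x * y).c4, ?_⟩
    ext <;> simp [algebraMap_eq, mul_eq, hx, hy]
  · have h : (⟨0, 0, 0, 0, 1⟩ : FiveAlg F 0) = ⟨0, 0, 1, 0, 0⟩ * ⟨0, 0, 0, 1, 0⟩ := by
      ext <;> simp [mul_eq]
    rw [h, sq]
    exact Ideal.mul_mem_mul ((mem_maximalIdeal_iff _).2 rfl) ((mem_maximalIdeal_iff _).2 rfl)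

/-- Modulo the square of the maximal ideal only `c1`, `c2`, `c3` survive, and two generators would
factor the 3 × 3 identity through rank two. -/
lemma maximalIdeal_ne_span_pair (u v : FiveAlg F 0) :
    maximalIdeal (FiveAlg F 0) ≠ Ideal.span {u, v} := by
  intro h
  have hu : u.c0 = 0 := by
    rw [← mem_maximalIdeal_iff, h]; exact Ideal.subset_span (by simp)
  have hv : v.c0 = 0 := by
    rw [← mem_maximalIdeal_iff, h]; exact Ideal.subset_span (by simp)
  have key (x : FiveAlg F 0) (hx : x.c0 = 0) : ∃ a b : F, a * u.c1 + b * v.c1 = x.c1 ∧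
      a * u.c2 + b * v.c2 = x.c2 ∧ a * u.c3 + b * v.c3 = x.c3 := by
    rw [← mem_maximalIdeal_iff, h, Ideal.mem_span_pair] at hx
    obtain ⟨a, b, rfl⟩ := hx
    exact ⟨a.c0, b.c0, by simp [mul_eq, hu, hv], by simp [mul_eq, hu, hv],
      by simp [mul_eq, hu, hv]⟩
  obtain ⟨a1, b1, h11, h12, h13⟩ := key ⟨0, 1, 0, 0, 0⟩ rfl
  obtain ⟨a2, b2, h21, h22, h23⟩ := key ⟨0, 0, 1, 0, 0⟩ rfl
  obtain ⟨a3, b3, h31, h32, h33⟩ := key ⟨0, 0, 0, 1, 0⟩ rfl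
  have hM : !![a1, b1; a2, b2; a3, b3] * !![u.c1, u.c2, u.c3; v.c1, v.c2, v.c3] = 1 := by
    ext i j
    fin_cases i <;> fin_cases j <;> simp [Matrix.mul_apply, Fin.sum_univ_two, *]
  have h3 := congrArg Matrix.rank hM
  rw [Matrix.rank_one, Fintype.card_fin] at h3
  have h2 := (Matrix.rank_mul_le_left !![a1, b1; a2, b2; a3, b3]
    !![u.c1, u.c2, u.c3; v.c1, v.c2, v.c3]).trans (Matrix.rank_le_width _)
  omega

/-- The coordinate `c4` as a linear form. -/
def socleForm : FiveAlg F 0 →ₗ[F] F where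
  toFun := c4
  map_add' _ _ := rfl
  map_smul' _ _ := rfl

/-- The pairing on the span of `a`, `b`, `c` has determinant 1, so it is perfect in every
characteristic, and `1` pairs with the socle generator `bc`. -/
lemma eq_zero_of_socleForm_mul (x : FiveAlg F 0) (h : ∀ y, socleForm (y * x) = 0) : x = 0 := by
  have h0 := h ⟨0, 0, 0, 0, 1⟩
  have h1 := h ⟨0, 1, 0, 0, 0⟩
  have h2 := h ⟨0, 0, 1, 0, 0⟩
  have h3 := h ⟨0, 0, 0, 1, 0⟩
  have h4 := h ⟨1, 0, 0, 0, 0⟩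
  simp only [socleForm, LinearMap.coe_mk, AddHom.coe_mk, mul_eq] at h0 h1 h2 h3 h4
  ext <;> simp only [zero_c0, zero_c1, zero_c2, zero_c3, zero_c4]
  · linear_combination h0
  · linear_combination -h2 - h3
  · linear_combination -h1
  · linear_combination -h1 - h3
  · linear_combination h4

end FiveAlg

/-! ### A regular sequence of parameters at the vertex -/

section Regular

variable {A : Type*} [CommRing A]

/-- The variables followed by an element of the base. -/
noncomputable def varList (a : A) : List (MvPolynomial (Fin 7) A) :=
  List.ofFn MvPolynomial.X ++ [.C a]

-- An ideal generated by variables is detected monomial by monomial. Multiplying by a new variable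
-- shifts exponents without touching the old variables, and a nonzero constant preserves the
-- support.
open MvPolynomial in
lemma isWeaklyRegular_varList [IsDomain A] {a : A} (ha : a ≠ 0) :
    RingTheory.Sequence.IsWeaklyRegular (MvPolynomial (Fin 7) A) (varList a) := by
  have htake (i : ℕ) (hi : i ≤ 7) : Ideal.ofList ((varList a).take i) =
      Ideal.span (X '' {j : Fin 7 | (j : ℕ) < i} : Set (MvPolynomial (Fin 7) A)) := by
    rw [Ideal.ofList]
    congr 1
    ext f
    rw [varList, List.take_append_of_le_length (by simpa using hi)]
    simp only [Set.mem_ofPred_eq, List.mem_take_iff_getElem, List.length_ofFn, List.getElem_ofFn,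
      Set.mem_image]
    exact ⟨fun ⟨k, hk, h⟩ => ⟨⟨k, by omega⟩, lt_of_lt_of_le hk (min_le_left _ _), h⟩,
      fun ⟨j, hj, h⟩ => ⟨j, lt_min hj j.2, h⟩⟩
  refine ⟨fun i hi => ?_⟩
  rw [isSMulRegular_quotient_iff_mem_of_smul_mem]
  have hi' : i < 8 := by simpa [varList] using hi
  rw [htake i (by omega)]
  simp only [smul_eq_mul, Ideal.mul_top]
  intro f hf
  replace hf : (varList a)[i] * f ∈
    Ideal.span (X '' {j : Fin 7 | (j : ℕ) < i} : Set (MvPolynomial (Fin 7) A)) := hf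
  rw [mem_ideal_span_X_image] at hf ⊢
  intro m hm
  rcases Nat.lt_or_ge i 7 with h7 | h7
  · have hget : (varList a)[i] = X ⟨i, h7⟩ := by
      simp only [varList]
      rw [List.getElem_append_left (by simpa using h7), List.getElem_ofFn]
    rw [hget] at hf
    obtain ⟨j, hj, hne⟩ := hf (Finsupp.single ⟨i, h7⟩ 1 + m) (by
      rw [mem_support_iff, coeff_X_mul]; exact mem_support_iff.1 hm)
    refine ⟨j, hj, ?_⟩
    have hji : (⟨i, h7⟩ : Fin 7) ≠ j := fun h => by
      subst h; exact lt_irrefl i (show i < i from hj)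
    simpa [Finsupp.single_apply, hji] using hne
  · obtain rfl : i = 7 := by omega
    have hget : (varList a)[7] = C a := by
      simp only [varList]
      rw [List.getElem_append_right (by simp)]
      simp
    rw [hget] at hf
    refine hf m ?_
    rw [mem_support_iff, coeff_C_mul]
    exact mul_ne_zero ha (mem_support_iff.1 hm)

end Regular

namespace PluckerRing

open IsLocalRing

variable (O : Type u) [CommRing O] [IsLocalRing O]

/-- The evaluation of polynomials at the closed point of the zero section. -/
noncomputable def evalVertex : MvPolynomial (Fin 7) O →+* ResidueField O :=
  MvPolynomial.eval₂Hom (residue O) 0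

/-- The evaluation at the origin of the rank five algebra. -/
noncomputable def fibreMap :
    FiveAlg (MvPolynomial (Fin 7) O) MvPolynomial.X →+* FiveAlg (ResidueField O) 0 :=
  FiveAlg.map (evalVertex O) (by simp [evalVertex])

lemma fibreMap_apply (x : FiveAlg (MvPolynomial (Fin 7) O) MvPolynomial.X) : fibreMap O x =
    ⟨evalVertex O x.c0, evalVertex O x.c1, evalVertex O x.c2, evalVertex O x.c3,
      evalVertex O x.c4⟩ := rfl

/-- The fibre of the Noether normalization of the Plücker ring at the origin. -/
noncomputable def toFibre : PluckerRing O →+* FiveAlg (ResidueField O) 0 :=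
  (fibreMap O).comp (fiveEquiv O : PluckerRing O →+* FiveAlg _ _)

lemma toFibre_apply (x : PluckerRing O) : toFibre O x = fibreMap O (fiveEquiv O x) := rfl

lemma evalVertex_surjective : Function.Surjective (evalVertex O) := fun x => by
  obtain ⟨x, rfl⟩ := residue_surjective x
  exact ⟨.C x, by simp [evalVertex]⟩

lemma toFibre_surjective : Function.Surjective (toFibre O) := by
  intro x
  choose f hf using evalVertex_surjective O
  refine ⟨(fiveEquiv O).symm ⟨f x.c0, f x.c1, f x.c2, f x.c3, f x.c4⟩, ?_⟩
  rw [toFibre_apply, RingEquiv.apply_symm_apply, fibreMap_apply]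
  ext <;> exact hf _

lemma toFibre_param (r : MvPolynomial (Fin 7) O) :
    toFibre O (param O r) = algebraMap _ _ (evalVertex O r) := by
  rw [toFibre_apply, fiveEquiv_param, FiveAlg.algebraMap_eq, FiveAlg.algebraMap_eq, fibreMap_apply]
  simp only [map_zero]

variable {O}

lemma ker_evalVertex {ϖ : O} (hϖ : maximalIdeal O = Ideal.span {ϖ}) :
    RingHom.ker (evalVertex O) = Ideal.ofList (varList ϖ) := by
  have hmem (i : Fin 7) : (.X i : MvPolynomial (Fin 7) O) ∈ Ideal.ofList (varList ϖ) :=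
    Ideal.subset_span (List.mem_append_left _ (List.mem_ofFn.2 ⟨i, rfl⟩))
  have hC : (.C ϖ : MvPolynomial (Fin 7) O) ∈ Ideal.ofList (varList ϖ) :=
    Ideal.subset_span (by simp [varList])
  refine le_antisymm (fun f hf => ?_) (Ideal.span_le.2 fun f hf => ?_)
  · have key (g : MvPolynomial (Fin 7) O) :
        g - .C (MvPolynomial.constantCoeff g) ∈ Ideal.ofList (varList ϖ) := by
      induction g using MvPolynomial.induction_on with
      | C a => simp
      | add f g hf hg =>
        rw [map_add, map_add, add_sub_add_comm]
        exact add_mem hf hg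
      | mul_X f i _ => simpa using Ideal.mul_mem_left _ f (hmem i)
    have hc : evalVertex O f = residue O (MvPolynomial.constantCoeff f) := by
      have : evalVertex O = (residue O).comp MvPolynomial.constantCoeff :=
        MvPolynomial.ringHom_ext (by simp [evalVertex]) (by simp [evalVertex])
      rw [this]; rfl
    rw [RingHom.mem_ker, hc, residue_eq_zero_iff, hϖ, Ideal.mem_span_singleton'] at hf
    obtain ⟨b, hb⟩ := hf
    rw [← sub_add_cancel f (.C (MvPolynomial.constantCoeff f))]
    refine add_mem (key f) ?_
    rw [← hb, map_mul]
    exact Ideal.mul_mem_left _ _ hC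
  · have hϖ' : residue O ϖ = 0 := by
      rw [residue_eq_zero_iff, hϖ]; exact Ideal.mem_span_singleton_self ϖ
    simp only [varList, List.mem_append, List.mem_ofFn, List.mem_singleton, Set.mem_ofPred_eq] at hf
    obtain ⟨i, rfl⟩ | rfl := hf <;> simp [evalVertex, hϖ']

lemma ker_toFibre {ϖ : O} (hϖ : maximalIdeal O = Ideal.span {ϖ}) :
    RingHom.ker (toFibre O) = Ideal.ofList ((varList ϖ).map (param O)) := by
  have hmap := Ideal.map_ofList (param O).toRingHom (varList ϖ)
  refine Eq.trans ?_ hmap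
  rw [← ker_evalVertex hϖ]
  refine le_antisymm (fun x hx => ?_) (Ideal.map_le_iff_le_comap.2 fun r hr => ?_)
  · rw [RingHom.mem_ker, toFibre_apply] at hx
    obtain ⟨y, rfl⟩ := (fiveEquiv O).symm.surjective x
    rw [RingEquiv.apply_symm_apply] at hx
    have hy : y = algebraMap _ _ y.c0 + algebraMap _ _ y.c1 * ⟨0, 1, 0, 0, 0⟩ +
        algebraMap _ _ y.c2 * ⟨0, 0, 1, 0, 0⟩ + algebraMap _ _ y.c3 * ⟨0, 0, 0, 1, 0⟩ +
        algebraMap _ _ y.c4 * ⟨0, 0, 0, 0, 1⟩ := by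
      simp only [← Algebra.smul_def]
      rw [FiveAlg.algebraMap_eq]
      ext <;> simp
    have hmem (r : MvPolynomial (Fin 7) O) (hr : evalVertex O r = 0) :
        (fiveEquiv O).symm (algebraMap _ _ r) ∈
          (RingHom.ker (evalVertex O)).map (param O).toRingHom := by
      rw [← fiveEquiv_param, RingEquiv.symm_apply_apply]
      exact Ideal.mem_map_of_mem (param O).toRingHom hr
    rw [hy]
    simp only [map_add, map_mul]
    exact add_mem (add_mem (add_mem (add_mem (hmem _ (congrArg FiveAlg.c0 hx))
      (Ideal.mul_mem_right _ _ (hmem _ (congrArg FiveAlg.c1 hx))))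
      (Ideal.mul_mem_right _ _ (hmem _ (congrArg FiveAlg.c2 hx))))
      (Ideal.mul_mem_right _ _ (hmem _ (congrArg FiveAlg.c3 hx))))
      (Ideal.mul_mem_right _ _ (hmem _ (congrArg FiveAlg.c4 hx)))
  · change toFibre O (param O r) = 0
    rw [toFibre_param, (show evalVertex O r = 0 from hr), map_zero]

-- Freeness over the parameter ring carries regular sequences along.
omit [IsLocalRing O] in
lemma isWeaklyRegular_param [IsDomain O] {a : O} (ha : a ≠ 0) :
    RingTheory.Sequence.IsWeaklyRegular (PluckerRing O) ((varList a).map (param O)) := by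
  let := (param O).toRingHom.toAlgebra
  have : Module.Flat (MvPolynomial (Fin 7) O) (PluckerRing O) := by
    let e : PluckerRing O ≃ₗ[MvPolynomial (Fin 7) O] FiveAlg (MvPolynomial (Fin 7) O) .X :=
      { (fiveEquiv O).toAddEquiv with
        map_smul' := fun r x => by
          change fiveEquiv O (param O r * x) = r • fiveEquiv O x
          rw [map_mul, fiveEquiv_param, Algebra.smul_def] }
    exact .of_linearEquiv e
  exact (isWeaklyRegular_varList ha).of_flat

variable (O)

/-- The maximal ideal of the closed point of the vertex section. -/
noncomputable def vertexMax : Ideal (PluckerRing O) :=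
  (maximalIdeal (FiveAlg (ResidueField O) 0)).comap (toFibre O)

instance : (vertexMax O).IsMaximal :=
  Ideal.comap_isMaximal_of_surjective (toFibre O) (toFibre_surjective O)

lemma ker_toFibre_le_vertexMax : RingHom.ker (toFibre O) ≤ vertexMax O :=
  Ideal.comap_mono bot_le

variable {O}

lemma eq_vertexMax_of_ker_le {m : Ideal (PluckerRing O)} [hm : m.IsMaximal]
    (h : RingHom.ker (toFibre O) ≤ m) : m = vertexMax O := by
  refine hm.eq_of_le (Ideal.IsMaximal.ne_top inferInstance) ?_
  rw [vertexMax, ← Ideal.map_le_iff_le_comap]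
  refine le_maximalIdeal fun ht => hm.ne_top ?_
  have := congrArg (Ideal.comap (toFibre O)) ht
  rwa [Ideal.comap_map_of_surjective' _ (toFibre_surjective O), sup_eq_left.2 h,
    Ideal.comap_top] at this

omit [IsLocalRing O] in
lemma exists_sub_algebraMap_mem (x : PluckerRing O) :
    ∃ a : O, x - algebraMap O _ a ∈ vertexIdeal O := by
  obtain ⟨f, rfl⟩ := mk_surjective O x
  induction f using MvPolynomial.induction_on with
  | C a => exact ⟨a, by
      have : mk O (.C a) = algebraMap O _ a := (mk O).commutes a
      simp [this]⟩
  | add f g hf hg =>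
    obtain ⟨a, ha⟩ := hf
    obtain ⟨b, hb⟩ := hg
    exact ⟨a + b, by rw [map_add, map_add, add_sub_add_comm]; exact add_mem ha hb⟩
  | mul_X f ij _ =>
    exact ⟨0, by
      rw [map_zero, sub_zero, map_mul]
      exact Ideal.mul_mem_left _ _ (p_mem_vertexIdeal O ij.1 ij.2)⟩

/-- The base surjects onto the quotient by the vertex ideal, so a maximal ideal over the vertex
contracts to the maximal ideal of `O` and hence contains the uniformizer and all parameters. -/
lemma eq_vertexMax {ϖ : O} (hϖ : maximalIdeal O = Ideal.span {ϖ}) {m : Ideal (PluckerRing O)}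
    [hm : m.IsMaximal] (h : vertexIdeal O ≤ m) : m = vertexMax O := by
  have hsurj : Function.Surjective ((Ideal.Quotient.mk m).comp (algebraMap O (PluckerRing O))) := by
    intro y
    obtain ⟨x, rfl⟩ := Ideal.Quotient.mk_surjective y
    obtain ⟨a, ha⟩ := exists_sub_algebraMap_mem x
    exact ⟨a, ((Ideal.Quotient.mk_eq_mk_iff_sub_mem _ _).2 (h ha)).symm⟩
  have hmax : (m.comap (algebraMap O (PluckerRing O))).IsMaximal := by
    let := Ideal.Quotient.field m
    have hk : RingHom.ker ((Ideal.Quotient.mk m).comp (algebraMap O (PluckerRing O))) =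
        m.comap (algebraMap O (PluckerRing O)) := by
      ext
      rw [RingHom.mem_ker, RingHom.comp_apply, Ideal.Quotient.eq_zero_iff_mem, Ideal.mem_comap]
    exact hk ▸ RingHom.ker_isMaximal_of_surjective _ hsurj
  have hϖm : algebraMap O (PluckerRing O) ϖ ∈ m := by
    have : ϖ ∈ m.comap (algebraMap O (PluckerRing O)) := by
      rw [eq_maximalIdeal hmax, hϖ]
      exact Ideal.mem_span_singleton_self ϖ
    exact this
  refine eq_vertexMax_of_ker_le ?_
  rw [ker_toFibre hϖ]
  refine Ideal.span_le.2 fun x hx => ?_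
  have hp (i j) : p O i j ∈ m := h (p_mem_vertexIdeal O i j)
  simp only [Set.mem_ofPred_eq, List.mem_map, varList, List.mem_append, List.mem_ofFn,
    List.mem_singleton] at hx
  obtain ⟨_, ⟨i, rfl⟩ | rfl, rfl⟩ := hx
  · rw [param, MvPolynomial.aeval_X]
    fin_cases i
    exacts [hp _ _, hp _ _, hp _ _, hp _ _, hp _ _, add_mem (add_mem (hp _ _) (hp _ _)) (hp _ _),
      add_mem (add_mem (hp _ _) (hp _ _)) (hp _ _)]
  · rw [SetLike.mem_coe, MvPolynomial.algHom_C]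
    exact hϖm

end PluckerRing

/-! ### Completions, Gorenstein rings and the local ring at the vertex -/

section Completion

open IsLocalRing

variable {A : Type u} [CommRing A] [IsLocalRing A] {B : Type*} [CommRing B]

/-- The extension to the completion of a homomorphism which kills a power of the maximal ideal. -/
noncomputable def completionLift (ψ : A →+* B) (k : ℕ) (hk : maximalIdeal A ^ k ≤ RingHom.ker ψ) :
    AdicCompletion (maximalIdeal A) A →+* B :=
  (Ideal.Quotient.lift (maximalIdeal A ^ k) ψ hk).comp
    (AdicCompletion.evalₐ (maximalIdeal A) k : _ →+* A ⧸ maximalIdeal A ^ k)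

lemma completionLift_algebraMap (ψ : A →+* B) (k : ℕ) (hk : maximalIdeal A ^ k ≤ RingHom.ker ψ)
    (a : A) : completionLift ψ k hk (algebraMap A _ a) = ψ a := by
  change Ideal.Quotient.lift (maximalIdeal A ^ k) ψ hk
    (AdicCompletion.evalₐ (maximalIdeal A) k (algebraMap A _ a)) = ψ a
  rw [AlgHom.commutes]
  rfl

/-- An element of the completion agrees with some `a : A` up to the kernel of evaluation at level
`k`. That kernel is the extension of the `k`-th power of the maximal ideal, by finite generation. -/
lemma ker_completionLift [IsNoetherianRing A] (ψ : A →+* B) (k : ℕ)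
    (hk : maximalIdeal A ^ k ≤ RingHom.ker ψ) : RingHom.ker (completionLift ψ k hk) =
      (RingHom.ker ψ).map (algebraMap A (AdicCompletion (maximalIdeal A) A)) := by
  refine le_antisymm (fun x hx => ?_) (Ideal.map_le_iff_le_comap.2 fun a ha => ?_)
  · obtain ⟨a, ha⟩ := Ideal.Quotient.mk_surjective (AdicCompletion.evalₐ (maximalIdeal A) k x)
    have hx' : Ideal.Quotient.lift (maximalIdeal A ^ k) ψ hk
      (AdicCompletion.evalₐ (maximalIdeal A) k x) = 0 := hx
    rw [← ha] at hx'
    change ψ a = 0 at hx'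
    rw [← add_sub_cancel (algebraMap A _ a) x]
    refine add_mem (Ideal.mem_map_of_mem _ hx') (Ideal.map_mono hk ?_)
    have h0 : AdicCompletion.evalₐ (maximalIdeal A) k (x - algebraMap A _ a) = 0 := by
      rw [map_sub, ← ha, AlgHom.commutes]
      exact sub_self _
    have h1 : AdicCompletion.eval (maximalIdeal A) A k (x - algebraMap A _ a) = 0 := by
      rw [← AdicCompletion.factor_evalₐ_eq_eval _ _ (by simp), h0, map_zero]
    rw [← LinearMap.mem_ker, ← AdicCompletion.pow_smul_top_eq_ker_eval
      (maximalIdeal A).fg_of_isNoetherianRing, Ideal.smul_top_eq_map] at h1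
    exact h1
  · rw [Ideal.mem_comap, RingHom.mem_ker, completionLift_algebraMap]
    exact ha

/-- If the quotient of a complete intersection local ring by a regular sequence is killed by a power
of the maximal ideal, then it is the quotient of a regular local ring by at most as many equations as
the dimension. -/
theorem exists_regular_presentation [Nontrivial B] (ψ : A →+* B) (hψ : Function.Surjective ψ)
    (θ : List A) (hker : RingHom.ker ψ = Ideal.ofList θ)
    (hreg : RingTheory.Sequence.IsWeaklyRegular A θ) (k : ℕ)
    (hk : maximalIdeal A ^ k ≤ RingHom.ker ψ) (h : IsCompleteIntersectionLocal A) :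
    ∃ (S : Type u) (_ : CommRing S) (_ : IsRegularLocalRing S) (φ : S →+* B) (ys : List S),
      Function.Surjective φ ∧ RingHom.ker φ = Ideal.ofList ys ∧
      (ys.length : WithBot ℕ∞) ≤ ringKrullDim S := by
  obtain ⟨hN, S, hS, xs, hSreg, hxs, ⟨e⟩⟩ := h
  let C := AdicCompletion (maximalIdeal A) A
  let π : S →+* C := (e : S ⧸ Ideal.ofList xs →+* C).comp (Ideal.Quotient.mk (Ideal.ofList xs))
  have hπ : Function.Surjective π := e.surjective.comp Ideal.Quotient.mk_surjective
  have hπker : RingHom.ker π = Ideal.ofList xs := by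
    ext x
    rw [RingHom.mem_ker, ← Ideal.Quotient.eq_zero_iff_mem]
    exact map_eq_zero_iff e e.injective
  have hCN : IsNoetherianRing C := isNoetherianRing_of_surjective S C π hπ
  have hψ' : Function.Surjective (completionLift ψ k hk) := fun b => by
    obtain ⟨a, rfl⟩ := hψ b
    exact ⟨_, completionLift_algebraMap ψ k hk a⟩
  have hkerC : RingHom.ker (completionLift ψ k hk) = Ideal.ofList (θ.map (algebraMap A C)) := by
    rw [ker_completionLift, hker, Ideal.map_ofList]
  have hregC : RingTheory.Sequence.IsRegular C (θ.map (algebraMap A C)) := by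
    refine ⟨hreg.of_flat, ?_⟩
    rw [← hkerC, smul_eq_mul, Ideal.mul_top]
    exact (RingHom.ker_ne_top _).symm
  -- By flatness `θ` stays regular on the completion, whose dimension is therefore at least the
  -- length of `θ`. Adding the length of `xs` gives the bound for `S`, since `dim S = dim C +
  -- xs.length`.
  have hdimC : (θ.length : WithBot ℕ∞) ≤ ringKrullDim C := by
    have h1 := ringKrullDim_add_length_eq_ringKrullDim_of_isRegular _ hregC
    have : Nontrivial (C ⧸ Ideal.ofList (θ.map (algebraMap A C))) := by
      rw [Ideal.Quotient.nontrivial_iff, ← hkerC]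
      exact RingHom.ker_ne_top _
    rw [List.length_map] at h1
    rw [← h1]
    simpa using add_le_add_left (ringKrullDim_nonneg_of_nontrivial
      (R := C ⧸ Ideal.ofList (θ.map (algebraMap A C)))) (θ.length : WithBot ℕ∞)
  have hπ' := hπ
  choose g hg using hπ'
  refine ⟨S, hS, hSreg, (completionLift ψ k hk).comp π,
    xs ++ (θ.map (algebraMap A C)).map g, hψ'.comp hπ, ?_, ?_⟩
  · rw [← RingHom.comap_ker, hkerC, Ideal.ofList_append, ← hπker, sup_comm]
    have hmap : Ideal.ofList (θ.map (algebraMap A C)) =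
        (Ideal.ofList ((θ.map (algebraMap A C)).map g)).map π := by
      rw [Ideal.map_ofList, List.map_map, show π ∘ g = id from funext hg, List.map_id]
    rw [hmap, Ideal.comap_map_of_surjective' π hπ]
  · rw [List.length_append, List.length_map, List.length_map, ←
      ringKrullDim_add_length_eq_ringKrullDim_of_isRegular _ hxs,
      ringKrullDim_eq_of_ringEquiv e, Nat.cast_add, add_comm]
    exact add_le_add_left hdimC _

end Completion

section Gorenstein

open IsLocalRing

lemma isGorensteinLocal_of_isRegularLocalRing (A : Type u) [CommRing A] [IsRegularLocalRing A] :
    IsGorensteinLocal A := by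
  obtain ⟨xs, hreg, hm⟩ := exists_isRegular_maximalIdeal_eq_ofList A
  have hmax : (Ideal.ofList xs).IsMaximal := hm ▸ inferInstance
  let := Ideal.Quotient.field (Ideal.ofList xs)
  refine ⟨inferInstance, inferInstance, xs, hreg, inferInstance, ?_⟩
  exact injective_self_of_nondegenerate (A ⧸ Ideal.ofList xs) LinearMap.id
    fun x hx => by simpa using hx 1

lemma isGorensteinLocal_of_nondegenerate {A : Type u} [CommRing A] [IsLocalRing A]
    [IsNoetherianRing A] (F : Type*) [Field F] {B : Type*} [CommRing B] [Algebra F B]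
    [Module.Finite F B] (l : B →ₗ[F] F) (hl : ∀ x, (∀ y, l (y * x) = 0) → x = 0)
    (ψ : A →+* B) (hψ : Function.Surjective ψ) (θ : List A) (hker : RingHom.ker ψ = Ideal.ofList θ)
    (hreg : RingTheory.Sequence.IsRegular A θ) : IsGorensteinLocal A := by
  let e : (A ⧸ Ideal.ofList θ) ≃+* B :=
    (Ideal.quotEquivOfEq hker.symm).trans (RingHom.quotientKerEquivOfSurjective hψ)
  let : Algebra F (A ⧸ Ideal.ofList θ) := ((e.symm : B →+* _).comp (algebraMap F B)).toAlgebra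
  let e' : (A ⧸ Ideal.ofList θ) ≃ₐ[F] B := AlgEquiv.ofRingEquiv (f := e) fun x => by
    exact e.apply_symm_apply (algebraMap F B x)
  have hfin : Module.Finite F (A ⧸ Ideal.ofList θ) := .equiv e'.symm.toLinearEquiv
  refine ⟨inferInstance, inferInstance, θ, hreg, IsArtinianRing.of_finite F _, ?_⟩
  refine injective_self_of_nondegenerate F (l.comp e'.toLinearMap) fun x hx => ?_
  rw [← map_eq_zero_iff e' e'.injective]
  refine hl _ fun y => ?_
  obtain ⟨y, rfl⟩ := e'.surjective y
  rw [← map_mul]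
  exact hx y

end Gorenstein

namespace PluckerRing

open IsLocalRing

variable (O : Type u) [CommRing O] [IsLocalRing O]

/-- The homomorphism from the local ring at the vertex. -/
noncomputable def localToFibre :
    Localization.AtPrime (vertexMax O) →+* FiveAlg (ResidueField O) 0 :=
  IsLocalization.lift (M := (vertexMax O).primeCompl) (g := toFibre O) fun y => by
    by_contra h
    exact y.2 h

lemma localToFibre_algebraMap (x : PluckerRing O) :
    localToFibre O (algebraMap _ _ x) = toFibre O x := IsLocalization.lift_eq _ x

lemma localToFibre_surjective : Function.Surjective (localToFibre O) := fun b => by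
  obtain ⟨x, rfl⟩ := toFibre_surjective O b
  exact ⟨_, localToFibre_algebraMap O x⟩

variable {O}

/-- The system of parameters at the vertex. -/
noncomputable def parameters (ϖ : O) : List (Localization.AtPrime (vertexMax O)) :=
  ((varList ϖ).map (param O)).map (algebraMap (PluckerRing O) _)

lemma ker_localToFibre {ϖ : O} (hϖ : maximalIdeal O = Ideal.span {ϖ}) :
    RingHom.ker (localToFibre O) = Ideal.ofList (parameters ϖ) := by
  rw [parameters, ← Ideal.map_ofList, ← ker_toFibre hϖ]
  refine le_antisymm (fun x hx => ?_) (Ideal.map_le_iff_le_comap.2 fun x hx => ?_)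
  · obtain ⟨x, s, rfl⟩ := IsLocalization.exists_mk'_eq (vertexMax O).primeCompl x
    rw [RingHom.mem_ker] at hx
    have h := congrArg (localToFibre O)
      (IsLocalization.mk'_spec (Localization.AtPrime (vertexMax O)) x s)
    rw [map_mul, hx, zero_mul, localToFibre_algebraMap] at h
    rw [IsLocalization.mk'_eq_mul_mk'_one]
    exact Ideal.mul_mem_right _ _ (Ideal.mem_map_of_mem _ h.symm)
  · rw [Ideal.mem_comap, RingHom.mem_ker, localToFibre_algebraMap]
    exact hx

lemma isRegular_parameters [IsDomain O] [IsNoetherianRing O] {ϖ : O}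
    (hϖ : maximalIdeal O = Ideal.span {ϖ}) (h0 : ϖ ≠ 0) :
    RingTheory.Sequence.IsRegular (Localization.AtPrime (vertexMax O)) (parameters ϖ) := by
  refine (isWeaklyRegular_param h0).isRegular_of_isLocalization_of_mem _ (vertexMax O)
    fun r hr => ker_toFibre_le_vertexMax O ?_
  rw [ker_toFibre hϖ]
  exact Ideal.subset_span hr

lemma maximalIdeal_cube_le_ker :
    maximalIdeal (Localization.AtPrime (vertexMax O)) ^ 3 ≤ RingHom.ker (localToFibre O) := by
  have := IsLocalHom.of_surjective _ (localToFibre_surjective O)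
  have h3 : maximalIdeal (FiveAlg (ResidueField O) 0) ^ 3 = ⊥ := by
    rw [pow_succ, FiveAlg.maximalIdeal_sq_eq_span, eq_bot_iff, Ideal.mul_le]
    intro x hx y hy
    obtain ⟨a, rfl⟩ := Ideal.mem_span_singleton'.1 hx
    rw [FiveAlg.mem_maximalIdeal_iff] at hy
    rw [Ideal.mem_bot]
    ext <;> simp [FiveAlg.mul_eq, hy]
  rw [← Ideal.map_eq_bot_iff_le_ker, Ideal.map_pow,
    IsLocalRing.map_maximalIdeal_of_surjective _ (localToFibre_surjective O), h3]

end PluckerRing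

namespace PluckerRing

open IsLocalRing

variable (O : Type u) [CommRing O]

/-- Only one maximal ideal lies over the vertex, and there the parameters leave the fibre with its
perfect pairing; all other local rings are regular. -/
theorem isGorenstein [IsDomain O] [IsDiscreteValuationRing O] : IsGorenstein (PluckerRing O) := by
  obtain ⟨ϖ, hϖ⟩ := IsDiscreteValuationRing.exists_irreducible O
  refine ⟨inferInstance, fun m hm => ?_⟩
  by_cases h : vertexIdeal O ≤ m
  · obtain rfl := eq_vertexMax hϖ.maximalIdeal_eq h
    exact isGorensteinLocal_of_nondegenerate (ResidueField O) FiveAlg.socleForm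
      FiveAlg.eq_zero_of_socleForm_mul (localToFibre O) (localToFibre_surjective O) (parameters ϖ)
      (ker_localToFibre hϖ.maximalIdeal_eq) (isRegular_parameters hϖ.maximalIdeal_eq hϖ.ne_zero)
  · have := isRegularLocalRing_of_not_le O m h
    exact isGorensteinLocal_of_isRegularLocalRing _

theorem not_isCompleteIntersection [IsDomain O] [IsDiscreteValuationRing O] :
    ¬ IsCompleteIntersection (PluckerRing O) := by
  obtain ⟨ϖ, hϖ⟩ := IsDiscreteValuationRing.exists_irreducible O
  intro h
  obtain ⟨S, _, _, φ, ys, hφ, hker, hd⟩ := exists_regular_presentation (localToFibre O)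
    (localToFibre_surjective O) (parameters ϖ) (ker_localToFibre hϖ.maximalIdeal_eq)
    (isRegular_parameters hϖ.maximalIdeal_eq hϖ.ne_zero).1 3 maximalIdeal_cube_le_ker
    (h.2 (vertexMax O))
  exact false_of_ker_eq_ofList _ FiveAlg.maximalIdeal_eq_span FiveAlg.maximalIdeal_ne_span_pair _
    FiveAlg.maximalIdeal_sq_eq_span φ hφ ys hker hd

end PluckerRing

/-! ### The singular locus -/

section Nonregular

open IsLocalRing

/-- A lower bound for the dimension of a regular local ring from a square-zero extension. -/
theorem card_le_ringKrullDim_of_isRegularLocalRing {A K ι κ : Type*} [CommRing A] [Field K]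
    [Fintype κ] [Finite ι] (q : Ideal A) [q.IsPrime] [IsRegularLocalRing (Localization.AtPrime q)]
    (φ : A →+* TrivSqZeroExt K (ι → K)) (hφ : ∀ x, x ∈ q ↔ (φ x).fst = 0) (y : κ → A)
    (hy : ∀ i, y i ∈ q) (hl : LinearIndependent K fun i => (φ (y i)).snd) :
    (Fintype.card κ : WithBot ℕ∞) ≤ ringKrullDim A := by
  let Φ : Localization.AtPrime q →+* TrivSqZeroExt K (ι → K) :=
    IsLocalization.lift (M := q.primeCompl) (g := φ) fun s => by
      rw [TrivSqZeroExt.isUnit_iff_isUnit_fst, isUnit_iff_ne_zero, Ne, ← hφ]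
      exact s.2
  have hΦ (x : A) : Φ (algebraMap A _ x) = φ x := IsLocalization.lift_eq _ x
  have hm (x) (hx : x ∈ maximalIdeal (Localization.AtPrime q)) : (Φ x).fst = 0 := by
    by_contra hne
    have hu : IsUnit (Φ x) := by
      rwa [TrivSqZeroExt.isUnit_iff_isUnit_fst, isUnit_iff_ne_zero]
    obtain ⟨a, s, rfl⟩ := IsLocalization.exists_mk'_eq q.primeCompl x
    have ha : a ∈ q := (IsLocalization.AtPrime.mk'_mem_maximal_iff _ q a s).1 hx
    have h := congrArg Φ (IsLocalization.mk'_spec (Localization.AtPrime q) a s)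
    rw [map_mul, hΦ, hΦ] at h
    have h' := congrArg TrivSqZeroExt.fst h
    rw [TrivSqZeroExt.fst_mul, (hφ a).1 ha] at h'
    exact (mul_eq_zero.1 h').elim hne fun h => s.2 ((hφ _).2 h)
  obtain ⟨s, hs, hs'⟩ := Submodule.FG.exists_span_finset_card_eq_spanFinrank
    (maximalIdeal (Localization.AtPrime q)).fg_of_isNoetherianRing
  -- For `x` in the maximal ideal the `snd` part of `Φ (a * x)` is a scalar times that of `Φ x`. So
  -- the `snd` parts lie in the span coming from a generating set, whose minimal size is the
  -- dimension by regularity.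
  have hmem (x) (hx : x ∈ maximalIdeal (Localization.AtPrime q)) :
      (Φ x).snd ∈ Submodule.span K ((fun z => (Φ z).snd) '' (s : Set (Localization.AtPrime q))) := by
    rw [← hs'] at hx
    induction hx using Submodule.span_induction with
    | mem x h => exact Submodule.subset_span ⟨x, h, rfl⟩
    | zero => simp
    | add x y _ _ hx hy => rw [map_add, TrivSqZeroExt.snd_add]; exact add_mem hx hy
    | smul a x hx h =>
      rw [smul_eq_mul, map_mul, TrivSqZeroExt.snd_mul, hm x (hs' ▸ hx), MulOpposite.op_zero,
        zero_smul, add_zero]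
      exact Submodule.smul_mem _ _ h
  have hcard : Fintype.card κ ≤ s.card := by
    have h1 : Submodule.span K (Set.range fun i => (φ (y i)).snd) ≤
        Submodule.span K ((fun z => (Φ z).snd) '' (s : Set (Localization.AtPrime q))) := by
      rw [Submodule.span_le]
      rintro _ ⟨i, rfl⟩
      simp only [← hΦ]
      exact hmem _ ((IsLocalization.AtPrime.to_map_mem_maximal_iff _ q _).2 (hy i))
    classical
    rw [← finrank_span_eq_card hl]
    refine (Submodule.finrank_mono h1).trans ?_
    rw [← Finset.coe_image]
    exact (finrank_span_finset_le_card _).trans Finset.card_image_le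
  have hdim : ringKrullDim (Localization.AtPrime q) ≤ ringKrullDim A := by
    rw [IsLocalization.AtPrime.ringKrullDim_eq_height q]
    exact Ideal.height_le_ringKrullDim_of_ne_top Ideal.IsPrime.ne_top'
  refine le_trans ?_ hdim
  rw [← IsRegularLocalRing.spanFinrank_maximalIdeal, ← hs]
  exact_mod_cast hcard

lemma mem_singularLocus_comap_iff {A B : Type u} [CommRing A] [CommRing B] (e : A ≃+* B)
    (p : PrimeSpectrum B) :
    PrimeSpectrum.comap (e : A →+* B) p ∈ singularLocus A ↔ p ∈ singularLocus B := by
  let e' : Localization.AtPrime (PrimeSpectrum.comap (e : A →+* B) p).asIdeal ≃+*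
      Localization.AtPrime p.asIdeal :=
    IsLocalization.ringEquivOfRingEquiv (M := (PrimeSpectrum.comap (e : A →+* B) p).asIdeal.primeCompl)
      (T := p.asIdeal.primeCompl) _ _ e (by
        ext y
        obtain ⟨x, rfl⟩ := e.surjective y
        simp [Ideal.primeCompl])
  exact not_congr ⟨fun h => .of_ringEquiv e', fun h => .of_ringEquiv e'.symm⟩

end Nonregular

namespace PluckerRing

/-- The index set of the Plücker coordinates. -/
abbrev Pairs : Type := {ij : Fin 5 × Fin 5 // ij.1 < ij.2}

/-- The standard alternating family of vectors. -/
def pairVector (K : Type*) [Field K] (i j : Fin 5) : Pairs → K :=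
  fun k => (if (i, j) = k.1 then 1 else 0) - if (j, i) = k.1 then 1 else 0

variable {A K : Type*} [CommRing A] [Field K]

/-- Products of square-zero elements vanish, so the quadratic relations put no condition on tangent
vectors at the vertex; only alternation remains, and the tangent directions number ten. -/
lemma isPlucker_pairVector :
    IsPlucker fun i j => (TrivSqZeroExt.inr (pairVector K i j) : TrivSqZeroExt K (Pairs → K)) where
  self i := by
    have : pairVector K i i = 0 := by ext; simp [pairVector]
    rw [this, TrivSqZeroExt.inr_zero]
  swap i j := by
    rw [← TrivSqZeroExt.inr_neg]
    congr 1
    ext k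
    simp [pairVector]
  rel i j k l := by simp

/-- The tangent vectors at the vertex. -/
noncomputable def tangentHom (f : PluckerRing A →+* K) :
    PluckerRing A →+* TrivSqZeroExt K (Pairs → K) :=
  liftRingHom ((TrivSqZeroExt.inlHom K (Pairs → K)).comp (f.comp (algebraMap A _))) _
    isPlucker_pairVector

lemma tangentHom_p (f : PluckerRing A →+* K) (i j : Fin 5) :
    tangentHom f (p A i j) = TrivSqZeroExt.inr (pairVector K i j) := liftRingHom_p _ _ _ i j

lemma fst_tangentHom {f : PluckerRing A →+* K} (hf : vertexIdeal A ≤ RingHom.ker f)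
    (x : PluckerRing A) : (tangentHom f x).fst = f x := by
  have : (TrivSqZeroExt.fstHom K K (Pairs → K) : _ →+* K).comp (tangentHom f) = f := by
    refine ringHom_ext (fun i j => ?_) fun a => ?_
    · have : f (p A i j) = 0 := hf (p_mem_vertexIdeal A i j)
      rw [RingHom.comp_apply, tangentHom_p, this]
      rfl
    · rw [RingHom.comp_apply, tangentHom, liftRingHom_algebraMap]
      rfl
  exact DFunLike.congr_fun this x

lemma linearIndependent_pairVector :
    LinearIndependent K fun k : Pairs => pairVector K k.1.1 k.1.2 := by
  convert (Pi.basisFun K Pairs).linearIndependent using 1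
  ext k l
  have h : (k.1.2, k.1.1) ≠ l.1 := fun h => by
    have h1 := l.2
    rw [← h] at h1
    exact lt_asymm h1 k.2
  simp [pairVector, h, Pi.single_apply, Subtype.ext_iff, eq_comm]

lemma card_pairs : Fintype.card Pairs = 10 := by decide

/-- Ten independent tangent directions against dimension at most eight. -/
theorem not_isRegularLocalRing_of_le [IsNoetherianRing A]
    (hA : ringKrullDim A ≤ 1) {q : Ideal (PluckerRing A)} [q.IsPrime] (hq : vertexIdeal A ≤ q) :
    ¬ IsRegularLocalRing (Localization.AtPrime q) := by
  intro h
  let f : PluckerRing A →+* q.ResidueField := algebraMap _ _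
  have hker (x) : f x = 0 ↔ x ∈ q := q.algebraMap_residueField_eq_zero
  have hf : vertexIdeal A ≤ RingHom.ker f := fun x hx => (hker x).2 (hq hx)
  have h10 := card_le_ringKrullDim_of_isRegularLocalRing q (tangentHom f)
    (fun x => by rw [fst_tangentHom hf, hker]) (fun k : Pairs => p A k.1.1 k.1.2)
    (fun k => hq (p_mem_vertexIdeal A _ _)) (by
      simp only [tangentHom_p, TrivSqZeroExt.snd_inr]
      exact linearIndependent_pairVector)
  rw [card_pairs, ringKrullDim_eq] at h10
  have := h10.trans (add_le_add_left hA 7)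
  norm_cast at this

/-- The extra variable raises the dimension to at most nine, still below the ten tangent directions
coming from the Plücker coordinates. -/
theorem not_isRegularLocalRing_polynomial_of_le [IsNoetherianRing A]
    (hA : ringKrullDim A ≤ 1) {q : Ideal (Polynomial (PluckerRing A))} [q.IsPrime]
    (hq : (vertexIdeal A).map Polynomial.C ≤ q) :
    ¬ IsRegularLocalRing (Localization.AtPrime q) := by
  intro h
  let f : Polynomial (PluckerRing A) →+* q.ResidueField := algebraMap _ _
  have hker (x) : f x = 0 ↔ x ∈ q := q.algebraMap_residueField_eq_zero
  have hf : vertexIdeal A ≤ RingHom.ker (f.comp Polynomial.C) :=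
    fun x hx => (hker _).2 (hq (Ideal.mem_map_of_mem _ hx))
  let φ : Polynomial (PluckerRing A) →+* TrivSqZeroExt q.ResidueField (Pairs → q.ResidueField) :=
    Polynomial.eval₂RingHom (tangentHom (f.comp Polynomial.C)) (TrivSqZeroExt.inl (f .X))
  have hφC (x) : φ (.C x) = tangentHom (f.comp Polynomial.C) x := Polynomial.eval₂_C _ _
  have hφ (x) : (φ x).fst = f x := by
    have : (TrivSqZeroExt.fstHom q.ResidueField q.ResidueField (Pairs → q.ResidueField) :
        _ →+* q.ResidueField).comp φ = f := by
      refine Polynomial.ringHom_ext (fun x => ?_) ?_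
      · exact (congrArg TrivSqZeroExt.fst (hφC x)).trans (fst_tangentHom hf x)
      · exact (congrArg TrivSqZeroExt.fst (Polynomial.eval₂_X _ _)).trans rfl
    exact DFunLike.congr_fun this x
  have h10 := card_le_ringKrullDim_of_isRegularLocalRing q φ
    (fun x => by rw [hφ, hker]) (fun k : Pairs => .C (p A k.1.1 k.1.2))
    (fun k => hq (Ideal.mem_map_of_mem _ (p_mem_vertexIdeal A _ _))) (by
      simp only [hφC, tangentHom_p, TrivSqZeroExt.snd_inr]
      exact linearIndependent_pairVector)
  rw [card_pairs, Polynomial.ringKrullDim_of_isNoetherianRing, ringKrullDim_eq] at h10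
  have := h10.trans (add_le_add_left (add_le_add_left hA 7) 1)
  norm_cast at this

theorem singularLocus_eq (A : Type u) [CommRing A] [IsRegularRing A] (hA : ringKrullDim A ≤ 1) :
    singularLocus (PluckerRing A) = PrimeSpectrum.zeroLocus (vertexIdeal A : Set (PluckerRing A)) := by
  ext q
  refine ⟨fun h => ?_, fun h => not_isRegularLocalRing_of_le hA h⟩
  by_contra h'
  exact h (isRegularLocalRing_of_not_le A q.asIdeal h')

theorem singularLocus_polynomial_eq (A : Type u) [CommRing A] [IsRegularRing A]
    (hA : ringKrullDim A ≤ 1) : singularLocus (Polynomial (PluckerRing A)) =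
      PrimeSpectrum.zeroLocus ((vertexIdeal A).map Polynomial.C : Set (Polynomial (PluckerRing A))) := by
  ext q
  refine ⟨fun h => ?_, fun h => not_isRegularLocalRing_polynomial_of_le hA h⟩
  by_contra h'
  exact h (isRegularLocalRing_polynomial_of_not_le A q.asIdeal h')

end PluckerRing

/-! ### Vanishing of divisor class groups -/

section ClassGroup

lemma ordAlong_of_notMem {A : Type u} [CommRing A] (q : PrimeDivisor A) {a : A}
    (ha : a ∉ q.1.asIdeal) : ordAlong q a = 0 :=
  Ring.ord_of_isUnit (IsLocalization.map_units _ (⟨a, ha⟩ : q.1.asIdeal.primeCompl))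

lemma ordAlong_of_eq_span {A : Type u} [CommRing A] (q : PrimeDivisor A) {a : A}
    (ha : q.1.asIdeal = Ideal.span {a}) : ordAlong q a = 1 := by
  let S := Localization.AtPrime q.1.asIdeal
  have hmax : (Ideal.span {algebraMap A S a}).IsMaximal := by
    rw [← Set.image_singleton, ← Ideal.map_span, ← ha, Localization.AtPrime.map_eq_maximalIdeal]
    infer_instance
  rw [ordAlong, Ring.ord, Module.length_eq_one_iff,
    isSimpleModule_iff_isSimpleModule_of_algebraMap_surjective
      (S := S ⧸ Ideal.span {algebraMap A S a}) Ideal.Quotient.mk_surjective]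
  let := Ideal.Quotient.field (Ideal.span {algebraMap A S a})
  exact instIsSimpleModule _

/-- The divisor class group of a Noetherian factorial domain vanishes. -/
theorem subsingleton_divisorClassGroup (A : Type u) [CommRing A] [IsDomain A] [IsNoetherianRing A]
    [UniqueFactorizationMonoid A] : Subsingleton (DivisorClassGroup A) := by
  rw [QuotientAddGroup.subsingleton_iff]
  refine eq_top_iff.2 fun D _ => ?_
  induction D using Finsupp.induction_linear with
  | zero => exact zero_mem _
  | add f g hf hg => exact add_mem (hf trivial) (hg trivial)
  | single p n =>
    have h1 : Finsupp.single p (1 : ℤ) ∈ principalDivisors A := by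
      -- The prime divisor is principal. Its generator has order one along it and order zero along
      -- every other prime divisor, since distinct primes of height one are incomparable.
      have := UniqueFactorizationMonoid.isPrincipal_of_height_eq_one p.2
      obtain ⟨a, ha⟩ := this
      have ha0 : a ≠ 0 := by
        rintro rfl
        refine Ideal.ne_bot_of_height_eq_one p.2 ?_
        rw [ha]; simp
      refine AddSubgroup.subset_closure ⟨a, mem_nonZeroDivisors_of_ne_zero ha0, fun q => ?_⟩
      by_cases hpq : p = q
      · subst hpq
        rw [ordAlong_of_eq_span p ha]
        simp
      · rw [ordAlong_of_notMem, Finsupp.single_eq_of_ne' hpq]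
        · simp
        · intro haq
          have hle : p.1.asIdeal ≤ q.1.asIdeal := by
            rw [ha]; exact (Ideal.span_singleton_le_iff_mem _).2 haq
          refine hpq (Subtype.ext (PrimeSpectrum.ext ?_))
          by_contra hne
          have hlt := lt_of_le_of_ne hle hne
          have := Ideal.height_add_one_le_of_lt_of_isPrime hlt
          rw [p.2, q.2] at this
          norm_num at this
    have := AddSubgroup.zsmul_mem _ h1 n
    simpa using this

end ClassGroup

/-! ### Rationality away from a divisor -/

section Rational

variable {k B : Type u} [Field k] [CommRing B] [Algebra k B]

/-- An embedding into a polynomial ring survives the flat base change to `K`, and the polynomial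
ring stays a domain. -/
lemma isDomain_tensorProduct_of_injective {D : Type u} [CommRing D] [Algebra k D] (m : ℕ)
    (γ : D →ₐ[k] MvPolynomial (Fin m) k) (hγ : Function.Injective γ) (K : Type u) [Field K]
    [Algebra k K] : IsDomain (D ⊗[k] K) := by
  let e := (Algebra.TensorProduct.comm k (MvPolynomial (Fin m) k) K).toRingEquiv.trans
    (MvPolynomial.algebraTensorAlgEquiv (σ := Fin m) k K).toRingEquiv
  have : IsDomain (MvPolynomial (Fin m) k ⊗[k] K) := e.toMulEquiv.isDomain _
  exact Function.Injective.isDomain (Algebra.TensorProduct.map γ (AlgHom.id k K)).toRingHom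
    (Module.Flat.rTensor_preserves_injective_linearMap (M := K) γ.toLinearMap hγ)

lemma geometricallyIntegral_of_injective {D : Type u} [CommRing D] [Algebra k D] (m : ℕ)
    (γ : D →ₐ[k] MvPolynomial (Fin m) k) (hγ : Function.Injective γ) :
    GeometricallyIntegral (structureMap k D) := by
  refine ⟨geometrically_iff_of_commRing.2 fun K _ _ Z fst snd h => ?_⟩
  have := isDomain_tensorProduct_of_injective m γ hγ K
  have hint : IsIntegral (Spec (CommRingCat.of (D ⊗[k] K))) := inferInstance
  let e : Z ≅ Spec (CommRingCat.of (D ⊗[k] K)) := h.isoPullback ≪≫ pullbackSpecIso k D K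
  have : Nonempty Z := ⟨e.inv (Nonempty.some inferInstance)⟩
  exact isIntegral_of_isOpenImmersion e.hom

/-- The complement of a principal divisor as the spectrum of a localization. -/
noncomputable def complementOpenIso (f : B) : (complementOpen (Ideal.span {f})).toScheme ≅
    Spec (CommRingCat.of (Localization.Away f)) :=
  IsOpenImmersion.isoOfRangeEq (complementOpen (Ideal.span {f})).ι
    (Spec.map (CommRingCat.ofHom (algebraMap B (Localization.Away f)))) (by
      rw [Scheme.Opens.range_ι]
      refine Eq.trans ?_ (PrimeSpectrum.localization_away_comap_range (Localization.Away f) f).symm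
      change (PrimeSpectrum.zeroLocus ((Ideal.span {f} : Ideal B) : Set B))ᶜ = _
      rw [PrimeSpectrum.zeroLocus_span, PrimeSpectrum.basicOpen_eq_zeroLocus_compl])

lemma complementOpenIso_hom_comp (f : B) : (complementOpenIso f).hom ≫
    Spec.map (CommRingCat.ofHom (algebraMap B (Localization.Away f))) =
      (complementOpen (Ideal.span {f})).ι :=
  IsOpenImmersion.isoOfRangeEq_hom_fac _ _ _

lemma specMap_comp_structureMap {C : Type u} [CommRing C] [Algebra k C] (φ : B →ₐ[k] C) :
    Spec.map (CommRingCat.ofHom φ.toRingHom) ≫ structureMap k B = structureMap k C := by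
  rw [structureMap, structureMap, ← Spec.map_comp, ← CommRingCat.ofHom_comp]
  congr 2
  exact φ.comp_algebraMap

/-- The map `γ` embeds `B/(f)` in a polynomial ring, making the divisor geometrically integral; `α`
identifies its complement with the locus `g ≠ 0`, on which `a` is a rational point. -/
theorem isRationalAwayFromIntegralDivisor_of_algEquiv {n : ℕ} (f : B) (hf : (Ideal.span {f}).height = 1)
    (g : MvPolynomial (Fin n) k) (α : Localization.Away f ≃ₐ[k] Localization.Away g)
    (a : Fin n → k) (ha : MvPolynomial.eval a g ≠ 0) (m : ℕ) (γ : B →ₐ[k] MvPolynomial (Fin m) k)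
    (hγ : RingHom.ker γ = Ideal.span {f}) : IsRationalAwayFromIntegralDivisor k B n := by
  have hz : ∀ b ∈ Ideal.span {f}, γ b = 0 := fun b hb => by rwa [← RingHom.mem_ker, hγ]
  refine ⟨Ideal.span {f}, hf, geometricallyIntegral_of_injective m
    (Ideal.Quotient.liftₐ (Ideal.span {f}) γ hz) ?_, ?_⟩
  · refine (injective_iff_map_eq_zero _).2 fun x hx => ?_
    obtain ⟨x, rfl⟩ := Ideal.Quotient.mk_surjective x
    rw [Ideal.Quotient.eq_zero_iff_mem, ← hγ]
    exact hx
  let e2 : Spec (CommRingCat.of (Localization.Away f)) ≅ Spec (CommRingCat.of (Localization.Away g)) :=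
    Scheme.Spec.mapIso α.toRingEquiv.toCommRingCatIso.symm.op
  have he2 : e2.hom = Spec.map (CommRingCat.ofHom α.symm.toAlgHom.toRingHom) := rfl
  have hloc (C : Type u) [CommRing C] [Algebra k C] (c : C) :
      Spec.map (CommRingCat.ofHom (algebraMap C (Localization.Away c))) ≫ structureMap k C =
        structureMap k (Localization.Away c) :=
    specMap_comp_structureMap (IsScalarTower.toAlgHom k C (Localization.Away c))
  have hU : (complementOpenIso g).inv ≫ (complementOpen (Ideal.span {g})).ι =
      Spec.map (CommRingCat.ofHom (algebraMap _ (Localization.Away g))) := by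
    rw [Iso.inv_comp_eq, complementOpenIso_hom_comp]
  refine ⟨complementOpen (Ideal.span {g}), complementOpenIso f ≪≫ e2 ≪≫ (complementOpenIso g).symm,
    ?_, ?_⟩
  · simp only [Iso.trans_hom, Iso.symm_hom, Category.assoc]
    rw [reassoc_of% hU, hloc, he2, specMap_comp_structureMap, ← hloc B f, ← Category.assoc,
      complementOpenIso_hom_comp]
  · let σ : Localization.Away g →ₐ[k] k := IsLocalization.liftAlgHom (M := Submonoid.powers g)
      (f := MvPolynomial.aeval a) (PluckerRing.isUnit_powers_of_isUnit g
        (MvPolynomial.aeval a : _ →ₐ[k] k).toRingHom (isUnit_iff_ne_zero.2 ha))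
    refine ⟨Spec.map (CommRingCat.ofHom σ.toRingHom) ≫ (complementOpenIso g).inv, ?_⟩
    rw [Category.assoc, reassoc_of% hU, hloc, specMap_comp_structureMap]
    exact Spec.map_id _

end Rational

namespace PluckerRing

lemma ker_minors' (A : Type*) [CommRing A] [IsDomain A] :
    RingHom.ker (minors' A) = Ideal.span {p A 0 1} :=
  le_antisymm (fun _ hx => Ideal.mem_span_singleton.2 (dvd_of_minors'_eq_zero A hx)) <| by
    rw [Ideal.span_singleton_le_iff_mem]; exact minors'_p01 A

lemma height_span_singleton_of_prime {A : Type*} [CommRing A] [IsDomain A] [IsNoetherianRing A]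
    {x : A} (hx : Prime x) : (Ideal.span {x}).height = 1 := by
  have hp : (Ideal.span {x}).IsPrime := (Ideal.span_singleton_prime hx.ne_zero).2 hx
  refine le_antisymm (Ideal.height_le_one_of_isPrincipal_of_mem_minimalPrimes (Ideal.span {x}) _
    (by rw [Ideal.minimalPrimes_eq_subsingleton_self]; rfl)) ?_
  rw [Order.one_le_iff_ne_zero, Ne, Ideal.height_eq_zero_iff_eq_bot, Ideal.span_singleton_eq_bot]
  exact hx.ne_zero

section Fibre

variable (O k : Type u) [CommRing O] [Field k] [Algebra O k]

instance : IsDomain (k ⊗[O] PluckerRing O) := (baseChangeEquiv O k).toMulEquiv.isDomain _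

instance : IsNoetherianRing (k ⊗[O] PluckerRing O) :=
  isNoetherianRing_of_ringEquiv _ (baseChangeEquiv O k).symm.toRingEquiv

instance : UniqueFactorizationMonoid (k ⊗[O] PluckerRing O) :=
  (baseChangeEquiv O k).symm.toMulEquiv.uniqueFactorizationMonoid inferInstance

lemma ringKrullDim_fibre : ringKrullDim (k ⊗[O] PluckerRing O) = 7 := by
  rw [ringKrullDim_eq_of_ringEquiv (baseChangeEquiv O k).toRingEquiv, ringKrullDim_eq,
    ringKrullDim_eq_zero_of_field, zero_add]

theorem isRationalAwayFromIntegralDivisor_fibre :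
    IsRationalAwayFromIntegralDivisor k (k ⊗[O] PluckerRing O) 7 := by
  let β := baseChangeEquiv O k
  let f : k ⊗[O] PluckerRing O := 1 ⊗ₜ p O 0 1
  have hβ : β f = p k 0 1 := baseChangeEquiv_tmul O k 0 1
  have hf : Prime f := by
    rw [← MulEquiv.prime_iff β.toMulEquiv]
    exact hβ ▸ prime_p01 k
  -- The divisor is `p 0 1 = 0`, and the rational point has all coordinates equal to 1.
  refine isRationalAwayFromIntegralDivisor_of_algEquiv f (height_span_singleton_of_prime hf)
    (MvPolynomial.X 0) ((IsLocalization.algEquivOfAlgEquiv (M := Submonoid.powers f)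
      (T := Submonoid.powers (p k 0 1)) (Localization.Away f) (Localization.Away (p k 0 1)) β ?_).trans
      (chartEquiv k)) 1 (by simp) 6 ((minors' k).comp β.toAlgHom) ?_
  · rw [Submonoid.map_powers]
    exact congrArg _ hβ
  · ext x
    have h : minors' k (β x) = 0 ↔ β x ∈ Ideal.span {p k 0 1} := by
      rw [← ker_minors', RingHom.mem_ker]
    refine h.trans ?_
    rw [Ideal.mem_span_singleton, Ideal.mem_span_singleton, ← hβ]
    exact map_dvd_iff β

end Fibre

end PluckerRing

/-! ### The grading -/

namespace PluckerRing

variable (A : Type*) [CommRing A]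

/-- The coaction of the multiplicative monoid scheme which defines the grading. -/
noncomputable def coaction : PluckerRing A →ₐ[A] Polynomial (PluckerRing A) :=
  lift (fun i j => .C (p A i j) * .X)
    { self i := by simp [(isPlucker_p A).self]
      swap i j := by rw [(isPlucker_p A).swap, map_neg, neg_mul]
      rel i j k l := by
        have := congrArg (Polynomial.C (R := PluckerRing A)) ((isPlucker_p A).rel i j k l)
        simp only [map_add, map_sub, map_mul, map_zero] at this
        linear_combination Polynomial.X ^ 2 * this }

/-- The projection to the degree zero part. -/
noncomputable def augmentation : PluckerRing A →ₐ[A] A :=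
  lift (fun _ _ => 0) ⟨fun _ => rfl, fun _ _ => neg_zero.symm, fun _ _ _ _ => by simp⟩

@[simp] lemma augmentation_p (i j : Fin 5) : augmentation A (p A i j) = 0 := lift_p _ _ i j

lemma eval_zero_coaction (x : PluckerRing A) :
    (coaction A x).eval 0 = algebraMap A _ (augmentation A x) := by
  refine AlgHom.congr_fun (φ₁ := ((Polynomial.aeval (R := PluckerRing A) 0).restrictScalars A).comp
    (coaction A)) (φ₂ := (Algebra.ofId A _).comp (augmentation A)) (algHom_ext fun i j => ?_) x
  simp [coaction]

/-- The homogeneous elements of degree `n`. -/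
noncomputable def grading (n : ℕ) : Submodule A (PluckerRing A) where
  carrier := {x | coaction A x = .C x * .X ^ n}
  add_mem' {x y} hx hy := by
    simp only [Set.mem_ofPred_eq] at *
    rw [map_add, hx, hy, map_add, add_mul]
  zero_mem' := by simp
  smul_mem' a x hx := by
    simp only [Set.mem_ofPred_eq] at *
    rw [map_smul, hx, ← Polynomial.smul_C, smul_mul_assoc]

variable {A}

lemma mem_grading {n : ℕ} {x : PluckerRing A} :
    x ∈ grading A n ↔ coaction A x = .C x * .X ^ n := Iff.rfl

lemma p_mem_grading (i j : Fin 5) : p A i j ∈ grading A 1 := by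
  rw [mem_grading, pow_one]; exact lift_p _ _ i j

instance : SetLike.GradedMonoid (grading A) where
  one_mem := by simp [mem_grading]
  mul_mem m n x y hx hy := by
    rw [mem_grading] at *
    rw [map_mul, hx, hy, map_mul]; ring

lemma coeff_coaction_coeAlgHom (z : DirectSum ℕ fun n => grading A n) (n : ℕ) :
    (coaction A (DirectSum.coeAlgHom (grading A) z)).coeff n = z n := by
  induction z using DirectSum.induction_on with
  | zero => simp
  | of m x =>
    rw [DirectSum.coeAlgHom_of, mem_grading.1 x.2, Polynomial.coeff_C_mul_X_pow,
      DirectSum.coe_of_apply]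
    simp only [eq_comm]
    split_ifs <;> rfl
  | add x y hx hy => simp [hx, hy]

/-- The coaction separates degrees: its `n`-th coefficient recovers the `n`-th component of a sum.
-/
lemma coeAlgHom_injective : Function.Injective (DirectSum.coeAlgHom (grading A)) := by
  intro x y h
  refine DFinsupp.ext fun n => Subtype.ext ?_
  rw [← coeff_coaction_coeAlgHom, h, coeff_coaction_coeAlgHom]

/-- The decomposition comes from the universal property. The Plücker relations in the direct sum are
checked after the injective map back to the ring. -/
noncomputable instance : GradedAlgebra (grading A) :=
  have h : IsPlucker fun i j => DirectSum.of (fun n => grading A n) 1 ⟨p A i j, p_mem_grading i j⟩ :=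
    ⟨fun i => coeAlgHom_injective (by simp [(isPlucker_p A).self]),
      fun i j => coeAlgHom_injective (by simp [(isPlucker_p A).swap i j]),
      fun i j k l => coeAlgHom_injective (by simp [(isPlucker_p A).rel])⟩
  have hr : (DirectSum.coeAlgHom (grading A)).comp (lift _ h) = .id A _ :=
    algHom_ext fun i j => by simp
  GradedAlgebra.ofAlgHom (grading A) (lift _ h) hr fun i x =>
    coeAlgHom_injective ((AlgHom.congr_fun hr x).trans (DirectSum.coeAlgHom_of _ _ _).symm)

lemma grading_zero : grading A 0 = LinearMap.range (Algebra.linearMap A (PluckerRing A)) := by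
  ext x
  refine ⟨fun hx => ⟨augmentation A x, ?_⟩, ?_⟩
  · rw [Algebra.linearMap_apply, ← eval_zero_coaction, mem_grading.1 hx]
    simp
  · rintro ⟨a, rfl⟩
    rw [Algebra.linearMap_apply, mem_grading, AlgHom.commutes]
    simp [Polynomial.algebraMap_apply]

lemma positiveIdeal_grading (O : Type u) [CommRing O] :
    positiveIdeal (grading O) = vertexIdeal O := by
  refine le_antisymm (Ideal.span_le.2 ?_) (Ideal.span_le.2 ?_)
  · rintro x ⟨n, hn, hx⟩
    have h : algebraMap O (PluckerRing O) (augmentation O x) = 0 := by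
      rw [← eval_zero_coaction, mem_grading.1 hx]
      simp [hn.ne']
    have hv : vertexIdeal O ≤ RingHom.ker (augmentation O) := by
      refine Ideal.span_le.2 ?_
      rintro _ ⟨ij, rfl⟩
      exact augmentation_p O _ _
    obtain ⟨a, ha⟩ := exists_sub_algebraMap_mem x
    have h' := hv ha
    rw [RingHom.mem_ker, map_sub, AlgHom.commutes, Algebra.algebraMap_self_apply, sub_eq_zero] at h'
    rwa [← h', h, sub_zero] at ha
  · rintro _ ⟨ij, rfl⟩
    exact Ideal.subset_span ⟨1, one_pos, p_mem_grading _ _⟩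

end PluckerRing

/-! ### Identification of the closure with the Plücker ring in one variable -/

namespace N22

lemma rank_eta {K : Type*} [Field K] (N : Matrix (Fin 2) (Fin 2) K) : (eta N).rank = N.rank := by
  have h : eta N = Matrix.fromRows (1 : Matrix (Fin 2) (Fin 2) K) (0 : Matrix (Fin 2) (Fin 2) K) * N *
      Matrix.fromCols (0 : Matrix (Fin 2) (Fin 2) K) (1 : Matrix (Fin 2) (Fin 2) K) := by
    rw [Matrix.fromRows_mul, Matrix.fromRows_mul_fromCols]
    simp [eta]
  have h' : N = Matrix.fromCols (1 : Matrix (Fin 2) (Fin 2) K) (0 : Matrix (Fin 2) (Fin 2) K) * eta N *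
      Matrix.fromRows (0 : Matrix (Fin 2) (Fin 2) K) (1 : Matrix (Fin 2) (Fin 2) K) := by
    rw [eta, Matrix.fromCols_mul_fromBlocks, Matrix.fromCols_mul_fromRows]
    simp
  refine le_antisymm ?_ ?_
  · rw [h]
    exact (Matrix.rank_mul_le_left _ _).trans (Matrix.rank_mul_le_right _ _)
  · conv_lhs => rw [h']
    exact (Matrix.rank_mul_le_left _ _).trans (Matrix.rank_mul_le_right _ _)

/-- The block matrix squares to zero, so only its first power imposes a condition, namely that `N`
has rank two. -/
lemma hasNilpotentType_eta_iff {K : Type*} [Field K] {N : Matrix (Fin 2) (Fin 2) K} :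
    HasNilpotentType {2, 2} (eta N) ↔ N.det ≠ 0 := by
  refine ⟨fun h => ?_, fun h i => ?_⟩
  · have h1 : N.rank = 2 := by simpa [rank_eta] using h 1
    rw [← isUnit_iff_ne_zero, ← Matrix.isUnit_iff_isUnit_det, ← Matrix.mulVec_surjective_iff_isUnit]
    refine (LinearMap.range_eq_top (f := N.mulVecLin)).1 (Submodule.eq_top_of_finrank_eq ?_)
    rw [← Matrix.rank, h1]; simp
  · match i with
    | 0 => simp
    | 1 => simp [rank_eta, Matrix.rank_of_det_ne_zero h]
    | i + 2 =>
      rw [add_comm, pow_add, pow_two, eta, Matrix.fromBlocks_multiply]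
      simp

section Tautological

variable (O : Type u) [CommRing O]

open PluckerRing in
/-- The universal triple over the polynomial ring over the Plücker ring. -/
noncomputable def pluckerTriple :
    Fin 3 → Matrix (Fin 2) (Fin 2) (Polynomial (PluckerRing O)) :=
  -- The diagonals make the traces agree identically. Equality of the determinants is then the
  -- Plücker relation on `0, 1, 2, 3`, and the other four relations are the entries of `X₁ N = N
  -- X₂`.
  ![!![.X + .C (p O 0 1) + .C (p O 2 3), .C (p O 1 2); .C (p O 0 3), .X],
    !![.C (p O 1 4), .C (p O 2 4); .C (p O 3 4), .C (p O 0 4)],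
    !![.X + .C (p O 0 1), .C (p O 0 2); .C (p O 1 3), .X + .C (p O 2 3)]]

lemma isPlucker_C_p : IsPlucker fun i j => Polynomial.C (PluckerRing.p O i j) :=
  (PluckerRing.isPlucker_p O).map Polynomial.C

lemma pluckerTriple_mul :
    pluckerTriple O 0 * pluckerTriple O 1 = pluckerTriple O 1 * pluckerTriple O 2 := by
  have h := (isPlucker_C_p O).rel
  ext i j : 1
  fin_cases i <;> fin_cases j <;> simp [pluckerTriple, Matrix.mul_apply]
  · linear_combination h 1 2 3 4
  · linear_combination h 0 1 2 4
  · linear_combination -h 0 1 3 4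
  · linear_combination -h 0 2 3 4

/-- The classifying map of the universal triple over the Plücker ring. -/
noncomputable def toPlucker : CoordRing O →ₐ[O] Polynomial (PluckerRing O) :=
  Ideal.Quotient.liftₐ (relations O)
    (MvPolynomial.aeval fun v => pluckerTriple O v.1 v.2.1 v.2.2) fun a ha => by
    refine (Ideal.span_le (I := RingHom.ker (MvPolynomial.aeval fun v : Fin 3 × Fin 2 × Fin 2 =>
      pluckerTriple O v.1 v.2.1 v.2.2 : _ →ₐ[O] Polynomial (PluckerRing O)))).2 ?_ ha
    rintro _ ⟨ij, rfl⟩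
    have := congrFun (congrFun (pluckerTriple_mul O) ij.1) ij.2
    simpa [generic, Matrix.mul_apply, sub_eq_zero] using this

lemma toPlucker_univ (a : Fin 3) (i j : Fin 2) :
    toPlucker O (univ O a i j) = pluckerTriple O a i j :=
  MvPolynomial.aeval_X _ (a, i, j)

variable {O} in
lemma algHom_ext {B : Type*} [CommRing B] [Algebra O B] {f g : CoordRing O →ₐ[O] B}
    (h : ∀ a i j, f (univ O a i j) = g (univ O a i j)) : f = g :=
  Ideal.Quotient.algHom_ext _ (MvPolynomial.algHom_ext fun v => h v.1 v.2.1 v.2.2)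

lemma univ_mul : univ O 0 * univ O 1 = univ O 1 * univ O 2 := by
  rw [univ, univ, univ, ← Matrix.map_mul, ← Matrix.map_mul, ← sub_eq_zero, ← Matrix.map_sub _ (map_sub _)]
  ext i j
  exact Ideal.Quotient.eq_zero_iff_mem.2 (Ideal.subset_span ⟨(i, j), rfl⟩)

/-- Evaluation of functions on the scheme of triples at the triples given by minors. -/
noncomputable def toPolynomial : Polynomial (PluckerRing O) →ₐ[O] MvPolynomial (Option (Fin 7)) O :=
  (MvPolynomial.optionEquivLeft O (Fin 7)).symm.toAlgHom.comp
    (Polynomial.mapAlgHom (PluckerRing.minors O))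

lemma toPolynomial_injective [IsDomain O] : Function.Injective (toPolynomial O) :=
  (MvPolynomial.optionEquivLeft O (Fin 7)).symm.injective.comp
    (Polynomial.map_injective (PluckerRing.minors O).toRingHom
      (PluckerRing.minors_injective O))

lemma det_pluckerTriple_ne_zero [Nontrivial O] : (pluckerTriple O 1).det ≠ 0 := by
  intro h
  -- The plane spanned by these two rows specializes `N` to the identity matrix.
  let w : Fin 5 → Fin 5 → O :=
    fun i j => ![1, 1, 0, 0, 0] i * ![0, 0, 0, 0, 1] j - ![1, 1, 0, 0, 0] j * ![0, 0, 0, 0, 1] i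
  have hw : IsPlucker w := .of_minors _ _
  have := congrArg (fun f => PluckerRing.lift (A := O) w hw (f.coeff 0)) h
  simp [pluckerTriple, Matrix.det_fin_two, w] at this

end Tautological

section StRing

variable (O E : Type u) [CommRing O] [Field E] [Algebra O E]

/-- At each geometric point parametrized by minors, either `det N` vanishes or the point has the
required type and `z` vanishes. So `z * det N` is the zero polynomial over an infinite field, and
`det N` cancels in a domain. -/
lemma toPlucker_eq_zero_of_mem [IsDomain O] [FaithfulSMul O E] {z : CoordRing O} (hz : z ∈ stIdeal O E) :
    toPlucker O z = 0 := by
  have key : toPolynomial O (toPlucker O (z * (univ O 1).det)) = 0 := by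
    have hinj : Function.Injective (algebraMap O (AlgebraicClosure E)) := by
      rw [IsScalarTower.algebraMap_eq O E]
      exact (algebraMap E _).injective.comp (FaithfulSMul.algebraMap_injective O E)
    refine MvPolynomial.map_injective _ hinj (MvPolynomial.funext fun v => ?_)
    rw [map_zero, map_zero, MvPolynomial.eval_map, ← MvPolynomial.aeval_def]
    let x : CoordRing O →ₐ[O] AlgebraicClosure E :=
      ((MvPolynomial.aeval v).comp (toPolynomial O)).comp (toPlucker O)
    change x (z * (univ O 1).det) = 0
    rw [map_mul]
    by_cases h : ((univ O 1).map x).det = 0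
    · rw [AlgHom.map_det, AlgHom.mapMatrix_apply, h, mul_zero]
    · have : z ∈ RingHom.ker x := by
        simp only [stIdeal, Ideal.mem_iInf] at hz
        exact hz x (hasNilpotentType_eta_iff.2 h)
      rw [RingHom.mem_ker.1 this, zero_mul]
  rw [map_eq_zero_iff _ (toPolynomial_injective O), map_mul, mul_eq_zero] at key
  refine key.resolve_right ?_
  rw [AlgHom.map_det, AlgHom.mapMatrix_apply]
  have h : (univ O 1).map (toPlucker O) = pluckerTriple O 1 :=
    Matrix.ext fun i j => toPlucker_univ O 1 i j
  exact h ▸ det_pluckerTriple_ne_zero O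

variable {O E} in
lemma mem_stIdeal_of_det_mul_eq_zero {z : CoordRing O} (h : z * (univ O 1).det = 0) :
    z ∈ stIdeal O E := by
  simp only [stIdeal, Ideal.mem_iInf]
  intro x hx
  have := congrArg x h
  rw [map_mul, AlgHom.map_det, AlgHom.mapMatrix_apply, map_zero, mul_eq_zero] at this
  exact this.resolve_right (hasNilpotentType_eta_iff.1 hx)

lemma stUniv_apply (a : Fin 3) (i j : Fin 2) :
    stUniv O E a i j = Ideal.Quotient.mk (stIdeal O E) (univ O a i j) := rfl

lemma stUniv_mul : stUniv O E 0 * stUniv O E 1 = stUniv O E 1 * stUniv O E 2 := by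
  rw [stUniv, stUniv, stUniv, ← Matrix.map_mul, ← Matrix.map_mul, univ_mul]

/-- Multiplying `X₁ N - N X₂ = 0` by the adjugate of `N` and taking traces gives the equality times
`det N`, a factor that cancels on the closure. -/
lemma trace_stUniv : (stUniv O E 0).trace = (stUniv O E 2).trace := by
  have h : ((univ O 0).trace - (univ O 2).trace) * (univ O 1).det = 0 := by
    have h := univ_mul O
    have h00 := congrFun (congrFun h 0) 0
    have h01 := congrFun (congrFun h 0) 1
    have h10 := congrFun (congrFun h 1) 0
    have h11 := congrFun (congrFun h 1) 1
    simp only [Matrix.mul_apply, Fin.sum_univ_two] at h00 h01 h10 h11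
    simp only [Matrix.trace_fin_two, Matrix.det_fin_two]
    linear_combination univ O 1 1 1 * h00 - univ O 1 1 0 * h01 - univ O 1 0 1 * h10 + univ O 1 0 0 * h11
  have h' := Ideal.Quotient.eq_zero_iff_mem.2 (mem_stIdeal_of_det_mul_eq_zero (E := E) h)
  rw [map_sub, sub_eq_zero] at h'
  simpa [Matrix.trace_fin_two, stUniv_apply] using h'

lemma det_stUniv : (stUniv O E 0).det = (stUniv O E 2).det := by
  have h : ((univ O 0).det - (univ O 2).det) * (univ O 1).det = 0 := by
    have h := congrArg Matrix.det (univ_mul O)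
    rw [Matrix.det_mul, Matrix.det_mul] at h
    linear_combination h
  have h' := Ideal.Quotient.eq_zero_iff_mem.2 (mem_stIdeal_of_det_mul_eq_zero (E := E) h)
  rw [map_sub, sub_eq_zero] at h'
  simpa [Matrix.det_fin_two, stUniv_apply] using h'

/-- The Plücker coordinates of the universal triple. -/
noncomputable def stCoords : Fin 5 → Fin 5 → StRing O E :=
  let X := stUniv O E
  skewFamily (X 2 0 0 - X 0 1 1) (X 2 0 1) (X 0 1 0) (X 1 1 1) (X 0 0 1) (X 2 1 0) (X 1 0 0)
    (X 2 1 1 - X 0 1 1) (X 1 0 1) (X 1 1 0)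

/-- Four relations are the entries of `X₁ N = N X₂`, two of them corrected by the trace equation;
the fifth is the equality of determinants. -/
lemma isPlucker_stCoords : IsPlucker (stCoords O E) := by
  have h := stUniv_mul O E
  have h00 := congrFun (congrFun h 0) 0
  have h01 := congrFun (congrFun h 0) 1
  have h10 := congrFun (congrFun h 1) 0
  have h11 := congrFun (congrFun h 1) 1
  simp only [Matrix.mul_apply, Fin.sum_univ_two] at h00 h01 h10 h11
  have ht := trace_stUniv O E
  have hd := det_stUniv O E
  simp only [Matrix.trace_fin_two, Matrix.det_fin_two] at ht hd
  refine isPlucker_skewFamily ?_ ?_ ?_ ?_ ?_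
  · linear_combination h00 - stUniv O E 1 0 0 * ht
  · linear_combination -h11
  · linear_combination -h10
  · linear_combination h01 - stUniv O E 1 0 1 * ht
  · linear_combination stUniv O E 0 1 1 * ht - hd

/-- The classifying map of the universal triple over the Plücker ring, on the closure of the points
of type `st_{2,2}`. -/
noncomputable def stToPlucker [IsDomain O] [FaithfulSMul O E] :
    StRing O E →ₐ[O] Polynomial (PluckerRing O) :=
  Ideal.Quotient.liftₐ (stIdeal O E) (toPlucker O) fun _ => toPlucker_eq_zero_of_mem O E

/-- The homomorphism given by the Plücker coordinates of the universal triple. -/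
noncomputable def stOfPlucker : Polynomial (PluckerRing O) →ₐ[O] StRing O E :=
  Polynomial.eval₂AlgHom (PluckerRing.lift (stCoords O E) (isPlucker_stCoords O E))
    (stUniv O E 0 1 1) fun _ => Commute.all (S := StRing O E) _ _

lemma stToPlucker_stUniv [IsDomain O] [FaithfulSMul O E] (a : Fin 3) (i j : Fin 2) :
    stToPlucker O E (stUniv O E a i j) = pluckerTriple O a i j := toPlucker_univ O a i j

@[simp] lemma stOfPlucker_X : stOfPlucker O E .X = stUniv O E 0 1 1 := by simp [stOfPlucker]

@[simp] lemma stOfPlucker_C_p (i j : Fin 5) :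
    stOfPlucker O E (.C (PluckerRing.p O i j)) = stCoords O E i j := by simp [stOfPlucker]

variable {O E} in
lemma st_algHom_ext {B : Type*} [CommRing B] [Algebra O B] {f g : StRing O E →ₐ[O] B}
    (h : ∀ a i j, f (stUniv O E a i j) = g (stUniv O E a i j)) : f = g := by
  refine Ideal.Quotient.algHom_ext _ ?_
  exact N22.algHom_ext h

lemma stToPlucker_comp_stOfPlucker [IsDomain O] [FaithfulSMul O E] :
    (stToPlucker O E).comp (stOfPlucker O E) = .id O _ := by
  refine Polynomial.algHom_ext' (PluckerRing.algHom_ext fun i j => ?_) ?_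
  · refine PluckerRing.map_p_eq_of_lt (f := (((stToPlucker O E).comp (stOfPlucker O E)).comp
      Polynomial.CAlgHom).toRingHom) (g := Polynomial.C) (fun i j hij => ?_) i j
    fin_cases i <;> fin_cases j <;> first | exact absurd hij (by decide) |
      simp [stCoords, skewFamily, stToPlucker_stUniv, pluckerTriple]
  · simp [stToPlucker_stUniv, pluckerTriple]

lemma stOfPlucker_comp_stToPlucker [IsDomain O] [FaithfulSMul O E] :
    (stOfPlucker O E).comp (stToPlucker O E) = .id O _ := by
  refine st_algHom_ext (B := StRing O E) fun a i j => ?_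
  have ht := trace_stUniv O E
  simp only [Matrix.trace_fin_two] at ht
  rw [AlgHom.comp_apply, stToPlucker_stUniv, AlgHom.id_apply]
  fin_cases a <;> fin_cases i <;> fin_cases j <;> simp [pluckerTriple, stCoords, skewFamily]
  linear_combination -ht

/-- The coordinate ring of the closure of the points of type `st_{2,2}` is a polynomial ring over
the Plücker ring. -/
noncomputable def stEquiv [IsDomain O] [FaithfulSMul O E] :
    StRing O E ≃ₐ[O] Polynomial (PluckerRing O) :=
  AlgEquiv.ofAlgHom (stToPlucker O E) (stOfPlucker O E) (stToPlucker_comp_stOfPlucker O E)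
    (stOfPlucker_comp_stToPlucker O E)

@[simp] lemma stEquiv_stUniv [IsDomain O] [FaithfulSMul O E] (a : Fin 3) (i j : Fin 2) :
    stEquiv O E (stUniv O E a i j) = pluckerTriple O a i j := stToPlucker_stUniv O E a i j

/-- Both ideals are generated by the same space of linear forms: the equations of the scalar triples
recover each `p i j`. In particular `p 0 1` comes from `p 0 1 + p 2 3`, the difference of the
diagonal entries of `X₁`. -/
lemma map_scalarIdeal [IsDomain O] [FaithfulSMul O E] :
    (scalarIdeal O E).map (stEquiv O E) = (PluckerRing.vertexIdeal O).map Polynomial.C := by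
  apply le_antisymm
  · have h (i j) : Polynomial.C (PluckerRing.p O i j) ∈
        (PluckerRing.vertexIdeal O).map Polynomial.C :=
      Ideal.mem_map_of_mem _ (PluckerRing.p_mem_vertexIdeal O i j)
    rw [Ideal.map_le_iff_le_comap]
    refine sup_le (sup_le ?_ ?_) ?_ <;> rw [Ideal.span_le]
    · rintro _ ⟨⟨i, j⟩, rfl⟩
      fin_cases i <;> fin_cases j <;> simp [pluckerTriple, h]
    · rintro _ ⟨⟨i, j⟩, rfl⟩
      fin_cases i <;> fin_cases j <;> simp [pluckerTriple, h, sub_mem]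
    · rintro _ (rfl | rfl | rfl) <;> simp [pluckerTriple, h, add_assoc, add_mem]
  · let J := (scalarIdeal O E).map (stEquiv O E)
    have h {x : StRing O E} (hx : x ∈ scalarIdeal O E) : stEquiv O E x ∈ J :=
      Ideal.mem_map_of_mem _ hx
    have hN (i j) : pluckerTriple O 1 i j ∈ J := by
      rw [← stEquiv_stUniv O E]
      exact h (Ideal.mem_sup_left (Ideal.mem_sup_left (Ideal.subset_span ⟨(i, j), rfl⟩)))
    have hX (i j) : pluckerTriple O 0 i j - pluckerTriple O 2 i j ∈ J := by
      rw [← stEquiv_stUniv O E, ← stEquiv_stUniv O E, ← map_sub]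
      exact h (Ideal.mem_sup_left (Ideal.mem_sup_right (Ideal.subset_span ⟨(i, j), rfl⟩)))
    have h01 : pluckerTriple O 0 0 1 ∈ J := by
      rw [← stEquiv_stUniv O E]
      exact h (Ideal.mem_sup_right (Ideal.subset_span (.inl rfl)))
    have h10 : pluckerTriple O 0 1 0 ∈ J := by
      rw [← stEquiv_stUniv O E]
      exact h (Ideal.mem_sup_right (Ideal.subset_span (.inr (.inl rfl))))
    have hd : pluckerTriple O 0 0 0 - pluckerTriple O 0 1 1 ∈ J := by
      rw [← stEquiv_stUniv O E, ← stEquiv_stUniv O E, ← map_sub]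
      exact h (Ideal.mem_sup_right (Ideal.subset_span (.inr (.inr rfl))))
    have h14 := hN 0 0
    have h24 := hN 0 1
    have h34 := hN 1 0
    have h04 := hN 1 1
    have h23 := hX 0 0
    have h02 := sub_mem h01 (hX 0 1)
    have h13 := sub_mem h10 (hX 1 0)
    simp [pluckerTriple] at h14 h24 h34 h04 h23 h02 h13 h01 h10 hd
    have h01' := (add_mem_cancel_right h23).1 (by simpa [add_sub_right_comm] using hd)
    rw [Ideal.map_le_iff_le_comap, PluckerRing.vertexIdeal, Ideal.span_le]
    rintro _ ⟨⟨i, j⟩, rfl⟩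
    have key (i j : Fin 5) (hij : i < j) : Polynomial.C (PluckerRing.p O i j) ∈ J := by
      fin_cases i <;> fin_cases j <;> first | exact absurd hij (by decide) | assumption
    rcases lt_trichotomy i j with hij | rfl | hij
    · exact key i j hij
    · simp [(PluckerRing.isPlucker_p O).self]
    · change Polynomial.C (PluckerRing.p O i j) ∈ J
      rw [(PluckerRing.isPlucker_p O).swap, map_neg, neg_mem_iff]
      exact key j i hij

end StRing

end N22

/-! ### Transfer of the singular locus and the theorem -/

lemma singularLocus_eq_of_algEquiv {O A B : Type u} [CommRing O] [CommRing A] [CommRing B]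
    [Algebra O A] [Algebra O B] (e : A ≃ₐ[O] B) {I : Ideal A} {J : Ideal B} (hIJ : I.map e = J)
    (h : singularLocus B = PrimeSpectrum.zeroLocus (J : Set B)) :
    singularLocus A = PrimeSpectrum.zeroLocus (I : Set A) := by
  ext q
  obtain ⟨p, rfl⟩ := (PrimeSpectrum.comapEquiv e.toRingEquiv).symm.surjective q
  refine (mem_singularLocus_comap_iff e.toRingEquiv p).trans ?_
  rw [h, ← hIJ, PrimeSpectrum.mem_zeroLocus, PrimeSpectrum.mem_zeroLocus]
  exact Ideal.map_le_iff_le_comap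

lemma N22.singularLocus_stRing (O E : Type u) [CommRing O] [IsDomain O] [IsRegularRing O] [Field E]
    [Algebra O E] [FaithfulSMul O E] (hO : ringKrullDim O ≤ 1) :
    singularLocus (N22.StRing O E) =
      PrimeSpectrum.zeroLocus (N22.scalarIdeal O E : Set (N22.StRing O E)) := by
  have h := PluckerRing.singularLocus_polynomial_eq O hO
  generalize hJ : (PluckerRing.vertexIdeal O).map Polynomial.C = J at h
  have key := singularLocus_eq_of_algEquiv (A := N22.StRing O E) (N22.stEquiv O E)
    (I := N22.scalarIdeal O E) (J := J)
  exact key ((N22.map_scalarIdeal O E).trans hJ) h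

theorem mainTheorem7 (O E : Type u) [CommRing O] [IsDomain O] [IsDiscreteValuationRing O]
    [Field E] [Algebra O E] [IsFractionRing O E] :
    ∃ (R : Type u) (_ : CommRing R) (_ : Algebra O R)
      (𝒜 : ℕ → Submodule O R) (_ : GradedAlgebra 𝒜)
      (e : N22.StRing O E ≃ₐ[O] Polynomial R),
      -- the degree zero part of `R` is `O`
      (Function.Injective (algebraMap O R) ∧ 𝒜 0 = LinearMap.range (Algebra.linearMap O R)) ∧
      -- domains, dimensions and flatness
      (IsDomain (IsLocalRing.ResidueField O ⊗[O] R) ∧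
        ringKrullDim (IsLocalRing.ResidueField O ⊗[O] R) = 7 ∧
        IsDomain (E ⊗[O] R) ∧ ringKrullDim (E ⊗[O] R) = 7 ∧
        IsDomain R ∧ Module.Flat O R ∧ ringKrullDim R = 8) ∧
      -- the singular locus
      (singularLocus (N22.StRing O E) =
          PrimeSpectrum.zeroLocus (N22.scalarIdeal O E : Set (N22.StRing O E)) ∧
        (N22.scalarIdeal O E).map e = (positiveIdeal 𝒜).map Polynomial.C ∧
        singularLocus R = PrimeSpectrum.zeroLocus (positiveIdeal 𝒜 : Set R)) ∧
      -- both fibres are rational away from an integral divisor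
      (IsRationalAwayFromIntegralDivisor (IsLocalRing.ResidueField O)
          (IsLocalRing.ResidueField O ⊗[O] R) 7 ∧
        IsRationalAwayFromIntegralDivisor E (E ⊗[O] R) 7) ∧
      -- normality (also of the fibres), Gorenstein, not a complete intersection
      (IsIntegrallyClosed R ∧ IsIntegrallyClosed (IsLocalRing.ResidueField O ⊗[O] R) ∧
        IsIntegrallyClosed (E ⊗[O] R) ∧ IsGorenstein R ∧ ¬ IsCompleteIntersection R) ∧
      -- the class groups vanish
      (Subsingleton (DivisorClassGroup R) ∧
        Subsingleton (DivisorClassGroup (IsLocalRing.ResidueField O ⊗[O] R)) ∧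
        Subsingleton (DivisorClassGroup (E ⊗[O] R))) := by
  have hO : ringKrullDim O = 1 := IsDiscreteValuationRing.ringKrullDim_eq_one O
  have : FaithfulSMul O E := (faithfulSMul_iff_algebraMap_injective O E).2
    (IsFractionRing.injective O E)
  refine ⟨PluckerRing O, inferInstance, inferInstance, PluckerRing.grading O, inferInstance,
    N22.stEquiv O E,
    ⟨PluckerRing.algebraMap_injective O, PluckerRing.grading_zero⟩,
    ⟨inferInstance, PluckerRing.ringKrullDim_fibre O _, inferInstance,
      PluckerRing.ringKrullDim_fibre O _, inferInstance, inferInstance, ?_⟩,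
    ⟨?_, ?_, ?_⟩,
    ⟨PluckerRing.isRationalAwayFromIntegralDivisor_fibre O _,
      PluckerRing.isRationalAwayFromIntegralDivisor_fibre O _⟩,
    -- Normality of the ring and of both fibres is an instance of factoriality, which also gives the
    -- vanishing of the class groups.
    ⟨inferInstance, inferInstance, inferInstance, PluckerRing.isGorenstein O,
      PluckerRing.not_isCompleteIntersection O⟩,
    subsingleton_divisorClassGroup _, subsingleton_divisorClassGroup _,
    subsingleton_divisorClassGroup _⟩
  · rw [PluckerRing.ringKrullDim_eq, hO]
    rfl
  · exact N22.singularLocus_stRing O E hO.le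
  · rw [PluckerRing.positiveIdeal_grading, N22.map_scalarIdeal]
  · rw [PluckerRing.positiveIdeal_grading, PluckerRing.singularLocus_eq O hO.le]
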